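/- Let $d\ge 3$, let $\Omega\subset\mathbb R^d$ be a bounded open set with $C^2$ boundary and outward unit normal $\boldsymbol\nu$, and let $\rho\in C^\infty(\overline\Omega)$, $\mu,\lambda\in C^1(\overline\Omega)$ satisfy, on $\overline\Omega$, $d\lambda+2\mu>0$ and $$0<\rho\le\rho_1,\qquad 0<\mu_0\le\mu\le\mu_1,\qquad \lambda_0\le\lambda\le\lambda_1$$ with constants $\rho_1,\mu_0,\mu_1,\lambda_0,\lambda_1$. Here a function is $C^k$ on a compact set if it is $C^k$ on a neighbourhood of it. Write $(\nabla\boldsymbol v)_{ij}=\partial_{x_j}v_i$, $A:B=\sum_{i,j}A_{ij}B_{ij}$, $|A|^2=A:A$, and let $I_d$ be the unit matrix. Let $\boldsymbol u\in C^2([0,T]\times\overline\Omega;\mathbb R^d)$ satisfy $$\rho\,\partial_t^2\boldsymbol u=\nabla\cdot\big(\mu(\nabla\boldsymbol u+\nabla\boldsymbol u^\top)\big)+\nabla(\lambda\nabla\cdot\boldsymbol u)\ \text{ in }(0,T)\times\Omega,\qquad \boldsymbol u=\boldsymbol 0\ \text{ on }(0,T)\times\partial\Omega,$$ with energy $$E(t)=\int_\Omega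 |\sqrt\rho\,\partial_t\boldsymbol u|^2+\big(\mu(\nabla\boldsymbol u+\nabla\boldsymbol u^\top)+\lambda(\nabla\cdot\boldsymbol u)I_d\big):\nabla\boldsymbol u\,dx .$$ Let $x_0\in\mathbb R^d\setminus\overline\Omega$, $l(x)=|x-x_0|^2/2$, and $\Gamma=\{x\in\partial\Omega:\nabla l\cdot\boldsymbol\nu>0\}$. Suppose that for some constants $\rho_2,c_0,c_1>0$ one has $1+(\nabla\rho\cdot\nabla l)/\rho>\rho_2$ on $\overline\Omega$ and, for every $t\in[0,T]$ (at which $\boldsymbol u$ is evaluated), $$\int_\Omega\big(\mu(\nabla\boldsymbol u+\nabla\boldsymbol u^\top)+\lambda(\nabla\cdot\boldsymbol u)I_d\big):\nabla\boldsymbol u\,dx\ \ge\ c_0\int_\Omega|\nabla\boldsymbol u|^2dx,$$ $$\int_\Omega\Big[\big(\mu(\nabla\boldsymbol u+\nabla\boldsymbol u^\top)+\lambda(\nabla\cdot\boldsymbol u)I_d\big):\nabla\boldsymbol u-\sum_{i=1}^d\Big(\big(\partial_{x_i}\mu(\nabla\boldsymbol u+\nabla\boldsymbol u^\top)+\partial_{x_i}\lambda(\nabla\cdot\boldsymbol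 u)I_d\big):\nabla\boldsymbol u\Big)\partial_{x_i}l\Big]dx\ \ge\ c_1\int_\Omega|\nabla\boldsymbol u|^2dx$$ (for instance, because the corresponding inequalities between the integrands hold pointwise). Put $$C_0=\min\{\rho_2,c_1\},\qquad C_1=\max\Big\{\sqrt2,\ \frac{\sqrt{1+\mu_0}}{2\mu_0},\ \sqrt{\frac{5}{4\mu_0}},\ \frac1{\mu_0}\Big\}\max_{\overline\Omega}|\nabla l|,$$ $$C_2=\max\Big\{\frac{\rho_1}2,\ 2c_0^{-1}\max_{\overline\Omega}|\nabla l|^2\Big\},\qquad C_3=\max\{1,\ 2\mu_1+\max\{|\lambda_0|,|\lambda_1|\}\}.$$ If $T>2C_2C_3/C_0$, then $$E(0)\le\frac{C_1C_3}{TC_0-2C_2C_3}\int_0^T\!\!\int_\Gamma\big|\mu\,\partial_{\boldsymbol\nu}\boldsymbol u+\mu\nabla\boldsymbol u^\top\cdot\boldsymbol\nu+\lambda(\nabla\cdot\boldsymbol u)\boldsymbol\nu\big|^2\,dS\,dt .$$ -/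

import Mathlib

open MeasureTheory Set
open scoped Matrix ContDiff

noncomputable section

namespace ElasticWave

variable {d : ℕ}

/-- `f` is of class `C^k` on the (typically compact) set `K`, up to the boundary of `K`:
it is defined and `C^k` on an open neighbourhood of `K`. -/
def ContDiffNear {E F : Type*} [NormedAddCommGroup E] [NormedSpace ℝ E]
    [NormedAddCommGroup F] [NormedSpace ℝ F] (k : WithTop ℕ∞) (f : E → F) (K : Set E) : Prop :=
  ∃ O : Set E, IsOpen O ∧ K ⊆ O ∧ ContDiffOn ℝ k f O

/-- `Ω` is a bounded domain with `C²` boundary (not necessarily connected), presented by a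
defining function `φ`: `Ω = {φ < 0}`, and the gradient of `φ` does not vanish on `{φ = 0}`
(so that `{φ = 0}` is the boundary of `Ω`). -/
structure IsC2Domain (Ω : Set (EuclideanSpace ℝ (Fin d)))
    (φ : EuclideanSpace ℝ (Fin d) → ℝ) : Prop where
  bounded : Bornology.IsBounded Ω
  contDiff : ContDiff ℝ 2 φ
  eq_lt : Ω = {x | φ x < 0}
  gradient_ne : ∀ x, φ x = 0 → gradient φ x ≠ 0

/-- The outward unit normal of `{φ < 0}`. -/
def outwardNormal (φ : EuclideanSpace ℝ (Fin d) → ℝ) (x : EuclideanSpace ℝ (Fin d)) :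
    EuclideanSpace ℝ (Fin d) :=
  ‖gradient φ x‖⁻¹ • gradient φ x

/-- The partial derivative `∂_{x_i} f`. -/
def pderiv (i : Fin d) (f : EuclideanSpace ℝ (Fin d) → ℝ) (x : EuclideanSpace ℝ (Fin d)) : ℝ :=
  fderiv ℝ f x (EuclideanSpace.single i 1)

/-- The gradient tensor `∇v`, with `(i, j)` entry `∂_{x_j} v_i`. -/
def gradT (v : EuclideanSpace ℝ (Fin d) → EuclideanSpace ℝ (Fin d))
    (x : EuclideanSpace ℝ (Fin d)) : Matrix (Fin d) (Fin d) ℝ :=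
  Matrix.of fun i j => pderiv j (fun y => v y i) x

/-- The divergence `∇ · v`. -/
def divergence (v : EuclideanSpace ℝ (Fin d) → EuclideanSpace ℝ (Fin d))
    (x : EuclideanSpace ℝ (Fin d)) : ℝ :=
  ∑ i, pderiv i (fun y => v y i) x

/-- The product `A : B = ∑ A_ij B_ij`; in particular `|A|² = A : A`. -/
def ddot (A B : Matrix (Fin d) (Fin d) ℝ) : ℝ :=
  ∑ i, ∑ j, A i j * B i j

/-- The tensor `a (∇v + ∇vᵀ) + b (∇ · v) I_d` at `x`, for real numbers `a`, `b`. -/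
def stress (a b : ℝ) (v : EuclideanSpace ℝ (Fin d) → EuclideanSpace ℝ (Fin d))
    (x : EuclideanSpace ℝ (Fin d)) : Matrix (Fin d) (Fin d) ℝ :=
  a • (gradT v x + (gradT v x)ᵀ) + (b * divergence v x) • (1 : Matrix (Fin d) (Fin d) ℝ)

/-- The elastic operator
`L_ρ v = ρ⁻¹ (∇ · (μ (∇v + ∇vᵀ)) + ∇ (λ ∇ · v))`. -/
def elasticOp (rho mu lam : EuclideanSpace ℝ (Fin d) → ℝ)
    (v : EuclideanSpace ℝ (Fin d) → EuclideanSpace ℝ (Fin d))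
    (x : EuclideanSpace ℝ (Fin d)) : EuclideanSpace ℝ (Fin d) :=
  WithLp.toLp 2 fun i =>
    (rho x)⁻¹ *
      ((∑ j, pderiv j (fun y => mu y * (gradT v y i j + gradT v y j i)) x)
        + pderiv i (fun y => lam y * divergence v y) x)

/-- The surface traction `μ ∂_ν v + μ ∇vᵀ · ν + λ (∇ · v) ν` at `x`, for the normal `n` at `x`. -/
def traction (mu lam : EuclideanSpace ℝ (Fin d) → ℝ)
    (v : EuclideanSpace ℝ (Fin d) → EuclideanSpace ℝ (Fin d))
    (n x : EuclideanSpace ℝ (Fin d)) : EuclideanSpace ℝ (Fin d) :=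
  mu x • fderiv ℝ v x n
    + mu x • WithLp.toLp 2 ((gradT v x)ᵀ *ᵥ fun i => n i)
    + (lam x * divergence v x) • n

/-- `u` is a `C²` solution on `[0, T] × closure Ω` of `∂_t² u = L_ρ u` in `(0, T) × Ω` with
`u = 0` on `(0, T) × ∂Ω`. -/
structure IsSolution (Ω : Set (EuclideanSpace ℝ (Fin d))) (T : ℝ)
    (rho mu lam : EuclideanSpace ℝ (Fin d) → ℝ)
    (u : ℝ → EuclideanSpace ℝ (Fin d) → EuclideanSpace ℝ (Fin d)) : Prop where
  contDiff : ContDiffNear 2 (fun p : ℝ × EuclideanSpace ℝ (Fin d) => u p.1 p.2)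
    (Icc 0 T ×ˢ closure Ω)
  wave : ∀ t ∈ Ioo 0 T, ∀ x ∈ Ω,
    deriv (fun s => deriv (fun r => u r x) s) t = elasticOp rho mu lam (u t) x
  boundary : ∀ t ∈ Ioo 0 T, ∀ x ∈ frontier Ω, u t x = 0

/-- The energy
`E(t) = ∫_Ω |√ρ ∂_t u|² + (μ (∇u + ∇uᵀ) + λ (∇ · u) I_d) : ∇u dx`. -/
def energy (Ω : Set (EuclideanSpace ℝ (Fin d))) (rho mu lam : EuclideanSpace ℝ (Fin d) → ℝ)
    (u : ℝ → EuclideanSpace ℝ (Fin d) → EuclideanSpace ℝ (Fin d)) (t : ℝ) : ℝ :=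
  ∫ x in Ω, (‖Real.sqrt (rho x) • deriv (fun s => u s x) t‖ ^ 2
    + ddot (stress (mu x) (lam x) (u t) x) (gradT (u t) x))

/-- The two coercivity conditions that define the admissible Lamé parameters, on the displacement
field `v`, in integrated form. The integrated form follows from the pointwise inequalities for `v`;
pointwise inequalities for *all* fields cannot hold, since the left-hand sides vanish where `∇v` is
skew-symmetric. -/
structure LameAdmissible (Ω : Set (EuclideanSpace ℝ (Fin d)))
    (mu lam l : EuclideanSpace ℝ (Fin d) → ℝ) (c0 c1 : ℝ)
    (v : EuclideanSpace ℝ (Fin d) → EuclideanSpace ℝ (Fin d)) : Prop where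
  coercive : c0 * ∫ x in Ω, ddot (gradT v x) (gradT v x)
    ≤ ∫ x in Ω, ddot (stress (mu x) (lam x) v x) (gradT v x)
  coercive_weight : c1 * ∫ x in Ω, ddot (gradT v x) (gradT v x)
    ≤ ∫ x in Ω, (ddot (stress (mu x) (lam x) v x) (gradT v x)
        - ∑ i, ddot (stress (pderiv i mu x) (pderiv i lam x) v x) (gradT v x) * pderiv i l x)

/-- The weight `l(x) = |x - x₀|² / 2`. -/
def weight (x0 x : EuclideanSpace ℝ (Fin d)) : ℝ := ‖x - x0‖ ^ 2 / 2

/-- `max |∇l|` over `closure Ω`. -/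
def maxGrad (Ω : Set (EuclideanSpace ℝ (Fin d))) (l : EuclideanSpace ℝ (Fin d) → ℝ) : ℝ :=
  sSup ((fun x => ‖gradient l x‖) '' closure Ω)

/-- The observed part `Γ = {x ∈ ∂Ω : ∇l · ν > 0}` of the boundary of `Ω = {φ < 0}`. -/
def obsBoundary (Ω : Set (EuclideanSpace ℝ (Fin d))) (φ l : EuclideanSpace ℝ (Fin d) → ℝ) :
    Set (EuclideanSpace ℝ (Fin d)) :=
  {x ∈ frontier Ω | 0 < inner ℝ (gradient l x) (outwardNormal φ x)}

/-- `C₀ = min {ρ₂, c₁}`. -/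
def constC0 (rho2 c1 : ℝ) : ℝ := min rho2 c1

/-- `C₁ = max {√2, √(1 + μ₀) / (2 μ₀), √(5 / (4 μ₀)), 1 / μ₀} · M`, where `M = max |∇l|`. -/
def constC1 (mu0 M : ℝ) : ℝ :=
  max (max (max (Real.sqrt 2) (Real.sqrt (1 + mu0) / (2 * mu0))) (Real.sqrt (5 / (4 * mu0))))
    (1 / mu0) * M

/-- `C₂ = max {ρ₁ / 2, 2 c₀⁻¹ M²}`, where `M = max |∇l|`. -/
def constC2 (rho1 c0 M : ℝ) : ℝ := max (rho1 / 2) (2 * c0⁻¹ * M ^ 2)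

/-- `C₃ = max {1, 2 μ₁ + max {|λ₀|, |λ₁|}}`. -/
def constC3 (mu1 lam0 lam1 : ℝ) : ℝ := max 1 (2 * mu1 + max |lam0| |lam1|)

end ElasticWave

end

/-! The argument is the multiplier method with multiplier `m = 2 (x - x₀)·∇u + (d - 1) u`. Pairing
the wave equation with `m` shows that `∂_t (ρ ∂_t u · m)` is a spatial divergence, minus `(ρ +
∇ρ·∇l) |∂_t u|²`, minus the elastic density corrected by derivatives of the Lamé parameters
(`SmoothData.dirD_multiplier`). The coefficient `d - 1` is what leaves exactly one copy of each
density. By the assumptions on `ρ` and the second coercivity condition, the integral of the last two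
terms is at least `ρ₂ ∫ ρ |∂_t u|² + c₁ ∫ |∇u|²`, and hence at least `C₀ E / C₃`, where `E` is the
conserved energy (`SolutionData.energy_eq`, `SolutionData.strain_le`). Integrating over `[0, T]`
produces `T C₀ E / C₃`. The terms at `t = 0` and `t = T` cost at most `C₂ E` each
(`SolutionData.abs_multiplier_le`).

What remains is the boundary flux. There `u` and `∂_t u` vanish and `∇u = c ⊗ ν`, so the flux
collapses to `(∇l·ν) σ : ∇u`. The elastic density is nonnegative for such rank-one gradients, so the
part of the boundary outside `Γ` has the favourable sign; on `Γ`, `μ σ : ∇u ≤ |σν|²`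
(`traction_algebra`, `SolutionData.flux_normal_le`).

Two integral bounds rest on null-form identities with zero boundary values. `∫ (∇·u)² = ∫ ∇u : ∇uᵀ`
gives the factor `2 μ₁ + max |λ|` with no dimensional constant, and the divergence of `(x - x₀)
|u|²` gives `∫ |m|² ≤ 4 M² ∫ |∇u|²` with no Poincaré inequality.

Surface integrals use Hausdorff measure, and the only form of the divergence theorem required is the
one-sided `∫ div F ≤ ∫ (F·ν)⁺` (`ofReal_integral_divergence_le`). Applied to `F` and `-F` it yields
`∫ div F = 0` when `F` vanishes on the boundary. It is proved by cutting `F` off in a thin layer and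
controlling the layer integral by slicing along lines close to the normal: orthogonal projection
does not increase Hausdorff measure, so no area formula enters. -/

section Layer
-- Slicing along lines, projections and Hausdorff measure, level sets as Lipschitz graphs.
open Metric Topology

variable {V : Type*} [NormedAddCommGroup V] [InnerProductSpace ℝ V] [FiniteDimensional ℝ V]
  [MeasurableSpace V] [BorelSpace V]

theorem lintegral_eq_lintegral_lines {e : V} (he : ‖e‖ = 1) {f : V → ENNReal} (hf : Measurable f) :
    ∫⁻ x, f x = ∫⁻ y : (ℝ ∙ e)ᗮ, ∫⁻ s : ℝ, f (s • e + (y : V)) := by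
  have h1 := ((ℝ ∙ e).measurePreserving_measurableEquivProd (0 : V)).symm
  rw [InnerProductSpace.euclideanHausdorffMeasure_eq_volume] at h1
  rw [← h1.lintegral_comp hf, Measure.volume_eq_prod,
    lintegral_prod_symm' (fun z => f (((ℝ ∙ e).measurableEquivProd (0 : V)).symm z))
      (hf.comp (MeasurableEquiv.measurable _))]
  refine lintegral_congr fun y => ?_
  have h2 := (LinearIsometryEquiv.toSpanUnitSingleton (𝕜 := ℝ) e he).measurePreserving
  rw [← h2.lintegral_comp (by
    exact (hf.comp (MeasurableEquiv.measurable _)).comp measurable_prodMk_right)]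
  refine lintegral_congr fun s => ?_
  simp

/-- Orthogonal projection is 1-Lipschitz, so it does not increase Hausdorff measure. Neither `f` nor
`S` is assumed measurable: in the application `f` is built by choice, and the proof compares
measures instead of manipulating `f`. -/
theorem lintegral_le_setLIntegral_proj (K : Submodule ℝ V) {n : ℕ} (hn : Module.finrank ℝ K = n)
    {S : Set V} {f : K → ENNReal} (hf : ∀ y, f y ≠ 0 → ∃ x ∈ S, K.orthogonalProjectionOnto x = y) :
    ∫⁻ y, f y ≤ ∫⁻ x in S, f (K.orthogonalProjectionOnto x)
      ∂(Measure.euclideanHausdorffMeasure n) := by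
  set P : V → K := fun x => K.orthogonalProjectionOnto x with hP
  have hPm : Measurable P := K.orthogonalProjectionOnto.continuous.measurable
  have h1 : f = (P '' S).indicator f := by
    ext y
    by_cases hy : y ∈ P '' S
    · simp [hy]
    · rw [indicator_of_notMem hy]
      by_contra h
      exact hy (hf y h)
  -- Testing on measurable `B` alone suffices, so `P '' S` need not be measurable.
  have h2 : (volume : Measure K).restrict (P '' S) ≤
      Measure.map P ((Measure.euclideanHausdorffMeasure n).restrict S) := by
    refine Measure.le_intro fun B hB _ => ?_
    rw [Measure.restrict_apply hB, Measure.map_apply hPm hB, Measure.restrict_apply (hPm hB)]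
    have h3 : B ∩ P '' S = P '' (P ⁻¹' B ∩ S) := by rw [inter_comm, inter_comm (P ⁻¹' B), image_inter_preimage]
    rw [h3, ← InnerProductSpace.euclideanHausdorffMeasure_eq_volume, hn,
      Measure.euclideanHausdorffMeasure_def, Measure.euclideanHausdorffMeasure_def,
      Measure.smul_apply, Measure.smul_apply]
    gcongr
    exact hausdorffMeasure_orthogonalProjectionOnto_le K _ _ (by positivity)
  calc ∫⁻ y, f y = ∫⁻ y, (P '' S).indicator f y := by rw [← h1]
    _ ≤ ∫⁻ y in P '' S, f y := lintegral_indicator_le _ _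
    _ ≤ ∫⁻ y, f y ∂(Measure.map P ((Measure.euclideanHausdorffMeasure n).restrict S)) :=
        lintegral_mono' h2 le_rfl
    _ ≤ _ := lintegral_map_le _ _

/-- The projection restricted to `S` is antilipschitz, so the measure of `S` is at most a constant
times the Lebesgue measure of its bounded image. -/
theorem euclideanHausdorffMeasure_lt_top_of_dist_le_proj (K : Submodule ℝ V) {n : ℕ}
    (hn : Module.finrank ℝ K = n) {S : Set V} (hS : Bornology.IsBounded S) {C : NNReal}
    (h : ∀ x ∈ S, ∀ y ∈ S, dist x y ≤
      C * dist (K.orthogonalProjectionOnto x) (K.orthogonalProjectionOnto y)) :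
    Measure.euclideanHausdorffMeasure n S < ⊤ := by
  set P : V → K := fun x => K.orthogonalProjectionOnto x with hP
  have h1 : AntilipschitzWith C (fun x : S => P x) :=
    AntilipschitzWith.of_le_mul_dist fun x y => h x x.2 y y.2
  have h2 := h1.le_hausdorffMeasure_image (d := n) (by positivity) univ
  have h3 : (fun x : S => P x) '' univ = P '' S := by
    rw [image_univ]; exact (image_eq_range P S).symm
  have h4 : Measure.hausdorffMeasure (n : ℝ) (univ : Set S) = Measure.hausdorffMeasure (n : ℝ) S := by
    rw [← isometry_subtype_coe.hausdorffMeasure_image (Or.inl (by positivity))]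
    simp
  have h5 : Measure.euclideanHausdorffMeasure n (P '' S) < ⊤ := by
    have h6 : Bornology.IsBounded (P '' S) :=
      K.lipschitzWith_orthogonalProjectionOnto.isBounded_image hS
    rw [← hn, InnerProductSpace.euclideanHausdorffMeasure_eq_volume]
    exact h6.measure_lt_top
  rw [Measure.euclideanHausdorffMeasure_def, Measure.smul_apply] at h5 ⊢
  rw [h3, h4] at h2
  refine lt_of_le_of_lt (smul_le_smul_of_nonneg_left h2 zero_le) ?_
  rw [ENNReal.smul_def, smul_eq_mul] at h5 ⊢
  rw [mul_left_comm]
  exact ENNReal.mul_lt_top (by simp) h5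


/-- The derivative of a monotone cutoff along an increasing function has integral at most one. -/
theorem lintegral_deriv_comp_le_one {q : ℝ → ℝ} (hq : ContDiff ℝ 1 q) (hq0 : ∀ s, 0 ≤ q s)
    (hq1 : ∀ s, q s ≤ 1) (hqm : Monotone q) {ψ ψ' : ℝ → ℝ} (hψ : ∀ s, HasDerivAt ψ (ψ' s) s)
    (hψ' : Continuous ψ') {a b : ℝ} (h : ∀ s ∈ Ioo a b, 0 ≤ ψ' s) :
    ∫⁻ s in Ioo a b, ENNReal.ofReal (deriv q (ψ s) * ψ' s) ≤ 1 := by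
  rcases le_or_gt b a with hab | hab
  · simp [Ioo_eq_empty_of_le hab]
  have hψc : Continuous ψ := continuous_iff_continuousAt.2 fun s => (hψ s).continuousAt
  have hc : Continuous fun s => deriv q (ψ s) * ψ' s :=
    ((hq.continuous_deriv le_rfl).comp hψc).mul hψ'
  have hnn : ∀ s ∈ Ioo a b, 0 ≤ deriv q (ψ s) * ψ' s := fun s hs =>
    mul_nonneg hqm.deriv_nonneg (h s hs)
  rw [← ofReal_integral_eq_lintegral_ofReal]
  · rw [← integral_Ioc_eq_integral_Ioo, ← intervalIntegral.integral_of_le hab.le,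
      intervalIntegral.integral_eq_sub_of_hasDerivAt (f := fun s => q (ψ s))
      (fun s _ => ((hq.differentiable one_ne_zero _).hasDerivAt.comp s (hψ s)))
      (hc.intervalIntegrable _ _)]
    rw [ENNReal.ofReal_le_one]
    linarith [hq0 (ψ a), hq1 (ψ b)]
  · exact (hc.integrableOn_Icc (a := a) (b := b)).mono_set Ioo_subset_Icc_self
  · exact (ae_restrict_mem measurableSet_Ioo).mono hnn

omit [FiniteDimensional ℝ V] [MeasurableSpace V] [BorelSpace V] in
-- Along `e` the function grows at rate at least `c`, so from a value above `-ε` it reaches zero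
-- within distance `ε / c ≤ η`, before the path can leave the `η`-thickening of `A`.
theorem exists_zero_along_line {φ : V → ℝ} (hφ : ContDiff ℝ 1 φ) {e : V} (he : ‖e‖ = 1)
    {U : Set V} {c : ℝ} (hc : 0 < c) (hU : ∀ x ∈ U, c ≤ fderiv ℝ φ x e) {A : Set V} {η : ℝ}
    (hη : cthickening η A ⊆ U) {ε : ℝ} (hε : 0 < ε) (hεη : ε ≤ c * η) {x : V} (hx : x ∈ A)
    (hx1 : -ε < φ x) (hx2 : φ x < 0) :
    ∃ z ∈ U, φ z = 0 ∧ (∃ τ : ℝ, z = x + τ • e) ∧ dist x z ≤ ε / c := by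
  have hmem : ∀ τ ∈ Icc 0 (ε / c), x + τ • e ∈ U := fun τ hτ => by
    refine hη (mem_cthickening_of_dist_le _ x _ _ hx ?_)
    rw [dist_eq_norm, add_sub_cancel_left, norm_smul, he, mul_one, Real.norm_of_nonneg hτ.1]
    refine hτ.2.trans ?_
    rw [div_le_iff₀ hc]; linarith
  have hd : ∀ τ : ℝ, HasDerivAt (fun τ : ℝ => φ (x + τ • e)) (fderiv ℝ φ (x + τ • e) e) τ := by
    intro τ
    have h1 : HasDerivAt (fun τ : ℝ => x + τ • e) e τ := by
      simpa using ((hasDerivAt_id τ).smul_const e).const_add x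
    exact ((hφ.differentiable one_ne_zero _).hasFDerivAt).comp_hasDerivAt τ h1
  have hcont : Continuous (fun τ : ℝ => φ (x + τ • e)) :=
    continuous_iff_continuousAt.2 fun s => (hd s).continuousAt
  have h0 : (0 : ℝ) ≤ ε / c := by positivity
  have hmv := (convex_Icc (0 : ℝ) (ε / c)).mul_sub_le_image_sub_of_le_deriv
    hcont.continuousOn (fun τ _ => (hd τ).differentiableAt.differentiableWithinAt)
    (C := c) (fun τ hτ => by
      rw [(hd τ).deriv]; exact hU _ (hmem τ (interior_subset hτ)))
    0 (left_mem_Icc.2 h0) (ε / c) (right_mem_Icc.2 h0) h0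
  rw [sub_zero, mul_div_cancel₀ _ hc.ne'] at hmv
  simp only [zero_smul, add_zero] at hmv
  obtain ⟨τ, hτ, hτ0⟩ := intermediate_value_Icc h0 hcont.continuousOn
    (show (0 : ℝ) ∈ Icc _ _ from ⟨by simpa using hx2.le, by linarith⟩)
  refine ⟨x + τ • e, hmem τ hτ, hτ0, ⟨τ, rfl⟩, ?_⟩
  rw [dist_comm, dist_eq_norm, add_sub_cancel_left, norm_smul, he, mul_one,
    Real.norm_of_nonneg hτ.1]
  exact hτ.2

omit [FiniteDimensional ℝ V] [MeasurableSpace V] [BorelSpace V] in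
-- The mean value inequality for `φ - N ⟨e, ·⟩` bounds the `e`-component of `x - y` by half of `‖x -
-- y‖`. The orthogonal component must carry the other half: a level set is a Lipschitz graph over
-- the hyperplane orthogonal to `e`.
theorem dist_le_proj_of_fderiv_near {φ : V → ℝ} (hφ : ContDiff ℝ 1 φ) {e : V} (he : ‖e‖ = 1)
    {U : Set V} (hUc : Convex ℝ U) {N : ℝ} (hN : 0 < N)
    (hU : ∀ x ∈ U, ‖fderiv ℝ φ x - N • innerSL ℝ e‖ ≤ N / 2) {x y : V} (hx : x ∈ U) (hy : y ∈ U)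
    (hxy : φ x = φ y) :
    dist x y ≤ (2 : NNReal) * dist ((ℝ ∙ e)ᗮ.orthogonalProjectionOnto x)
      ((ℝ ∙ e)ᗮ.orthogonalProjectionOnto y) := by
  have h1 := hUc.norm_image_sub_le_of_norm_hasFDerivWithin_le'
    (fun z _ => (hφ.differentiable one_ne_zero z).hasFDerivAt.hasFDerivWithinAt) hU hy hx
  rw [hxy, sub_self, zero_sub, norm_neg] at h1
  simp only [_root_.smul_apply, innerSL_apply_apply, smul_eq_mul, norm_mul,
    Real.norm_of_nonneg hN.le] at h1
  have h2 : ‖inner ℝ e (x - y)‖ ≤ 1 / 2 * ‖x - y‖ := by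
    have := le_of_mul_le_mul_left (a := N) (b := ‖inner ℝ e (x - y)‖) (c := 1 / 2 * ‖x - y‖)
      (by linarith) hN
    exact this
  have h3 : x - y = inner ℝ e (x - y) • e +
      (((ℝ ∙ e)ᗮ.orthogonalProjectionOnto (x - y) : (ℝ ∙ e)ᗮ) : V) := by
    have := Submodule.starProjection_add_starProjection_orthogonal (K := ℝ ∙ e) (x - y)
    rw [Submodule.starProjection_unit_singleton ℝ he] at this
    exact this.symm
  have h4 : ‖x - y‖ ≤ ‖inner ℝ e (x - y)‖ + ‖(ℝ ∙ e)ᗮ.orthogonalProjectionOnto (x - y)‖ := by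
    conv_lhs => rw [h3]
    refine (norm_add_le _ _).trans ?_
    rw [norm_smul, he, mul_one]; rfl
  rw [dist_eq_norm, dist_eq_norm, ← map_sub]
  push_cast
  linarith

end Layer

/-! ### Layer integrals bounded by integrals over the level set. -/

section Layer
open Metric Topology

variable {V : Type*} [NormedAddCommGroup V] [InnerProductSpace ℝ V] [FiniteDimensional ℝ V]
  [MeasurableSpace V] [BorelSpace V]

/-- Tubular neighbourhoods: an integral over a thin layer `{-ε < φ < 0}` is controlled by the
integral over the level set `{φ = 0}`. -/
theorem exists_nhds_layer_le {φ : V → ℝ} (hφ : ContDiff ℝ 1 φ) {p : V} (hp : fderiv ℝ φ p ≠ 0)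
    {δ : ℝ} (hδ : 0 < δ) : ∃ U : Set V, IsOpen U ∧ p ∈ U ∧ Bornology.IsBounded U ∧
      Measure.euclideanHausdorffMeasure (Module.finrank ℝ V - 1) (U ∩ {x | φ x = 0}) < ⊤ ∧
      ∀ g : V → ℝ, Continuous g → (∀ x, 0 ≤ g x) → HasCompactSupport g → tsupport g ⊆ U →
      ∀ κ : ℝ, 0 < κ → ∃ ε₀ > 0, ∀ ε, 0 < ε → ε ≤ ε₀ → ∀ q : ℝ → ℝ, ContDiff ℝ 1 q →
        (∀ s, 0 ≤ q s) → (∀ s, q s ≤ 1) → Monotone q →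
        (∀ s, deriv q s ≠ 0 → s ∈ Ioo (-ε) 0) →
        ∫⁻ x, ENNReal.ofReal (g x * deriv q (φ x) * ‖fderiv ℝ φ x‖) ≤
          ENNReal.ofReal (1 + δ) * ∫⁻ x in U ∩ {x | φ x = 0}, ENNReal.ofReal (g x + κ)
            ∂(Measure.euclideanHausdorffMeasure (Module.finrank ℝ V - 1)) := by
  set N : ℝ := ‖fderiv ℝ φ p‖ with hN
  have hN0 : 0 < N := norm_pos_iff.2 hp
  have hfc : Continuous (fderiv ℝ φ) := hφ.continuous_fderiv one_ne_zero
  obtain ⟨e, he, hpe⟩ : ∃ e : V, ‖e‖ = 1 ∧ fderiv ℝ φ p = N • innerSL ℝ e := by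
    set w := (InnerProductSpace.toDual ℝ V).symm (fderiv ℝ φ p) with hw
    have hwN : ‖w‖ = N := by rw [hw, LinearIsometryEquiv.norm_map]
    refine ⟨N⁻¹ • w, ?_, ?_⟩
    · rw [norm_smul, hwN, norm_inv, Real.norm_of_nonneg hN0.le, inv_mul_cancel₀ hN0.ne']
    · ext v
      simp only [map_smul, _root_.smul_apply, innerSL_apply_apply, smul_eq_mul, hw,
        InnerProductSpace.toDual_symm_apply]
      rw [mul_inv_cancel_left₀ hN0.ne']
  have hpee : fderiv ℝ φ p e = N := by
    rw [hpe]; simp [he]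
  -- The first condition trades the full gradient norm for the derivative along `e` at the price `1
  -- + δ`; the second makes the level set a graph.
  have hnear : ∀ᶠ x in 𝓝 p, ‖fderiv ℝ φ x‖ < (1 + δ) * fderiv ℝ φ x e ∧
      ‖fderiv ℝ φ x - N • innerSL ℝ e‖ < N / 2 := by
    refine Filter.Eventually.and ?_ ?_
    · refine (hfc.norm.continuousAt).eventually_lt
        ((continuous_const.mul (hfc.clm_apply continuous_const)).continuousAt) ?_
      rw [hpee]; nlinarith
    · refine ((hfc.sub continuous_const).norm.continuousAt).eventually_lt continuousAt_const ?_
      rw [← hpe]; simpa using hN0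
  obtain ⟨R, hR, hball⟩ := Metric.eventually_nhds_iff_ball.1 hnear
  set P : V →L[ℝ] (ℝ ∙ e)ᗮ := (ℝ ∙ e)ᗮ.orthogonalProjectionOnto with hP
  have hdec : ∀ x : V, x = inner ℝ e x • e + (P x : V) := fun x => by
    have := Submodule.starProjection_add_starProjection_orthogonal (K := ℝ ∙ e) x
    rw [Submodule.starProjection_unit_singleton ℝ he] at this
    exact this.symm
  have hPe : P e = 0 := by
    refine Submodule.orthogonalProjectionOnto_apply_of_mem_orthogonal ?_
    rw [Submodule.orthogonal_orthogonal]
    exact Submodule.mem_span_singleton_self e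
  have hPy : ∀ y : (ℝ ∙ e)ᗮ, P y = y := fun y =>
    Submodule.orthogonalProjectionOnto_mem_subspace_eq_self y
  have hey : ∀ y : (ℝ ∙ e)ᗮ, inner ℝ e (y : V) = 0 := fun y =>
    Submodule.mem_orthogonal_singleton_iff_inner_right.1 y.2
  set r := R / 2 with hr
  have hr0 : 0 < r := by positivity
  -- A cylinder with axis `e`: it is convex, and every line parallel to `e` that meets it does so in
  -- the same interval of parameters. Its half-width `R / 2` keeps it inside the ball of radius `R`.
  set U : Set V := {x | dist (inner ℝ e x) (inner ℝ e p) < r} ∩ {x | dist (P x) (P p) < r} with hU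
  have hUo : IsOpen U := by
    refine (isOpen_lt (by fun_prop) continuous_const).inter
      (isOpen_lt (by fun_prop) continuous_const)
  have hUconv : Convex ℝ U := by
    have h1 : U = (innerSL ℝ e) ⁻¹' ball (inner ℝ e p) r ∩ P ⁻¹' ball (P p) r := rfl
    rw [h1]
    exact ((convex_ball _ _).linear_preimage (innerSL ℝ e).toLinearMap).inter
      ((convex_ball _ _).linear_preimage P.toLinearMap)
  have hUball : U ⊆ ball p R := fun x hx => by
    rw [mem_ball, dist_eq_norm, hdec (x - p)]
    refine (norm_add_le _ _).trans_lt ?_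
    rw [norm_smul, he, mul_one, inner_sub_right, map_sub]
    have h1 := hx.1
    have h2 := hx.2
    rw [mem_ofPred_eq, dist_eq_norm] at h1 h2
    have h3 : ‖((P x - P p : (ℝ ∙ e)ᗮ) : V)‖ = ‖P x - P p‖ := rfl
    rw [h3]
    linarith
  have hUd : ∀ x ∈ U, ‖fderiv ℝ φ x - N • innerSL ℝ e‖ ≤ N / 2 := fun x hx =>
    (hball x (hUball hx)).2.le
  have hUe : ∀ x ∈ U, N / 2 ≤ fderiv ℝ φ x e := fun x hx => by
    have h1 := (fderiv ℝ φ x - N • innerSL ℝ e).le_opNorm e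
    rw [he, mul_one] at h1
    have h2 := (abs_le.1 (h1.trans (hUd x hx))).1
    have h3 : (fderiv ℝ φ x - N • innerSL ℝ e) e = fderiv ℝ φ x e - N := by simp [he]
    rw [h3] at h2
    linarith
  have hproj : ∀ x ∈ U ∩ {x | φ x = 0}, ∀ y ∈ U ∩ {x | φ x = 0},
      dist x y ≤ (2 : NNReal) * dist (P x) (P y) := fun x hx y hy =>
    dist_le_proj_of_fderiv_near hφ he hUconv hN0 hUd hx.1 hy.1 (hx.2.trans hy.2.symm)
  have hrank : Module.finrank ℝ (ℝ ∙ e)ᗮ = Module.finrank ℝ V - 1 := by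
    have h1 := (ℝ ∙ e).finrank_add_finrank_orthogonal
    rw [finrank_span_singleton (by rintro rfl; simp at he)] at h1
    omega
  have hUb : Bornology.IsBounded U := isBounded_ball.subset hUball
  refine ⟨U, hUo, ⟨by simpa using hr0, by simpa using hr0⟩, hUb,
    euclideanHausdorffMeasure_lt_top_of_dist_le_proj _ hrank
      (hUb.subset inter_subset_left) hproj, ?_⟩
  intro g hg hg0 hgc hgU κ hκ
  obtain ⟨η, hη, hηU⟩ := hgc.isCompact.exists_cthickening_subset_open hUo hgU
  obtain ⟨ρ, hρ, hgρ⟩ := Metric.uniformContinuous_iff.1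
    (hgc.uniformContinuous_of_continuous hg) κ hκ
  -- Since `φ` grows at rate at least `N / 2` along `e`, the first bound keeps the path to the level
  -- set inside `U`. The second makes that path shorter than `ρ`, so that `g` changes by less than
  -- `κ`.
  refine ⟨min (N / 2 * η) (N / 2 * (ρ / 2)), by positivity, ?_⟩
  intro ε hε hεle q hq hq0 hq1 hqm hqs
  set S : Set V := U ∩ {x | φ x = 0} with hS
  have hinj : ∀ x ∈ S, ∀ y ∈ S, P x = P y → x = y := fun x hx y hy hxy => by
    have := hproj x hx y hy
    rw [hxy, dist_self, mul_zero] at this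
    exact dist_le_zero.1 this
  classical
  -- The value of `g + κ` at the point of the level set above `y`; by `hinj` there is at most one.
  set f : (ℝ ∙ e)ᗮ → ENNReal := fun y =>
    if h : ∃ x ∈ S, P x = y then ENNReal.ofReal (g h.choose + κ) else 0 with hf
  have hfP : ∀ x ∈ S, f (P x) = ENNReal.ofReal (g x + κ) := fun x hx => by
    have h : ∃ x' ∈ S, P x' = P x := ⟨x, hx, rfl⟩
    simp only [hf, dif_pos h]
    rw [hinj _ h.choose_spec.1 _ hx h.choose_spec.2]
  have hFm : Measurable fun x => ENNReal.ofReal (g x * deriv q (φ x) * ‖fderiv ℝ φ x‖) := by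
    refine ENNReal.measurable_ofReal.comp (Continuous.measurable ?_)
    exact (hg.mul ((hq.continuous_deriv le_rfl).comp hφ.continuous)).mul hfc.norm
  have hzero : ∀ x, ENNReal.ofReal (g x * deriv q (φ x) * ‖fderiv ℝ φ x‖) ≠ 0 →
      x ∈ U ∧ ∃ z ∈ S, P z = P x ∧ g x ≤ g z + κ := fun x hx => by
    have h1 : g x ≠ 0 := fun h => by simp [h] at hx
    have h2 : deriv q (φ x) ≠ 0 := fun h => by simp [h] at hx
    have h3 : x ∈ tsupport g := subset_tsupport g h1
    obtain ⟨z, hz, hz0, ⟨τ, rfl⟩, hd⟩ := exists_zero_along_line hφ he (half_pos hN0) hUe hηU hε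
      (hεle.trans (min_le_left _ _)) h3 (hqs _ h2).1 (hqs _ h2).2
    refine ⟨hgU h3, _, ⟨hz, hz0⟩, by simp [hPe], ?_⟩
    have h4 : ε / (N / 2) < ρ := by
      rw [div_lt_iff₀ (by positivity)]
      have := hεle.trans (min_le_right _ _)
      nlinarith
    have h5 := hgρ (hd.trans_lt h4)
    rw [Real.dist_eq] at h5
    linarith [(abs_lt.1 h5).2]
  -- On one line `g` is at most its value at the crossing point plus `κ`, and what is left, `q'(φ)
  -- ∂_e φ`, is the derivative of `q ∘ φ`, which rises by at most one.
  have hline : ∀ y : (ℝ ∙ e)ᗮ, ∫⁻ s : ℝ, ENNReal.ofReal (g (s • e + (y : V)) *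
      deriv q (φ (s • e + (y : V))) * ‖fderiv ℝ φ (s • e + (y : V))‖) ≤
      ENNReal.ofReal (1 + δ) * f y := fun y => by
    by_cases hex : ∃ s : ℝ, ENNReal.ofReal (g (s • e + (y : V)) *
      deriv q (φ (s • e + (y : V))) * ‖fderiv ℝ φ (s • e + (y : V))‖) ≠ 0
    swap
    · push Not at hex
      simp only [hex, lintegral_zero]
      exact zero_le
    obtain ⟨s₁, hs₁⟩ := hex
    have hPs : ∀ s : ℝ, P (s • e + (y : V)) = y := fun s => by
      rw [map_add, map_smul, hPe, smul_zero, zero_add, hPy]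
    have hes : ∀ s : ℝ, inner ℝ e (s • e + (y : V)) = s := fun s => by
      rw [inner_add_right, hey, inner_smul_right, real_inner_self_eq_norm_sq, he]; simp
    obtain ⟨hU₁, z, hz, hPz, -⟩ := hzero _ hs₁
    rw [hPs] at hPz
    set a := inner ℝ e p with ha
    have hmem : ∀ s : ℝ, s • e + (y : V) ∈ U ↔ s ∈ Ioo (a - r) (a + r) := fun s => by
      have h1 := hU₁.2
      rw [mem_ofPred_eq, hPs] at h1
      have h2 : s • e + (y : V) ∈ U ↔ dist s a < r := by
        simp only [hU, mem_inter_iff, mem_ofPred_eq, hPs, hes, h1, and_true]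
      rw [h2, ← mem_ball, Real.ball_eq_Ioo]
    set C : ℝ := (1 + δ) * (g z + κ) with hC
    have hC0 : 0 ≤ C := by have := hg0 z; positivity
    have hle : ∀ s : ℝ, ENNReal.ofReal (g (s • e + (y : V)) *
        deriv q (φ (s • e + (y : V))) * ‖fderiv ℝ φ (s • e + (y : V))‖) ≤
        (Ioo (a - r) (a + r)).indicator (fun s => ENNReal.ofReal C * ENNReal.ofReal
          (deriv q (φ (s • e + (y : V))) * fderiv ℝ φ (s • e + (y : V)) e)) s := fun s => by
      by_cases hs : ENNReal.ofReal (g (s • e + (y : V)) *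
        deriv q (φ (s • e + (y : V))) * ‖fderiv ℝ φ (s • e + (y : V))‖) = 0
      · rw [hs]; exact zero_le
      obtain ⟨hUs, z', hz', hPz', hgz⟩ := hzero _ hs
      rw [hPs] at hPz'
      obtain rfl : z' = z := hinj _ hz' _ hz (hPz'.trans hPz.symm)
      rw [indicator_of_mem ((hmem s).1 hUs), ← ENNReal.ofReal_mul hC0]
      refine ENNReal.ofReal_le_ofReal ?_
      have h1 := (hball _ (hUball hUs)).1.le
      have h2 : 0 ≤ deriv q (φ (s • e + (y : V))) := hqm.deriv_nonneg
      calc _ ≤ (g z' + κ) * deriv q (φ (s • e + (y : V))) *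
            ((1 + δ) * fderiv ℝ φ (s • e + (y : V)) e) := by
            have := hg0 z'
            gcongr
        _ = _ := by rw [hC]; ring
    refine (lintegral_mono hle).trans ?_
    rw [lintegral_indicator measurableSet_Ioo, lintegral_const_mul' _ _ ENNReal.ofReal_ne_top]
    have hfy : f y = ENNReal.ofReal (g z + κ) := by rw [← hPz, hfP z hz]
    rw [hfy, ← ENNReal.ofReal_mul (by positivity)]
    refine mul_le_of_le_one_right' ?_
    have hd : ∀ s : ℝ, HasDerivAt (fun s : ℝ => s • e + (y : V)) e s := fun s => by
      simpa using ((hasDerivAt_id s).smul_const e).add_const (y : V)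
    refine lintegral_deriv_comp_le_one hq hq0 hq1 hqm (ψ := fun s => φ (s • e + (y : V)))
      (ψ' := fun s => fderiv ℝ φ (s • e + (y : V)) e)
      (fun s => ((hφ.differentiable one_ne_zero _).hasFDerivAt).comp_hasDerivAt s (hd s))
      ?_ fun s hs => ?_
    · exact (hfc.comp (by fun_prop)).clm_apply continuous_const
    · exact (half_pos hN0).le.trans (hUe _ ((hmem s).2 hs))
  rw [lintegral_eq_lintegral_lines he hFm]
  refine (lintegral_mono hline).trans ?_
  rw [lintegral_const_mul' _ _ ENNReal.ofReal_ne_top]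
  gcongr
  refine (lintegral_le_setLIntegral_proj _ hrank (S := S) (f := f) ?_).trans ?_
  · intro y hy
    by_contra h
    exact hy (by simp only [hf]; rw [dif_neg h])
  · have hSm : MeasurableSet S := hUo.measurableSet.inter
      (isClosed_eq hφ.continuous continuous_const).measurableSet
    exact (setLIntegral_congr_fun hSm fun x hx => hfP x hx).le

end Layer

theorem ofReal_integral_le_lintegral_ofReal {α : Type*} [MeasurableSpace α] {μ : Measure α}
    {f : α → ℝ} (hf : Integrable f μ) :
    ENNReal.ofReal (∫ x, f x ∂μ) ≤ ∫⁻ x, ENNReal.ofReal (f x) ∂μ := by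
  have h1 : ∀ x, ENNReal.ofReal (f x) = ENNReal.ofReal (max (f x) 0) := fun x => by
    rcases le_total (f x) 0 with h | h <;> simp [h]
  simp_rw [h1]
  rw [← ofReal_integral_eq_lintegral_ofReal hf.pos_part
    (Filter.Eventually.of_forall fun x => le_max_right _ _)]
  exact ENNReal.ofReal_le_ofReal (integral_mono hf hf.pos_part fun x => le_max_left _ _)

/-! ### Geometry of the domain and integration by parts with a cutoff. -/

namespace ElasticWave
open Topology

variable {d : ℕ} {Ω : Set (EuclideanSpace ℝ (Fin d))} {φ : EuclideanSpace ℝ (Fin d) → ℝ}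

theorem gradient_apply {f : EuclideanSpace ℝ (Fin d) → ℝ} (x : EuclideanSpace ℝ (Fin d))
    (i : Fin d) : gradient f x i = pderiv i f x := by
  rw [pderiv, ← InnerProductSpace.toDual_symm_apply, ← gradient, real_inner_comm,
    EuclideanSpace.inner_single_left]
  simp

theorem norm_gradient {f : EuclideanSpace ℝ (Fin d) → ℝ} (x : EuclideanSpace ℝ (Fin d)) :
    ‖gradient f x‖ = ‖fderiv ℝ f x‖ := by
  rw [gradient, LinearIsometryEquiv.norm_map]

theorem fderiv_eq_zero_iff_gradient {f : EuclideanSpace ℝ (Fin d) → ℝ}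
    {x : EuclideanSpace ℝ (Fin d)} : fderiv ℝ f x = 0 ↔ gradient f x = 0 := by
  rw [← norm_eq_zero, ← norm_gradient, norm_eq_zero]

namespace IsC2Domain

theorem contDiff_one (hΩ : IsC2Domain Ω φ) : ContDiff ℝ 1 φ := hΩ.contDiff.of_le (by norm_num)

theorem isOpen (hΩ : IsC2Domain Ω φ) : IsOpen Ω := by
  rw [hΩ.eq_lt]
  exact isOpen_lt hΩ.contDiff.continuous continuous_const

theorem mem_iff (hΩ : IsC2Domain Ω φ) {x : EuclideanSpace ℝ (Fin d)} : x ∈ Ω ↔ φ x < 0 := by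
  rw [hΩ.eq_lt]; rfl

/-- A zero of `φ` outside the closure would be a local minimum, contradicting the nonvanishing
gradient. -/
theorem closure_eq (hΩ : IsC2Domain Ω φ) : closure Ω = {x | φ x ≤ 0} := by
  refine Subset.antisymm ?_ fun x hx => ?_
  · rw [hΩ.eq_lt]
    exact closure_lt_subset_le hΩ.contDiff.continuous continuous_const
  · rcases lt_or_eq_of_le (show φ x ≤ 0 from hx) with h | h
    · exact subset_closure (hΩ.mem_iff.2 h)
    · by_contra hcl
      have h1 : ∀ᶠ y in 𝓝 x, φ x ≤ φ y := by
        filter_upwards [isClosed_closure.isOpen_compl.mem_nhds hcl] with y hy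
        rw [h]
        by_contra h2
        exact hy (subset_closure (hΩ.mem_iff.2 (not_le.1 h2)))
      exact hΩ.gradient_ne x h (fderiv_eq_zero_iff_gradient.1 (IsLocalMin.fderiv_eq_zero h1))

theorem frontier_eq (hΩ : IsC2Domain Ω φ) : frontier Ω = {x | φ x = 0} := by
  rw [frontier, hΩ.isOpen.interior_eq, hΩ.closure_eq]
  ext x
  simp only [mem_sdiff, mem_ofPred_eq, hΩ.mem_iff, not_lt]
  exact ⟨fun h => le_antisymm h.1 h.2, fun h => ⟨h.le, h.ge⟩⟩

theorem isCompact_closure (hΩ : IsC2Domain Ω φ) : IsCompact (closure Ω) :=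
  hΩ.bounded.isCompact_closure

theorem isCompact_frontier (hΩ : IsC2Domain Ω φ) : IsCompact (frontier Ω) :=
  hΩ.isCompact_closure.of_isClosed_subset isClosed_frontier frontier_subset_closure

theorem fderiv_ne (hΩ : IsC2Domain Ω φ) {x : EuclideanSpace ℝ (Fin d)} (hx : x ∈ frontier Ω) :
    fderiv ℝ φ x ≠ 0 := by
  rw [hΩ.frontier_eq] at hx
  rw [Ne, fderiv_eq_zero_iff_gradient]
  exact hΩ.gradient_ne x hx

/-- The boundary is compact and is locally a Lipschitz graph, hence has locally finite measure. -/
theorem hausdorff_frontier_lt_top (hΩ : IsC2Domain Ω φ) :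
    Measure.euclideanHausdorffMeasure (d - 1) (frontier Ω) < ⊤ := by
  refine hΩ.isCompact_frontier.measure_lt_top_of_nhdsWithin fun x hx => ?_
  obtain ⟨U, hU, hxU, -, hfin, -⟩ := exists_nhds_layer_le hΩ.contDiff_one (hΩ.fderiv_ne hx)
    (zero_lt_one' ℝ)
  rw [finrank_euclideanSpace_fin] at hfin
  refine ⟨U ∩ {x | φ x = 0}, ?_, hfin⟩
  rw [hΩ.frontier_eq]
  rw [inter_comm]
  exact inter_mem_nhdsWithin _ (hU.mem_nhds hxU)

end IsC2Domain

theorem continuous_gradient {f : EuclideanSpace ℝ (Fin d) → ℝ} (hf : ContDiff ℝ 1 f) :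
    Continuous (gradient f) :=
  (LinearIsometryEquiv.continuous _).comp (hf.continuous_fderiv one_ne_zero)

theorem continuousOn_outwardNormal (hφ : ContDiff ℝ 1 φ) :
    ContinuousOn (outwardNormal φ) {x | gradient φ x ≠ 0} := by
  have h := (continuous_gradient hφ)
  exact ContinuousOn.smul (h.norm.continuousOn.inv₀ fun x hx => norm_ne_zero_iff.2 hx)
    h.continuousOn

theorem ContDiffOn.continuousOn_pderiv {O : Set (EuclideanSpace ℝ (Fin d))} (hO : IsOpen O)
    {f : EuclideanSpace ℝ (Fin d) → ℝ} (hf : ContDiffOn ℝ 1 f O) (i : Fin d) :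
    ContinuousOn (pderiv i f) O :=
  (hf.continuousOn_fderiv_of_isOpen hO le_rfl).clm_apply continuousOn_const

theorem integral_pderiv_eq_zero {f : EuclideanSpace ℝ (Fin d) → ℝ} (hf : ContDiff ℝ 1 f)
    (hc : HasCompactSupport f) (i : Fin d) : ∫ x, pderiv i f x = 0 := by
  have hd : Continuous (pderiv i f) :=
    (hf.continuous_fderiv one_ne_zero).clm_apply continuous_const
  have h := integral_mul_fderiv_eq_neg_fderiv_mul_of_integrable (μ := volume)
    (f := fun _ : EuclideanSpace ℝ (Fin d) => (1 : ℝ)) (g := f)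
    (v := EuclideanSpace.single i 1) (by simp)
    (by
      simp only [one_mul]
      exact hd.integrable_of_hasCompactSupport (hc.fderiv_apply ℝ _))
    (by simpa using hf.continuous.integrable_of_hasCompactSupport hc)
    (fun _ _ => differentiableAt_const _) (fun _ _ => hf.differentiable one_ne_zero _)
  simpa [pderiv] using h

theorem pderiv_mul {f g : EuclideanSpace ℝ (Fin d) → ℝ} {x : EuclideanSpace ℝ (Fin d)} (i : Fin d)
    (hf : DifferentiableAt ℝ f x) (hg : DifferentiableAt ℝ g x) :
    pderiv i (fun y => f y * g y) x = pderiv i f x * g x + f x * pderiv i g x := by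
  simp only [pderiv]
  rw [fderiv_fun_mul hf hg]
  simp only [_root_.add_apply, _root_.smul_apply, smul_eq_mul]
  ring

theorem continuousOn_integrableOn (hΩ : IsC2Domain Ω φ) {f : EuclideanSpace ℝ (Fin d) → ℝ}
    (hf : ContinuousOn f (closure Ω)) : IntegrableOn f Ω :=
  (hf.integrableOn_compact hΩ.isCompact_closure).mono_set subset_closure

/-- The field `(1 - q ∘ φ) F` vanishes near the complement of `Ω`, whatever `F` is outside `O`. It
is therefore `C¹` with compact support on the whole space, where its divergence integrates to zero;
the product rule then moves the derivative onto the cutoff. -/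
theorem setIntegral_cutoff_divergence (hΩ : IsC2Domain Ω φ) {O : Set (EuclideanSpace ℝ (Fin d))}
    (hO : IsOpen O) (hΩO : closure Ω ⊆ O) {F : Fin d → EuclideanSpace ℝ (Fin d) → ℝ}
    (hF : ∀ i, ContDiffOn ℝ 1 (F i) O) {q : ℝ → ℝ} (hq : ContDiff ℝ 1 q) {ε : ℝ} (hε : 0 < ε)
    (hq1 : ∀ s, -ε ≤ s → q s = 1) :
    ∫ x in Ω, (1 - q (φ x)) * ∑ i, pderiv i (F i) x =
      ∫ x in Ω, deriv q (φ x) * ∑ i, F i x * pderiv i φ x := by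
  have hφ := hΩ.contDiff_one
  have hqφ : ContDiff ℝ 1 fun x => 1 - q (φ x) := contDiff_const.sub (hq.comp hφ)
  have hFc : ∀ i, ContinuousOn (F i) (closure Ω) := fun i => (hF i).continuousOn.mono hΩO
  have hDc : ∀ i, ContinuousOn (pderiv i (F i)) (closure Ω) := fun i =>
    (ContDiffOn.continuousOn_pderiv hO (hF i) i).mono hΩO
  have hφc : ∀ i, Continuous (pderiv i φ) := fun i =>
    (hφ.continuous_fderiv one_ne_zero).clm_apply continuous_const
  have hqc : Continuous fun x => deriv q (φ x) := (hq.continuous_deriv le_rfl).comp hφ.continuous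
  set h : Fin d → EuclideanSpace ℝ (Fin d) → ℝ := fun i x => (1 - q (φ x)) * F i x with hh
  have hloc : ∀ i x, x ∉ Ω → h i =ᶠ[𝓝 x] fun _ => 0 := fun i x hx => by
    have hx0 : -ε < φ x := by
      have := not_lt.1 (mt hΩ.mem_iff.2 hx)
      linarith
    filter_upwards [hφ.continuous.continuousAt.eventually (lt_mem_nhds hx0)] with y hy
    simp [hh, hq1 _ hy.le]
  have hsm : ∀ i, ContDiff ℝ 1 (h i) := fun i => contDiff_iff_contDiffAt.2 fun x => by
    by_cases hx : x ∈ Ω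
    · exact hqφ.contDiffAt.mul ((hF i).contDiffAt (hO.mem_nhds (hΩO (subset_closure hx))))
    · exact contDiffAt_const.congr_of_eventuallyEq (hloc i x hx)
  have hcs : ∀ i, HasCompactSupport (h i) := fun i =>
    HasCompactSupport.intro hΩ.isCompact_closure fun x hx =>
      (hloc i x fun h' => hx (subset_closure h')).eq_of_nhds
  have hpd : ∀ i, ∀ x ∈ Ω, pderiv i (h i) x = (1 - q (φ x)) * pderiv i (F i) x -
      deriv q (φ x) * (F i x * pderiv i φ x) := fun i x hx => by
    rw [hh, pderiv_mul i (hqφ.differentiable one_ne_zero x)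
      (((hF i).contDiffAt (hO.mem_nhds (hΩO (subset_closure hx)))).differentiableAt one_ne_zero)]
    have : pderiv i (fun y => 1 - q (φ y)) x = - (deriv q (φ x) * pderiv i φ x) := by
      have h1 : HasFDerivAt (fun y => 1 - q (φ y)) (-(deriv q (φ x) • fderiv ℝ φ x)) x :=
        (((hq.differentiable one_ne_zero (φ x)).hasDerivAt.comp_hasFDerivAt x
          (hφ.differentiable one_ne_zero x).hasFDerivAt)).const_sub 1
      rw [pderiv, h1.fderiv]
      simp [pderiv]
    rw [this]; ring
  have hz : ∀ i, ∫ x in Ω, ((1 - q (φ x)) * pderiv i (F i) x -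
      deriv q (φ x) * (F i x * pderiv i φ x)) = 0 := fun i => by
    have h1 := setIntegral_eq_integral_of_forall_compl_eq_zero (μ := volume) (s := Ω)
      (f := pderiv i (h i)) fun x hx => by rw [pderiv, (hloc i x hx).fderiv_eq]; simp
    rw [integral_pderiv_eq_zero (hsm i) (hcs i) i] at h1
    rw [← h1]
    exact setIntegral_congr_fun hΩ.isOpen.measurableSet fun x hx => (hpd i x hx).symm
  have hi1 : ∀ i, IntegrableOn (fun x => (1 - q (φ x)) * pderiv i (F i) x) Ω := fun i =>
    continuousOn_integrableOn hΩ (hqφ.continuous.continuousOn.mul (hDc i))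
  have hi2 : ∀ i, IntegrableOn (fun x => deriv q (φ x) * (F i x * pderiv i φ x)) Ω := fun i =>
    continuousOn_integrableOn hΩ (hqc.continuousOn.mul ((hFc i).mul (hφc i).continuousOn))
  simp_rw [Finset.mul_sum]
  rw [integral_finsetSum _ fun i _ => hi1 i, integral_finsetSum _ fun i _ => hi2 i]
  refine Finset.sum_congr rfl fun i _ => ?_
  have := hz i
  rw [integral_sub (hi1 i) (hi2 i)] at this
  linarith

end ElasticWave

/-! ### Cutoffs concentrated in a boundary layer. -/

/-- The increasing cutoff that vanishes for `s ≤ -ε` and equals `1` for `-ε / 2 ≤ s`. -/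
noncomputable def layerCutoff (ε s : ℝ) : ℝ := Real.smoothTransition (2 * s / ε + 2)

namespace layerCutoff

variable {ε : ℝ}

theorem contDiff : ContDiff ℝ 1 (layerCutoff ε) :=
  (Real.smoothTransition.contDiff (n := 1)).comp (by fun_prop)

theorem nonneg (s : ℝ) : 0 ≤ layerCutoff ε s := Real.smoothTransition.nonneg _

theorem le_one (s : ℝ) : layerCutoff ε s ≤ 1 := Real.smoothTransition.le_one _

theorem monotone (hε : 0 < ε) : Monotone (layerCutoff ε) := fun s t h =>
  Real.smoothTransition.monotone (by gcongr)

theorem eq_one (hε : 0 < ε) {s : ℝ} (hs : -(ε / 2) ≤ s) : layerCutoff ε s = 1 :=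
  Real.smoothTransition.one_of_one_le (by
    have : -1 ≤ 2 * s / ε := by rw [le_div_iff₀ hε]; linarith
    linarith)

theorem eq_zero (hε : 0 < ε) {s : ℝ} (hs : s ≤ -ε) : layerCutoff ε s = 0 :=
  Real.smoothTransition.zero_of_nonpos (by
    have : 2 * s / ε ≤ -2 := by rw [div_le_iff₀ hε]; linarith
    linarith)

/-- At any other point the cutoff attains its minimum 0 or its maximum 1, so its derivative vanishes
there. -/
theorem mem_of_deriv_ne (hε : 0 < ε) {s : ℝ} (hs : deriv (layerCutoff ε) s ≠ 0) :
    s ∈ Ioo (-ε) 0 := by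
  by_contra h
  refine hs ?_
  rcases le_or_gt s (-ε) with h1 | h1
  · refine IsLocalMin.deriv_eq_zero (Filter.Eventually.of_forall fun t => ?_)
    rw [eq_zero hε h1]
    exact nonneg t
  · refine IsLocalMax.deriv_eq_zero (Filter.Eventually.of_forall fun t => ?_)
    have h2 : 0 ≤ s := by
      by_contra h2
      exact h ⟨h1, not_le.1 h2⟩
    have h3 : layerCutoff ε s = 1 := eq_one hε (by linarith)
    rw [h3]
    exact le_one t

end layerCutoff

/-! ### The one-sided divergence theorem. -/

namespace ElasticWave
open Topology Filter

variable {d : ℕ} {Ω : Set (EuclideanSpace ℝ (Fin d))} {φ : EuclideanSpace ℝ (Fin d) → ℝ}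

theorem tendsto_setIntegral_cutoff (hΩ : IsC2Domain Ω φ) {f : EuclideanSpace ℝ (Fin d) → ℝ}
    (hf : ContinuousOn f (closure Ω)) :
    Tendsto (fun n : ℕ => ∫ x in Ω, (1 - layerCutoff (1 / ((n : ℝ) + 1)) (φ x)) * f x) atTop
      (𝓝 (∫ x in Ω, f x)) := by
  have hfi := continuousOn_integrableOn hΩ hf
  refine tendsto_integral_of_dominated_convergence (fun x => ‖f x‖) (fun n => ?_) hfi.norm
    (fun n => Eventually.of_forall fun x => ?_) ?_
  · exact ((continuous_const.sub (layerCutoff.contDiff.continuous.comp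
      hΩ.contDiff.continuous)).aestronglyMeasurable).mul hfi.aestronglyMeasurable
  · rw [norm_mul]
    refine mul_le_of_le_one_left (norm_nonneg _) ?_
    have h1 := layerCutoff.nonneg (ε := 1 / ((n : ℝ) + 1)) (φ x)
    have h2 := layerCutoff.le_one (ε := 1 / ((n : ℝ) + 1)) (φ x)
    rw [Real.norm_eq_abs, abs_le]
    constructor <;> linarith
  · refine (ae_restrict_mem hΩ.isOpen.measurableSet).mono fun x hx => ?_
    refine tendsto_const_nhds.congr' ?_
    have hx0 : 0 < -φ x := neg_pos.2 (hΩ.mem_iff.1 hx)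
    filter_upwards [tendsto_one_div_add_atTop_nhds_zero_nat.eventually (gt_mem_nhds hx0)] with n hn
    rw [layerCutoff.eq_zero (by positivity) (by linarith)]
    ring

/-- There is a thin layer inside any neighbourhood of the boundary. -/
theorem exists_layer_subset (hΩ : IsC2Domain Ω φ) {A : Set (EuclideanSpace ℝ (Fin d))}
    (hA : IsOpen A) (hΩA : frontier Ω ⊆ A) : ∃ η > 0, {x | φ x ∈ Icc (-η) 0} ⊆ A := by
  have hK : IsCompact (closure Ω \ A) := hΩ.isCompact_closure.diff hA
  have hφ := hΩ.contDiff.continuous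
  rcases (closure Ω \ A).eq_empty_or_nonempty with hne | hne
  · refine ⟨1, one_pos, fun x hx => ?_⟩
    by_contra h
    have : x ∈ closure Ω \ A := ⟨by rw [hΩ.closure_eq]; exact hx.2, h⟩
    rw [hne] at this
    exact this
  · obtain ⟨y, hy, hmax⟩ := hK.exists_isMaxOn hne hφ.continuousOn
    have hy0 : φ y < 0 := by
      have h1 := hy.1
      rw [hΩ.closure_eq] at h1
      refine lt_of_le_of_ne h1 fun h => hy.2 (hΩA ?_)
      rw [hΩ.frontier_eq]; exact h
    refine ⟨-φ y / 2, by linarith, fun x hx => ?_⟩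
    by_contra h
    have h2 : φ x ≤ φ y := hmax ⟨by rw [hΩ.closure_eq]; exact hx.2, h⟩
    have h3 := hx.1
    linarith

/-- The divergence theorem, as an upper bound. -/
theorem ofReal_integral_divergence_le (hΩ : IsC2Domain Ω φ)
    {O : Set (EuclideanSpace ℝ (Fin d))} (hO : IsOpen O) (hΩO : closure Ω ⊆ O)
    {F : Fin d → EuclideanSpace ℝ (Fin d) → ℝ} (hF : ∀ i, ContDiffOn ℝ 1 (F i) O) :
    ENNReal.ofReal (∫ x in Ω, ∑ i, pderiv i (F i) x) ≤
      ∫⁻ x in frontier Ω, ENNReal.ofReal (∑ i, F i x * outwardNormal φ x i)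
        ∂(Measure.euclideanHausdorffMeasure (d - 1)) := by
  set H : Measure (EuclideanSpace ℝ (Fin d)) := Measure.euclideanHausdorffMeasure (d - 1) with hH
  have hφ := hΩ.contDiff_one
  have hfr : IsClosed (frontier Ω) := isClosed_frontier
  -- The positive part of the flux: the layer estimate needs a nonnegative density. The formula for
  -- the normal makes sense wherever the gradient of `φ` is nonzero, so `G` is continuous on a full
  -- neighbourhood of the boundary.
  set G : EuclideanSpace ℝ (Fin d) → ℝ := fun x => max (∑ i, F i x * outwardNormal φ x i) 0 with hG
  have hG0 : ∀ x, 0 ≤ G x := fun x => le_max_right _ _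
  have hGr : ∀ x, ENNReal.ofReal (∑ i, F i x * outwardNormal φ x i) = ENNReal.ofReal (G x) :=
    fun x => by
      simp only [hG]
      rcases le_total (∑ i, F i x * outwardNormal φ x i) 0 with h | h <;> simp [h]
  simp_rw [hGr]
  set W : Set (EuclideanSpace ℝ (Fin d)) := O ∩ {x | gradient φ x ≠ 0} with hW
  have hWo : IsOpen W := hO.inter (isOpen_ne_fun (continuous_gradient hφ) continuous_const)
  have hGc : ContinuousOn G W := by
    refine ContinuousOn.sup (continuousOn_finsetSum _ fun i _ => ContinuousOn.mul
      ((hF i).continuousOn.mono inter_subset_left) ?_) continuousOn_const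
    exact (EuclideanSpace.proj i : EuclideanSpace ℝ (Fin d) →L[ℝ] ℝ).continuous.comp_continuousOn
      ((continuousOn_outwardNormal hφ).mono inter_subset_right)
  have hfW : frontier Ω ⊆ W := fun x hx =>
    ⟨hΩO (frontier_subset_closure hx), mt fderiv_eq_zero_iff_gradient.2 (hΩ.fderiv_ne hx)⟩
  have hkey : ∀ δ : ℝ, 0 < δ → ENNReal.ofReal (∫ x in Ω, ∑ i, pderiv i (F i) x) ≤
      ENNReal.ofReal (1 + δ) *
        (∫⁻ x in frontier Ω, ENNReal.ofReal (G x) ∂H + ENNReal.ofReal δ * H (frontier Ω)) := by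
    intro δ hδ
    have hex := fun x : frontier Ω => exists_nhds_layer_le hφ (hΩ.fderiv_ne x.2) hδ
    rw [finrank_euclideanSpace_fin] at hex
    choose U hUo hxU hUb _ hUg using hex
    obtain ⟨t, ht⟩ := hΩ.isCompact_frontier.elim_finite_subcover (fun x => U x ∩ W)
      (fun x => (hUo x).inter hWo) fun x hx => mem_iUnion.2 ⟨⟨x, hx⟩, hxU _, hfW hx⟩
    obtain ⟨η, hη, hηU⟩ := exists_layer_subset hΩ
      (isOpen_biUnion fun x _ => (hUo x).inter hWo) ht
    have hscl : IsClosed {x | φ x ∈ Icc (-η) 0} := isClosed_Icc.preimage hφ.continuous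
    -- The partition sums to one on a whole layer, not only on the boundary, because the cutoff
    -- derivative lives in the layer.
    obtain ⟨ψ, hψ⟩ := PartitionOfUnity.exists_isSubordinate hscl (fun x : t => U x ∩ W)
      (fun x => (hUo x).inter hWo) (fun x hx => by
        obtain ⟨i, hi, hxi⟩ := mem_iUnion₂.1 (hηU hx)
        exact mem_iUnion.2 ⟨⟨i, hi⟩, hxi⟩)
    set g : t → EuclideanSpace ℝ (Fin d) → ℝ := fun i x => ψ i x * G x with hg
    have hts : ∀ i, tsupport (g i) ⊆ tsupport (ψ i) := fun i => tsupport_mul_subset_left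
    have hgc : ∀ i, Continuous (g i) := fun i => by
      refine ContinuousOn.continuous_of_tsupport_subset (s := W) ?_ hWo
        ((hts i).trans ((hψ i).trans inter_subset_right))
      exact (ψ i).continuous.continuousOn.mul hGc
    have hg0 : ∀ i x, 0 ≤ g i x := fun i x => mul_nonneg (ψ.nonneg i x) (hG0 x)
    have hgs : ∀ i, HasCompactSupport (g i) := fun i =>
      ((hUb i).subset ((hts i).trans ((hψ i).trans inter_subset_left))).isCompact_closure.of_isClosed_subset
        (isClosed_tsupport _) subset_closure
    -- Each patch contributes an error `κ`; the total stays below `δ`, and the `+ 1` avoids division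
    -- by zero.
    set κ : ℝ := δ / (t.card + 1) with hκ
    have hκ0 : 0 < κ := by positivity
    choose ε₀ hε₀ hεq using fun i : t => hUg i (g i) (hgc i) (hg0 i) (hgs i)
      ((hts i).trans ((hψ i).trans inter_subset_left)) κ hκ0
    have hsum : ∀ x, φ x ∈ Icc (-η) 0 → ∑ i, ψ i x = 1 := fun x hx => by
      rw [← finsum_eq_sum_of_fintype]; exact ψ.sum_eq_one hx
    have hsum1 : ∀ x ∈ frontier Ω, ∑ i, ψ i x = 1 := fun x hx => hsum x (by
      rw [hΩ.frontier_eq] at hx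
      rw [show φ x = 0 from hx]
      exact ⟨by linarith, le_rfl⟩)
    have hev : ∀ᶠ n : ℕ in atTop, 1 / ((n : ℝ) + 1) ≤ η ∧ ∀ i, 1 / ((n : ℝ) + 1) ≤ ε₀ i := by
      have h0 := tendsto_one_div_add_atTop_nhds_zero_nat (𝕜 := ℝ)
      refine (h0.eventually (ge_mem_nhds hη)).and (eventually_all.2 fun i =>
        h0.eventually (ge_mem_nhds (hε₀ i)))
    have hDc : ContinuousOn (fun x => ∑ i, pderiv i (F i) x) (closure Ω) :=
      continuousOn_finsetSum _ fun i _ =>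
        (ContDiffOn.continuousOn_pderiv hO (hF i) i).mono hΩO
    refine le_of_tendsto (ENNReal.tendsto_ofReal (tendsto_setIntegral_cutoff hΩ hDc)) ?_
    filter_upwards [hev] with n hn
    set ε : ℝ := 1 / ((n : ℝ) + 1) with hε
    have hε0 : 0 < ε := by positivity
    set q := layerCutoff ε with hq
    rw [setIntegral_cutoff_divergence hΩ hO hΩO hF layerCutoff.contDiff (half_pos hε0)
      fun s hs => layerCutoff.eq_one hε0 hs]
    have hint : IntegrableOn (fun x => deriv q (φ x) * ∑ i, F i x * pderiv i φ x) Ω := by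
      refine continuousOn_integrableOn hΩ (ContinuousOn.mul ?_ (continuousOn_finsetSum _
        fun i _ => ((hF i).continuousOn.mono hΩO).mul ?_))
      · exact ((layerCutoff.contDiff.continuous_deriv le_rfl).comp hφ.continuous).continuousOn
      · exact ((hφ.continuous_fderiv one_ne_zero).clm_apply continuous_const).continuousOn
    -- In the layer `F·∇φ = (F·ν) ‖∇φ‖ ≤ G ‖∇φ‖`, which the partition of unity splits into patches.
    have hptw : ∀ x, ENNReal.ofReal (deriv q (φ x) * ∑ i, F i x * pderiv i φ x) ≤
        ∑ i, ENNReal.ofReal (g i x * deriv q (φ x) * ‖fderiv ℝ φ x‖) := fun x => by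
      by_cases hx : deriv q (φ x) = 0
      · simp [hx]
      have hmem := layerCutoff.mem_of_deriv_ne hε0 hx
      have hx1 : φ x ∈ Icc (-η) 0 := ⟨by linarith [hmem.1, hn.1], hmem.2.le⟩
      have hdq : 0 ≤ deriv q (φ x) := (layerCutoff.monotone hε0).deriv_nonneg
      have hgx : gradient φ x ≠ 0 := by
        obtain ⟨i, _, hxi⟩ := mem_iUnion₂.1 (hηU hx1)
        exact hxi.2.2
      rw [← ENNReal.ofReal_sum_of_nonneg fun i _ =>
        mul_nonneg (mul_nonneg (hg0 i x) hdq) (norm_nonneg _)]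
      refine ENNReal.ofReal_le_ofReal ?_
      simp only [hg]
      rw [← Finset.sum_mul, ← Finset.sum_mul, ← Finset.sum_mul, hsum x hx1, one_mul, mul_comm (G x),
        mul_assoc]
      refine mul_le_mul_of_nonneg_left ?_ hdq
      have h1 : ∑ i, F i x * pderiv i φ x =
          (∑ i, F i x * outwardNormal φ x i) * ‖fderiv ℝ φ x‖ := by
        rw [Finset.sum_mul]
        refine Finset.sum_congr rfl fun i _ => ?_
        rw [outwardNormal, PiLp.smul_apply, gradient_apply, norm_gradient, smul_eq_mul]
        have := (norm_gradient (f := φ) x) ▸ norm_ne_zero_iff.2 hgx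
        field_simp
      rw [h1]
      exact mul_le_mul_of_nonneg_right (le_max_left _ _) (norm_nonneg _)
    have hmeas : ∀ i, Measurable fun x =>
        ENNReal.ofReal (g i x * deriv q (φ x) * ‖fderiv ℝ φ x‖) := fun i =>
      ENNReal.measurable_ofReal.comp ((((hgc i).mul
        ((layerCutoff.contDiff.continuous_deriv le_rfl).comp hφ.continuous)).mul
        (hφ.continuous_fderiv one_ne_zero).norm).measurable)
    have hgm : ∀ i, Measurable fun x => ENNReal.ofReal (g i x) := fun i =>
      ENNReal.measurable_ofReal.comp (hgc i).measurable
    calc _ ≤ ∫⁻ x in Ω, ENNReal.ofReal (deriv q (φ x) * ∑ i, F i x * pderiv i φ x) :=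
          ofReal_integral_le_lintegral_ofReal hint
      _ ≤ ∫⁻ x, ENNReal.ofReal (deriv q (φ x) * ∑ i, F i x * pderiv i φ x) :=
          setLIntegral_le_lintegral _ _
      _ ≤ ∫⁻ x, ∑ i, ENNReal.ofReal (g i x * deriv q (φ x) * ‖fderiv ℝ φ x‖) :=
          lintegral_mono hptw
      _ = ∑ i, ∫⁻ x, ENNReal.ofReal (g i x * deriv q (φ x) * ‖fderiv ℝ φ x‖) :=
          lintegral_finsetSum _ fun i _ => hmeas i
      _ ≤ ∑ i, ENNReal.ofReal (1 + δ) *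
            (∫⁻ x in frontier Ω, ENNReal.ofReal (g i x) ∂H + ENNReal.ofReal κ * H (frontier Ω)) := by
          refine Finset.sum_le_sum fun i _ => ?_
          refine (hεq i ε hε0 (hn.2 i) q layerCutoff.contDiff layerCutoff.nonneg
            layerCutoff.le_one (layerCutoff.monotone hε0)
            fun s hs => layerCutoff.mem_of_deriv_ne hε0 hs).trans ?_
          gcongr
          rw [← hΩ.frontier_eq]
          refine (lintegral_mono_set inter_subset_right).trans ?_
          rw [← setLIntegral_const, ← lintegral_add_left (hgm i)]
          exact lintegral_mono fun x => ENNReal.ofReal_add_le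
      _ = ENNReal.ofReal (1 + δ) * (∫⁻ x in frontier Ω, ∑ i, ENNReal.ofReal (g i x) ∂H +
            t.card * ENNReal.ofReal κ * H (frontier Ω)) := by
          rw [← Finset.mul_sum, Finset.sum_add_distrib, lintegral_finsetSum _ fun i _ => hgm i]
          simp [mul_assoc]
      _ ≤ _ := by
          refine mul_le_mul' le_rfl (add_le_add ?_ (mul_le_mul' ?_ le_rfl))
          · refine setLIntegral_mono' hfr.measurableSet fun x hx => ?_
            rw [← ENNReal.ofReal_sum_of_nonneg fun i _ => hg0 i x]
            simp only [hg]
            rw [← Finset.sum_mul, hsum1 x hx, one_mul]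
          · rw [← ENNReal.ofReal_natCast, ← ENNReal.ofReal_mul (by positivity)]
            refine ENNReal.ofReal_le_ofReal ?_
            rw [hκ, mul_div_assoc', div_le_iff₀ (by positivity)]
            nlinarith
  have hHfin : H (frontier Ω) ≠ ⊤ := hΩ.hausdorff_frontier_lt_top.ne
  set I := ∫⁻ x in frontier Ω, ENNReal.ofReal (G x) ∂H with hI
  -- Finiteness of `I` and of the boundary measure is what makes the bound continuous as `δ → 0`.
  by_cases hItop : I = ⊤
  · rw [hItop]; exact le_top
  have hlim : Tendsto (fun δ : ℝ => ENNReal.ofReal (1 + δ) *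
      (I + ENNReal.ofReal δ * H (frontier Ω))) (𝓝[>] 0) (𝓝 (ENNReal.ofReal (1 + 0) *
      (I + ENNReal.ofReal 0 * H (frontier Ω)))) := by
    have h1 : Tendsto (fun δ : ℝ => δ) (𝓝[>] (0 : ℝ)) (𝓝 0) := nhdsWithin_le_nhds
    refine ENNReal.Tendsto.mul (ENNReal.tendsto_ofReal (h1.const_add 1)) ?_
      (tendsto_const_nhds.add (ENNReal.Tendsto.mul_const (ENNReal.tendsto_ofReal h1) (Or.inr hHfin)))
      ?_
    · right; simpa using hItop
    · right; simp
  have := ge_of_tendsto hlim (eventually_nhdsWithin_of_forall fun δ hδ => hkey δ hδ)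
  simpa using this

end ElasticWave

/-! ### Directional calculus on space-time and integrals over time slices. -/

namespace ElasticWave
open Topology Filter

/-- The space-time on which the displacement field lives. -/
abbrev SpaceTime (d : ℕ) : Type := ℝ × EuclideanSpace ℝ (Fin d)

variable {d : ℕ}

/-- The unit vector in the time direction. -/
noncomputable def eT : SpaceTime d := (1, 0)

/-- The unit vector in the direction of `x_j`. -/
noncomputable def eX (j : Fin d) : SpaceTime d := (0, EuclideanSpace.single j 1)

/-- The derivative of `f` in the direction `v`. -/
noncomputable def dirD (v : SpaceTime d) (f : SpaceTime d → ℝ) (p : SpaceTime d) : ℝ :=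
  fderiv ℝ f p v

section Rules

variable {v : SpaceTime d} {f g : SpaceTime d → ℝ} {p : SpaceTime d}

theorem dirD_add (hf : DifferentiableAt ℝ f p) (hg : DifferentiableAt ℝ g p) :
    dirD v (fun z => f z + g z) p = dirD v f p + dirD v g p := by
  simp only [dirD]; rw [fderiv_fun_add hf hg]; rfl

theorem dirD_sub (hf : DifferentiableAt ℝ f p) (hg : DifferentiableAt ℝ g p) :
    dirD v (fun z => f z - g z) p = dirD v f p - dirD v g p := by
  simp only [dirD]; rw [fderiv_fun_sub hf hg]; rfl

theorem dirD_mul (hf : DifferentiableAt ℝ f p) (hg : DifferentiableAt ℝ g p) :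
    dirD v (fun z => f z * g z) p = dirD v f p * g p + f p * dirD v g p := by
  simp only [dirD]
  rw [fderiv_fun_mul hf hg]
  simp only [_root_.add_apply, _root_.smul_apply, smul_eq_mul]
  ring

theorem dirD_const_mul (c : ℝ) (hf : DifferentiableAt ℝ f p) :
    dirD v (fun z => c * f z) p = c * dirD v f p := by
  simp only [dirD]
  rw [fderiv_const_mul hf]; rfl

theorem dirD_sum {ι : Type*} {s : Finset ι} {F : ι → SpaceTime d → ℝ}
    (hF : ∀ i ∈ s, DifferentiableAt ℝ (F i) p) :
    dirD v (fun z => ∑ i ∈ s, F i z) p = ∑ i ∈ s, dirD v (F i) p := by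
  simp only [dirD]
  rw [fderiv_fun_sum hF, sum_apply]

theorem dirD_ite {c : Prop} [Decidable c] :
    dirD v (fun z => if c then f z else 0) p = if c then dirD v f p else 0 := by
  split_ifs <;> simp [dirD]

theorem dirD_comm {O : Set (SpaceTime d)} (hO : IsOpen O) (hf : ContDiffOn ℝ 2 f O) (hp : p ∈ O)
    (v w : SpaceTime d) : dirD v (dirD w f) p = dirD w (dirD v f) p := by
  have h1 : ContDiffAt ℝ 2 f p := hf.contDiffAt (hO.mem_nhds hp)
  have h2 : DifferentiableAt ℝ (fderiv ℝ f) p :=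
    (h1.fderiv_right (m := 1) (by norm_num)).differentiableAt one_ne_zero
  have h3 : ∀ a b : SpaceTime d, dirD a (dirD b f) p = fderiv ℝ (fderiv ℝ f) p a b := fun a b => by
    have := (h2.hasFDerivAt.clm_apply (hasFDerivAt_const b p)).fderiv
    rw [dirD, show dirD b f = fun y => fderiv ℝ f y b from rfl, this]
    simp
  rw [h3, h3]
  exact (h1.isSymmSndFDerivAt (by simp)).eq _ _

theorem contDiffOn_dirD {O : Set (SpaceTime d)} (hO : IsOpen O) (hf : ContDiffOn ℝ 2 f O)
    (v : SpaceTime d) : ContDiffOn ℝ 1 (dirD v f) O :=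
  (hf.fderiv_of_isOpen hO (by norm_num)).clm_apply contDiffOn_const

theorem continuousOn_dirD {O : Set (SpaceTime d)} (hO : IsOpen O) (hf : ContDiffOn ℝ 1 f O)
    (v : SpaceTime d) : ContinuousOn (dirD v f) O :=
  (hf.continuousOn_fderiv_of_isOpen hO le_rfl).clm_apply continuousOn_const

theorem hasDerivAt_dirD_eT {t : ℝ} {x : EuclideanSpace ℝ (Fin d)}
    (hf : DifferentiableAt ℝ f (t, x)) : HasDerivAt (fun s => f (s, x)) (dirD eT f (t, x)) t := by
  have h1 : HasDerivAt (fun s : ℝ => ((s, x) : SpaceTime d)) (1, 0) t :=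
    (hasDerivAt_id t).prodMk (hasDerivAt_const t x)
  exact hf.hasFDerivAt.comp_hasDerivAt t h1

theorem hasFDerivAt_slice {t : ℝ} {x : EuclideanSpace ℝ (Fin d)}
    (hf : DifferentiableAt ℝ f (t, x)) :
    HasFDerivAt (fun y => f (t, y))
      ((fderiv ℝ f (t, x)).comp (ContinuousLinearMap.inr ℝ ℝ (EuclideanSpace ℝ (Fin d)))) x :=
  hf.hasFDerivAt.comp x (hasFDerivAt_prodMk_right t x)

theorem pderiv_slice {t : ℝ} {x : EuclideanSpace ℝ (Fin d)}
    (hf : DifferentiableAt ℝ f (t, x)) (j : Fin d) :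
    pderiv j (fun y => f (t, y)) x = dirD (eX j) f (t, x) := by
  rw [pderiv, (hasFDerivAt_slice hf).fderiv]
  rfl

theorem dirD_comp_snd {h : EuclideanSpace ℝ (Fin d) → ℝ} (hh : DifferentiableAt ℝ h p.2) :
    dirD v (fun z => h z.2) p = fderiv ℝ h p.2 v.2 := by
  have := (hh.hasFDerivAt.comp p hasFDerivAt_snd).fderiv
  simp only [dirD]
  rw [show (fun z : SpaceTime d => h z.2) = h ∘ Prod.snd from rfl, this]
  rfl

end Rules

section Integrals

variable {Ω : Set (EuclideanSpace ℝ (Fin d))} {φ : EuclideanSpace ℝ (Fin d) → ℝ}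
  {O : Set (SpaceTime d)} {T : ℝ}

/-- Dominated convergence with a constant bound. The measure is left general because this serves
both volume on `Ω` and surface measure on `Γ`. -/
theorem continuousOn_setIntegral_slice {X : Type*} [TopologicalSpace X] [T2Space X]
    [SecondCountableTopology X]
    [MeasurableSpace X] [BorelSpace X] {μ : Measure X} {K A : Set X} (hK : IsCompact K)
    (hA : MeasurableSet A) (hAK : A ⊆ K) (hμ : μ A ≠ ⊤) {f : ℝ × X → ℝ} {a b : ℝ}
    (hf : ContinuousOn f (Icc a b ×ˢ K)) :
    ContinuousOn (fun t => ∫ x in A, f (t, x) ∂μ) (Icc a b) := by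
  obtain ⟨C, hC⟩ := (isCompact_Icc.prod hK).exists_bound_of_continuousOn hf
  refine continuousOn_of_dominated (bound := fun _ => C) (fun t ht => ?_) (fun t ht => ?_) ?_ ?_
  · have : ContinuousOn (fun x => f (t, x)) A :=
      hf.comp (by fun_prop) fun x hx => ⟨ht, hAK hx⟩
    exact this.aestronglyMeasurable hA
  · exact (ae_restrict_mem hA).mono fun x hx => hC _ ⟨ht, hAK hx⟩
  · exact integrableOn_const hμ
  · exact (ae_restrict_mem hA).mono fun x hx =>
      hf.comp (by fun_prop) fun t ht => ⟨ht, hAK hx⟩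

theorem continuousOn_slice {f : SpaceTime d → ℝ} (hf : ContinuousOn f O)
    (hOT : Icc 0 T ×ˢ closure Ω ⊆ O) {t : ℝ} (ht : t ∈ Icc 0 T) :
    ContinuousOn (fun x => f (t, x)) (closure Ω) :=
  hf.comp (by fun_prop) fun _ hx => hOT ⟨ht, hx⟩

theorem integrableOn_slice (hΩ : IsC2Domain Ω φ) {f : SpaceTime d → ℝ} (hf : ContinuousOn f O)
    (hOT : Icc 0 T ×ˢ closure Ω ⊆ O) {t : ℝ} (ht : t ∈ Icc 0 T) :
    IntegrableOn (fun x => f (t, x)) Ω :=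
  continuousOn_integrableOn hΩ (continuousOn_slice hf hOT ht)

theorem continuousOn_integral_slice (hΩ : IsC2Domain Ω φ) {f : SpaceTime d → ℝ}
    (hf : ContinuousOn f O) (hOT : Icc 0 T ×ˢ closure Ω ⊆ O) :
    ContinuousOn (fun t => ∫ x in Ω, f (t, x)) (Icc 0 T) :=
  continuousOn_setIntegral_slice hΩ.isCompact_closure hΩ.isOpen.measurableSet subset_closure
    hΩ.bounded.measure_lt_top.ne (hf.mono hOT)

/-- The fundamental theorem of calculus at each fixed `x`, followed by Fubini; this avoids
differentiating under the integral sign. -/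
theorem integral_slice_sub (hΩ : IsC2Domain Ω φ) (hO : IsOpen O)
    (hOT : Icc 0 T ×ˢ closure Ω ⊆ O) {f : SpaceTime d → ℝ} (hf : ContDiffOn ℝ 1 f O) {b : ℝ}
    (hb : b ∈ Icc 0 T) :
    (∫ x in Ω, f (b, x)) - ∫ x in Ω, f (0, x) =
      ∫ t in (0 : ℝ)..b, ∫ x in Ω, dirD eT f (t, x) := by
  have hD := continuousOn_dirD hO hf eT
  have h0 : (0 : ℝ) ∈ Icc 0 T := ⟨le_rfl, hb.1.trans hb.2⟩
  have hsub : Icc 0 b ⊆ Icc 0 T := Icc_subset_Icc_right hb.2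
  rw [← integral_sub (integrableOn_slice hΩ hf.continuousOn hOT hb)
    (integrableOn_slice hΩ hf.continuousOn hOT h0), intervalIntegral.integral_of_le hb.1]
  have hftc : ∀ x ∈ Ω, f (b, x) - f (0, x) = ∫ t in Ioc 0 b, dirD eT f (t, x) := fun x hx => by
    rw [← intervalIntegral.integral_of_le hb.1]
    refine (intervalIntegral.integral_eq_sub_of_hasDerivAt (f := fun t => f (t, x))
      (fun t ht => ?_) ?_).symm
    · rw [uIcc_of_le hb.1] at ht
      have hm : (t, x) ∈ O := hOT ⟨hsub ht, subset_closure hx⟩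
      exact hasDerivAt_dirD_eT
        ((hf.contDiffAt (hO.mem_nhds hm)).differentiableAt one_ne_zero)
    · refine ContinuousOn.intervalIntegrable ?_
      rw [uIcc_of_le hb.1]
      exact hD.comp (by fun_prop) fun t ht => hOT ⟨hsub ht, subset_closure hx⟩
  rw [setIntegral_congr_fun hΩ.isOpen.measurableSet hftc]
  refine (integral_integral_swap ?_).symm
  rw [Measure.prod_restrict]
  have hc : IsCompact (Icc 0 b ×ˢ closure Ω) := isCompact_Icc.prod hΩ.isCompact_closure
  refine ((hD.mono fun z hz => ?_).integrableOn_compact hc).mono_set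
    (prod_mono Ioc_subset_Icc_self subset_closure)
  exact hOT ⟨hsub hz.1, hz.2⟩

theorem ofReal_integral_dirD_le (hΩ : IsC2Domain Ω φ) (hO : IsOpen O)
    (hOT : Icc 0 T ×ˢ closure Ω ⊆ O) {F : Fin d → SpaceTime d → ℝ}
    (hF : ∀ j, ContDiffOn ℝ 1 (F j) O) {t : ℝ} (ht : t ∈ Icc 0 T) :
    ENNReal.ofReal (∫ x in Ω, ∑ j, dirD (eX j) (F j) (t, x)) ≤
      ∫⁻ x in frontier Ω, ENNReal.ofReal (∑ j, F j (t, x) * outwardNormal φ x j)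
        ∂(Measure.euclideanHausdorffMeasure (d - 1)) := by
  have hOt : IsOpen {x | (t, x) ∈ O} := hO.preimage (by fun_prop)
  have h := ofReal_integral_divergence_le hΩ hOt (fun x hx => hOT ⟨ht, hx⟩)
    (F := fun j x => F j (t, x)) fun j => (hF j).comp (by fun_prop) fun x hx => hx
  refine le_trans (le_of_eq ?_) h
  congr 1
  refine setIntegral_congr_fun hΩ.isOpen.measurableSet fun x hx => ?_
  have hm : (t, x) ∈ O := hOT ⟨ht, subset_closure hx⟩
  refine Finset.sum_congr rfl fun j _ => (pderiv_slice ?_ j).symm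
  exact ((hF j).contDiffAt (hO.mem_nhds hm)).differentiableAt one_ne_zero

/-- The one-sided divergence theorem, applied to `F` and to `-F`, has zero right-hand side both
times. -/
theorem integral_dirD_eq_zero (hΩ : IsC2Domain Ω φ) (hO : IsOpen O)
    (hOT : Icc 0 T ×ˢ closure Ω ⊆ O) {F : Fin d → SpaceTime d → ℝ}
    (hF : ∀ j, ContDiffOn ℝ 1 (F j) O) {t : ℝ} (ht : t ∈ Icc 0 T)
    (h0 : ∀ x ∈ frontier Ω, ∀ j, F j (t, x) = 0) :
    ∫ x in Ω, ∑ j, dirD (eX j) (F j) (t, x) = 0 := by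
  have hm : MeasurableSet (frontier Ω) := isClosed_frontier.measurableSet
  have key : ∀ G : Fin d → SpaceTime d → ℝ, (∀ j, ContDiffOn ℝ 1 (G j) O) →
      (∀ x ∈ frontier Ω, ∀ j, G j (t, x) = 0) →
      ∫ x in Ω, ∑ j, dirD (eX j) (G j) (t, x) ≤ 0 := fun G hG hG0 => by
    have h := ofReal_integral_dirD_le hΩ hO hOT hG ht
    rw [setLIntegral_congr_fun hm (g := fun _ => 0) fun x hx => by simp [hG0 x hx]] at h
    simpa using h
  refine le_antisymm (key F hF h0) ?_
  have h1 := key (fun j z => -F j z) (fun j => (hF j).neg) fun x hx j => by simp [h0 x hx j]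
  have h2 : ∀ j z, dirD (eX j) (fun z => -F j z) z = -dirD (eX j) (F j) z := fun j z => by
    simp only [dirD]
    rw [fderiv_fun_neg]; rfl
  simp only [h2, Finset.sum_neg_distrib, integral_neg] at h1
  linarith

end Integrals

end ElasticWave

/-! ### The elasticity tensor and the pointwise identities. -/

namespace ElasticWave
open Topology Filter

variable {d : ℕ}

/-- The isotropic elasticity tensor with Lamé parameters `a`, `b`, applied to `A`. -/
def lameTensor (a b : ℝ) (A : Fin d → Fin d → ℝ) (i j : Fin d) : ℝ :=
  a * (A i j + A j i) + if i = j then b * ∑ k, A k k else 0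

theorem sum_lameTensor_mul (a b : ℝ) (A B : Fin d → Fin d → ℝ) :
    ∑ i, ∑ j, lameTensor a b A i j * B i j =
      a * (∑ i, ∑ j, A i j * B i j + ∑ i, ∑ j, A j i * B i j) +
        b * ((∑ k, A k k) * ∑ k, B k k) := by
  simp only [lameTensor, add_mul, ite_mul, zero_mul, Finset.sum_add_distrib,
    Finset.sum_ite_eq, Finset.mem_univ, if_true, mul_add, mul_assoc, ← Finset.mul_sum]

theorem sum_lameTensor_mul_comm (a b : ℝ) (A B : Fin d → Fin d → ℝ) :
    ∑ i, ∑ j, lameTensor a b A i j * B i j = ∑ i, ∑ j, lameTensor a b B i j * A i j := by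
  rw [sum_lameTensor_mul, sum_lameTensor_mul]
  have h1 : ∑ i, ∑ j, A i j * B i j = ∑ i, ∑ j, B i j * A i j := by simp_rw [mul_comm]
  have h2 : ∑ i, ∑ j, A j i * B i j = ∑ i, ∑ j, B j i * A i j := by
    rw [Finset.sum_comm]; simp_rw [mul_comm]
  rw [h1, h2, mul_comm (∑ k, A k k)]

/-- The gradient of a space-time vector field in the space variables. -/
noncomputable def grad (U : Fin d → SpaceTime d → ℝ) (i j : Fin d) : SpaceTime d → ℝ :=
  dirD (eX j) (U i)

/-- The velocity of a space-time vector field. -/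
noncomputable def vel (U : Fin d → SpaceTime d → ℝ) (i : Fin d) : SpaceTime d → ℝ :=
  dirD eT (U i)

/-- The stress tensor of a space-time vector field. -/
noncomputable def sig (mu lam : SpaceTime d → ℝ) (U : Fin d → SpaceTime d → ℝ) (i j : Fin d)
    (p : SpaceTime d) : ℝ :=
  lameTensor (mu p) (lam p) (fun i j => grad U i j p) i j

/-- The elastic energy density `σ : ∇u`. -/
noncomputable def strain (mu lam : SpaceTime d → ℝ) (U : Fin d → SpaceTime d → ℝ)
    (p : SpaceTime d) : ℝ :=
  ∑ i, ∑ j, sig mu lam U i j p * grad U i j p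

/-- The `k`-th component of `x - x₀`. -/
def pos (x0 : EuclideanSpace ℝ (Fin d)) (k : Fin d) (p : SpaceTime d) : ℝ := p.2 k - x0 k

/-- The components of the multiplier `2 ∇u (x - x₀) + (d - 1) u`. -/
noncomputable def mult (x0 : EuclideanSpace ℝ (Fin d)) (U : Fin d → SpaceTime d → ℝ) (i : Fin d)
    (p : SpaceTime d) : ℝ :=
  2 * ∑ k, pos x0 k p * grad U i k p + ((d : ℝ) - 1) * U i p

/-- `∂_k μ (∇u + ∇uᵀ) + ∂_k λ (∇ · u) I_d` contracted with `∇u`. -/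
noncomputable def strainDeriv (mu lam : SpaceTime d → ℝ) (U : Fin d → SpaceTime d → ℝ)
    (v : SpaceTime d) (p : SpaceTime d) : ℝ :=
  ∑ i, ∑ j, lameTensor (dirD v mu p) (dirD v lam p) (fun i j => grad U i j p) i j * grad U i j p

/-- The flux in the multiplier identity. -/
noncomputable def flux (rho mu lam : SpaceTime d → ℝ) (U : Fin d → SpaceTime d → ℝ)
    (x0 : EuclideanSpace ℝ (Fin d)) (j : Fin d) (p : SpaceTime d) : ℝ :=
  ∑ i, sig mu lam U i j p * mult x0 U i p - pos x0 j p * strain mu lam U p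
    + pos x0 j p * (rho p * ∑ i, vel U i p * vel U i p)

/-- Regularity of the coefficients and of the displacement field on an open set of space-time. -/
structure SmoothData (O : Set (SpaceTime d)) (rho mu lam : SpaceTime d → ℝ)
    (U : Fin d → SpaceTime d → ℝ) : Prop where
  isOpen : IsOpen O
  disp : ∀ i, ContDiffOn ℝ 2 (U i) O
  contDiffOn_rho : ContDiffOn ℝ 1 rho O
  contDiffOn_mu : ContDiffOn ℝ 1 mu O
  contDiffOn_lam : ContDiffOn ℝ 1 lam O
  rho_eT : ∀ p ∈ O, dirD eT rho p = 0
  mu_eT : ∀ p ∈ O, dirD eT mu p = 0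
  lam_eT : ∀ p ∈ O, dirD eT lam p = 0

theorem contDiff_pos (x0 : EuclideanSpace ℝ (Fin d)) (k : Fin d) : ContDiff ℝ 1 (pos x0 k) := by
  unfold pos
  fun_prop

theorem dirD_pos (x0 : EuclideanSpace ℝ (Fin d)) (k : Fin d) (v p : SpaceTime d) :
    dirD v (pos x0 k) p = v.2 k := by
  have h : HasFDerivAt (pos x0 k) ((EuclideanSpace.proj k).comp
      (ContinuousLinearMap.snd ℝ ℝ (EuclideanSpace ℝ (Fin d)))) p :=
    ((EuclideanSpace.proj k).comp
      (ContinuousLinearMap.snd ℝ ℝ (EuclideanSpace ℝ (Fin d)))).hasFDerivAt.sub_const (x0 k)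
  rw [dirD, h.fderiv]
  rfl

theorem dirD_eX_pos (x0 : EuclideanSpace ℝ (Fin d)) (j k : Fin d) (p : SpaceTime d) :
    dirD (eX j) (pos x0 k) p = if k = j then 1 else 0 := by
  rw [dirD_pos]
  simp [eX]

theorem dirD_eT_pos (x0 : EuclideanSpace ℝ (Fin d)) (k : Fin d) (p : SpaceTime d) :
    dirD eT (pos x0 k) p = 0 := by
  rw [dirD_pos]
  simp [eT]

namespace SmoothData

variable {O : Set (SpaceTime d)} {rho mu lam : SpaceTime d → ℝ} {U : Fin d → SpaceTime d → ℝ}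
  {p : SpaceTime d} {x0 : EuclideanSpace ℝ (Fin d)}

section Smooth

variable (h : SmoothData O rho mu lam U)
include h

theorem disp_one (i : Fin d) : ContDiffOn ℝ 1 (U i) O := (h.disp i).of_le (by norm_num)

theorem grad (i j : Fin d) : ContDiffOn ℝ 1 (grad U i j) O := contDiffOn_dirD h.isOpen (h.disp i) _

theorem vel (i : Fin d) : ContDiffOn ℝ 1 (vel U i) O := contDiffOn_dirD h.isOpen (h.disp i) _

theorem sig (i j : Fin d) : ContDiffOn ℝ 1 (sig mu lam U i j) O := by
  have h1 := h.grad
  have h2 := h.contDiffOn_mu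
  have h3 := h.contDiffOn_lam
  unfold ElasticWave.sig lameTensor
  split_ifs <;> fun_prop

theorem strain : ContDiffOn ℝ 1 (strain mu lam U) O := by
  have h1 := h.grad
  have h2 := h.sig
  unfold ElasticWave.strain
  fun_prop

theorem mult (i : Fin d) : ContDiffOn ℝ 1 (mult x0 U i) O := by
  have h1 := h.grad
  have h2 := h.disp_one
  have h3 := fun k => (contDiff_pos x0 k).contDiffOn (s := O)
  unfold ElasticWave.mult
  fun_prop

theorem flux (j : Fin d) : ContDiffOn ℝ 1 (flux rho mu lam U x0 j) O := by
  have h1 := h.sig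
  have h2 := h.strain
  have h3 := fun k => (contDiff_pos x0 k).contDiffOn (s := O)
  have h4 := fun i => h.mult (x0 := x0) i
  have h5 := h.vel
  have h6 := h.contDiffOn_rho
  unfold ElasticWave.flux
  fun_prop

theorem diff {f : SpaceTime d → ℝ} (hf : ContDiffOn ℝ 1 f O) (hp : p ∈ O) :
    DifferentiableAt ℝ f p :=
  (hf.contDiffAt (h.isOpen.mem_nhds hp)).differentiableAt one_ne_zero

theorem dirD_grad_eX (hp : p ∈ O) (i j k : Fin d) :
    dirD (eX k) (ElasticWave.grad U i j) p = dirD (eX j) (ElasticWave.grad U i k) p :=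
  dirD_comm h.isOpen (h.disp i) hp _ _

theorem dirD_grad_eT (hp : p ∈ O) (i j : Fin d) :
    dirD eT (ElasticWave.grad U i j) p = dirD (eX j) (ElasticWave.vel U i) p :=
  dirD_comm h.isOpen (h.disp i) hp _ _

theorem dirD_sig (hp : p ∈ O) (v : SpaceTime d) (i j : Fin d) :
    dirD v (ElasticWave.sig mu lam U i j) p =
      lameTensor (dirD v mu p) (dirD v lam p) (fun i j => ElasticWave.grad U i j p) i j +
      lameTensor (mu p) (lam p) (fun i j => dirD v (ElasticWave.grad U i j) p) i j := by
  have h1 := fun i j => h.diff (h.grad i j) hp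
  have h2 := h.diff h.contDiffOn_mu hp
  have h3 := h.diff h.contDiffOn_lam hp
  have e : ElasticWave.sig mu lam U i j = fun z => mu z * (ElasticWave.grad U i j z +
    ElasticWave.grad U j i z) + if i = j then lam z * ∑ k, ElasticWave.grad U k k z else 0 := rfl
  have h4 : DifferentiableAt ℝ (fun z => if i = j then lam z * ∑ k, ElasticWave.grad U k k z
      else 0) p := by split_ifs <;> fun_prop
  rw [e, dirD_add (by fun_prop) h4, dirD_mul h2 (by fun_prop), dirD_add (h1 _ _) (h1 _ _), dirD_ite,
    dirD_mul h3 (by fun_prop), dirD_sum fun k _ => h1 k k]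
  simp only [lameTensor]
  split_ifs <;> ring

theorem dirD_strain (hp : p ∈ O) (v : SpaceTime d) :
    dirD v (ElasticWave.strain mu lam U) p = strainDeriv mu lam U v p +
      2 * ∑ i, ∑ j, ElasticWave.sig mu lam U i j p * dirD v (ElasticWave.grad U i j) p := by
  have h1 := fun i j => h.diff (h.grad i j) hp
  have h2 := fun i j => h.diff (h.sig i j) hp
  have e : ElasticWave.strain mu lam U = fun z => ∑ i, ∑ j, ElasticWave.sig mu lam U i j z *
    ElasticWave.grad U i j z := rfl
  rw [e, dirD_sum fun i _ => by fun_prop]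
  have h3 : ∀ i, dirD v (fun z => ∑ j, ElasticWave.sig mu lam U i j z * ElasticWave.grad U i j z) p
      = ∑ j, (dirD v (ElasticWave.sig mu lam U i j) p * ElasticWave.grad U i j p +
        ElasticWave.sig mu lam U i j p * dirD v (ElasticWave.grad U i j) p) := fun i => by
    rw [dirD_sum fun j _ => by fun_prop]
    exact Finset.sum_congr rfl fun j _ => dirD_mul (h2 i j) (h1 i j)
  simp only [h3, h.dirD_sig hp, add_mul, Finset.sum_add_distrib]
  rw [sum_lameTensor_mul_comm (mu p) (lam p) (fun i j => dirD v (ElasticWave.grad U i j) p)]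
  simp only [strainDeriv, ElasticWave.sig]
  ring

/-- The factor `d + 1` is `2`, from differentiating `x - x₀`, plus `d - 1`, from the zero-order
term. -/
theorem dirD_mult_eX (hp : p ∈ O) (i j : Fin d) :
    dirD (eX j) (ElasticWave.mult x0 U i) p = ((d : ℝ) + 1) * ElasticWave.grad U i j p +
      2 * ∑ k, pos x0 k p * dirD (eX k) (ElasticWave.grad U i j) p := by
  have h1 := fun i j => h.diff (h.grad i j) hp
  have h2 := fun k => ((contDiff_pos x0 k).differentiable one_ne_zero) p
  have h3 := fun i => h.diff (h.disp_one i) hp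
  have e : ElasticWave.mult x0 U i = fun z => 2 * ∑ k, pos x0 k z * ElasticWave.grad U i k z +
    ((d : ℝ) - 1) * U i z := rfl
  rw [e, dirD_add (by fun_prop) (by fun_prop), dirD_const_mul _ (by fun_prop),
    dirD_const_mul _ (h3 i), dirD_sum fun k _ => by fun_prop]
  have h4 : ∀ k, dirD (eX j) (fun z => pos x0 k z * ElasticWave.grad U i k z) p =
      (if k = j then ElasticWave.grad U i k p else 0) +
        pos x0 k p * dirD (eX k) (ElasticWave.grad U i j) p := fun k => by
    rw [dirD_mul (h2 k) (h1 i k), dirD_eX_pos, h.dirD_grad_eX hp]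
    split_ifs <;> simp
  simp only [h4, Finset.sum_add_distrib, Finset.sum_ite_eq', Finset.mem_univ, if_true]
  rw [show dirD (eX j) (U i) p = ElasticWave.grad U i j p from rfl]
  ring

theorem dirD_mult_eT (hp : p ∈ O) (i : Fin d) :
    dirD eT (ElasticWave.mult x0 U i) p = ((d : ℝ) - 1) * ElasticWave.vel U i p +
      2 * ∑ k, pos x0 k p * dirD (eX k) (ElasticWave.vel U i) p := by
  have h1 := fun i j => h.diff (h.grad i j) hp
  have h2 := fun k => ((contDiff_pos x0 k).differentiable one_ne_zero) p
  have h3 := fun i => h.diff (h.disp_one i) hp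
  have e : ElasticWave.mult x0 U i = fun z => 2 * ∑ k, pos x0 k z * ElasticWave.grad U i k z +
    ((d : ℝ) - 1) * U i z := rfl
  rw [e, dirD_add (by fun_prop) (by fun_prop), dirD_const_mul _ (by fun_prop),
    dirD_const_mul _ (h3 i), dirD_sum fun k _ => by fun_prop]
  have h4 : ∀ k, dirD eT (fun z => pos x0 k z * ElasticWave.grad U i k z) p =
        pos x0 k p * dirD (eX k) (ElasticWave.vel U i) p := fun k => by
    rw [dirD_mul (h2 k) (h1 i k), dirD_eT_pos, h.dirD_grad_eT hp]
    simp
  simp only [h4]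
  rw [show dirD eT (U i) p = ElasticWave.vel U i p from rfl]
  ring

theorem dirD_sum_sig_mul (hp : p ∈ O) {W : Fin d → SpaceTime d → ℝ}
    (hW : ∀ i, DifferentiableAt ℝ (W i) p) :
    ∑ j, dirD (eX j) (fun z => ∑ i, ElasticWave.sig mu lam U i j z * W i z) p =
      ∑ i, (∑ j, dirD (eX j) (ElasticWave.sig mu lam U i j) p) * W i p +
        ∑ i, ∑ j, ElasticWave.sig mu lam U i j p * dirD (eX j) (W i) p := by
  have h2 := fun i j => h.diff (h.sig i j) hp
  have h3 : ∀ j, dirD (eX j) (fun z => ∑ i, ElasticWave.sig mu lam U i j z * W i z) p =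
      ∑ i, (dirD (eX j) (ElasticWave.sig mu lam U i j) p * W i p +
        ElasticWave.sig mu lam U i j p * dirD (eX j) (W i) p) := fun j => by
    rw [dirD_sum fun i _ => by fun_prop]
    exact Finset.sum_congr rfl fun i _ => dirD_mul (h2 i j) (hW i)
  simp only [h3, Finset.sum_add_distrib, Finset.sum_mul]
  rw [Finset.sum_comm, Finset.sum_comm (f := fun j i => ElasticWave.sig mu lam U i j p * _)]

theorem dirD_sum_vel_sq (hp : p ∈ O) (v : SpaceTime d) :
    dirD v (fun z => ∑ i, ElasticWave.vel U i z * ElasticWave.vel U i z) p =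
      2 * ∑ i, ElasticWave.vel U i p * dirD v (ElasticWave.vel U i) p := by
  have h1 := fun i => h.diff (h.vel i) hp
  rw [dirD_sum fun i _ => by fun_prop, Finset.mul_sum]
  refine Finset.sum_congr rfl fun i _ => ?_
  rw [dirD_mul (h1 i) (h1 i)]
  ring

/-- Local conservation of energy. -/
theorem dirD_energy (hp : p ∈ O) (hw : ∀ i, rho p * dirD eT (ElasticWave.vel U i) p =
      ∑ j, dirD (eX j) (ElasticWave.sig mu lam U i j) p) :
    dirD eT (fun z => rho z * (∑ i, ElasticWave.vel U i z * ElasticWave.vel U i z) +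
        ElasticWave.strain mu lam U z) p =
      2 * ∑ j, dirD (eX j) (fun z => ∑ i, ElasticWave.sig mu lam U i j z *
        ElasticWave.vel U i z) p := by
  have h1 := fun i => h.diff (h.vel i) hp
  have h2 := h.diff h.contDiffOn_rho hp
  have h3 := h.diff h.strain hp
  rw [dirD_add (by fun_prop) h3, dirD_mul h2 (by fun_prop), h.rho_eT p hp, h.dirD_sum_vel_sq hp,
    h.dirD_strain hp, h.dirD_sum_sig_mul hp h1]
  -- The Lamé parameters do not depend on time.
  have h4 : strainDeriv mu lam U eT p = 0 := by
    simp [strainDeriv, h.mu_eT p hp, h.lam_eT p hp, lameTensor]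
  simp only [h4, h.dirD_grad_eT hp, ← hw]
  rw [zero_mul, zero_add, zero_add, mul_add]
  congr 1
  rw [mul_left_comm, Finset.mul_sum]
  congr 1
  exact Finset.sum_congr rfl fun i _ => by ring

/-- The multiplier identity. -/
theorem dirD_multiplier (hp : p ∈ O) (hw : ∀ i, rho p * dirD eT (ElasticWave.vel U i) p =
      ∑ j, dirD (eX j) (ElasticWave.sig mu lam U i j) p) :
    dirD eT (fun z => rho z * ∑ i, ElasticWave.vel U i z * ElasticWave.mult x0 U i z) p =
      ∑ j, dirD (eX j) (ElasticWave.flux rho mu lam U x0 j) p -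
      (rho p + ∑ k, pos x0 k p * dirD (eX k) rho p) *
        (∑ i, ElasticWave.vel U i p * ElasticWave.vel U i p) -
      (ElasticWave.strain mu lam U p - ∑ k, strainDeriv mu lam U (eX k) p * pos x0 k p) := by
  have h1 := fun i => h.diff (h.vel i) hp
  have h2 := h.diff h.contDiffOn_rho hp
  have h3 := h.diff h.strain hp
  have h4 := fun i => h.diff (h.mult (x0 := x0) i) hp
  have h5 := fun k => ((contDiff_pos x0 k).differentiable one_ne_zero) p
  have h6 := fun i j => h.diff (h.sig i j) hp
  -- The wave equation replaces `ρ ∂_t² u` by the divergence of the stress.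
  have lhs : dirD eT (fun z => rho z * ∑ i, ElasticWave.vel U i z * ElasticWave.mult x0 U i z) p =
      ∑ i, (∑ j, dirD (eX j) (ElasticWave.sig mu lam U i j) p) * ElasticWave.mult x0 U i p +
      ((d : ℝ) - 1) * (rho p * ∑ i, ElasticWave.vel U i p * ElasticWave.vel U i p) +
      2 * (rho p * ∑ k, pos x0 k p * ∑ i, ElasticWave.vel U i p *
        dirD (eX k) (ElasticWave.vel U i) p) := by
    rw [dirD_mul h2 (by fun_prop), h.rho_eT p hp, dirD_sum fun i _ => by fun_prop, zero_mul,
      zero_add]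
    have e1 : ∀ i, rho p * dirD eT (fun z => ElasticWave.vel U i z * ElasticWave.mult x0 U i z) p =
        (∑ j, dirD (eX j) (ElasticWave.sig mu lam U i j) p) * ElasticWave.mult x0 U i p +
        ((d : ℝ) - 1) * (rho p * (ElasticWave.vel U i p * ElasticWave.vel U i p)) +
        2 * (rho p * ∑ k, pos x0 k p * (ElasticWave.vel U i p *
          dirD (eX k) (ElasticWave.vel U i) p)) := fun i => by
      rw [dirD_mul (h1 i) (h4 i), h.dirD_mult_eT hp, ← hw]
      have e2 : ∑ k, pos x0 k p * (ElasticWave.vel U i p * dirD (eX k) (ElasticWave.vel U i) p) =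
          ElasticWave.vel U i p * ∑ k, pos x0 k p * dirD (eX k) (ElasticWave.vel U i) p := by
        rw [Finset.mul_sum]
        exact Finset.sum_congr rfl fun k _ => by ring
      rw [e2]
      ring
    rw [Finset.mul_sum]
    simp only [e1, Finset.sum_add_distrib, ← Finset.mul_sum]
    rw [Finset.sum_comm]
    simp only [← Finset.mul_sum]
  have e1 : ∀ j, dirD (eX j) (ElasticWave.flux rho mu lam U x0 j) p =
      dirD (eX j) (fun z => ∑ i, ElasticWave.sig mu lam U i j z * ElasticWave.mult x0 U i z) p -
      (ElasticWave.strain mu lam U p + pos x0 j p * (strainDeriv mu lam U (eX j) p +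
        2 * ∑ i, ∑ k, ElasticWave.sig mu lam U i k p * dirD (eX j) (ElasticWave.grad U i k) p)) +
      (rho p * (∑ i, ElasticWave.vel U i p * ElasticWave.vel U i p) + pos x0 j p *
        (dirD (eX j) rho p * (∑ i, ElasticWave.vel U i p * ElasticWave.vel U i p) + rho p *
        (2 * ∑ i, ElasticWave.vel U i p * dirD (eX j) (ElasticWave.vel U i) p))) := fun j => by
    have e : ElasticWave.flux rho mu lam U x0 j = fun z => (∑ i, ElasticWave.sig mu lam U i j z *
      ElasticWave.mult x0 U i z - pos x0 j z * ElasticWave.strain mu lam U z) + pos x0 j z *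
      (rho z * ∑ i, ElasticWave.vel U i z * ElasticWave.vel U i z) := rfl
    rw [e, dirD_add (by fun_prop) (by fun_prop), dirD_sub (by fun_prop) (by fun_prop),
      dirD_mul (h5 j) h3, dirD_mul (h5 j) (by fun_prop), dirD_mul h2 (by fun_prop), dirD_eX_pos,
      h.dirD_sum_vel_sq hp, h.dirD_strain hp]
    simp
  have e2 : ∑ i, ∑ j, ElasticWave.sig mu lam U i j p * dirD (eX j) (ElasticWave.mult x0 U i) p =
      ((d : ℝ) + 1) * ElasticWave.strain mu lam U p + 2 * ∑ k, pos x0 k p *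
        ∑ i, ∑ j, ElasticWave.sig mu lam U i j p * dirD (eX k) (ElasticWave.grad U i j) p := by
    simp only [h.dirD_mult_eX hp, mul_add, Finset.sum_add_distrib]
    congr 1
    · simp only [ElasticWave.strain, Finset.mul_sum]
      exact Finset.sum_congr rfl fun i _ => Finset.sum_congr rfl fun j _ => by ring
    · simp only [Finset.mul_sum]
      conv_rhs => rw [Finset.sum_comm]
      refine Finset.sum_congr rfl fun i _ => ?_
      conv_rhs => rw [Finset.sum_comm]
      exact Finset.sum_congr rfl fun j _ => Finset.sum_congr rfl fun k _ => by ring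
  have e3 : ∑ k, strainDeriv mu lam U (eX k) p * pos x0 k p =
      ∑ k, pos x0 k p * strainDeriv mu lam U (eX k) p :=
    Finset.sum_congr rfl fun k _ => mul_comm _ _
  rw [lhs]
  -- Summing `∂_j (x_j - x₀_j) = 1` over `j` gives `d` copies of each density. Against `d + 1`
  -- copies of the elastic density and `d - 1` of the kinetic one, exactly one of each survives,
  -- with a minus sign.
  simp only [e1, Finset.sum_add_distrib, Finset.sum_sub_distrib, h.dirD_sum_sig_mul hp h4, e2, e3,
    mul_add, Finset.sum_const, Finset.card_univ, Fintype.card_fin, nsmul_eq_mul]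
  have e4 : ∀ f : Fin d → ℝ, ∑ k, pos x0 k p * (2 * f k) = 2 * ∑ k, pos x0 k p * f k := fun f => by
    rw [Finset.mul_sum]; exact Finset.sum_congr rfl fun k _ => by ring
  have e5 : ∑ k, pos x0 k p * (rho p * (2 * ∑ i, ElasticWave.vel U i p *
      dirD (eX k) (ElasticWave.vel U i) p)) = 2 * (rho p * ∑ k, pos x0 k p *
        ∑ i, ElasticWave.vel U i p * dirD (eX k) (ElasticWave.vel U i) p) := by
    rw [Finset.mul_sum, Finset.mul_sum]; exact Finset.sum_congr rfl fun k _ => by ring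
  have e6 : ∑ k, pos x0 k p * (dirD (eX k) rho p *
      ∑ i, ElasticWave.vel U i p * ElasticWave.vel U i p) = (∑ k, pos x0 k p * dirD (eX k) rho p) *
      ∑ i, ElasticWave.vel U i p * ElasticWave.vel U i p := by
    rw [Finset.sum_mul]; exact Finset.sum_congr rfl fun k _ => by ring
  rw [e4, e5, e6]
  ring

/-- Integrated with zero boundary values, this turns the cross term of `|m|²` into a multiple of
`|u|²`. -/
theorem sum_dirD_pos_mul_sq (hp : p ∈ O) :
    ∑ j, dirD (eX j) (fun z => pos x0 j z * ∑ i, U i z * U i z) p =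
      d * (∑ i, U i p * U i p) +
        2 * ∑ i, U i p * ∑ k, pos x0 k p * ElasticWave.grad U i k p := by
  have h1 := fun i => h.diff (h.disp_one i) hp
  have h5 := fun k => ((contDiff_pos x0 k).differentiable one_ne_zero) p
  have e1 : ∀ j, dirD (eX j) (fun z => pos x0 j z * ∑ i, U i z * U i z) p =
      (∑ i, U i p * U i p) + 2 * ∑ i, U i p * (pos x0 j p * ElasticWave.grad U i j p) := fun j => by
    rw [dirD_mul (h5 j) (by fun_prop), dirD_eX_pos, dirD_sum fun i _ => by fun_prop]
    simp only [if_true, one_mul, Finset.mul_sum]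
    congr 1
    refine Finset.sum_congr rfl fun i _ => ?_
    rw [dirD_mul (h1 i) (h1 i)]
    simp only [ElasticWave.grad]
    ring
  simp only [e1, Finset.sum_add_distrib, Finset.sum_const, Finset.card_univ, Fintype.card_fin,
    nsmul_eq_mul, ← Finset.mul_sum]
  rw [Finset.sum_comm]
  simp only [← Finset.mul_sum]

/-- The difference `(∇·u)² - ∇u : ∇uᵀ` is a null Lagrangian: the second derivatives cancel by
symmetry. For fields vanishing on the boundary its integral is zero. -/
theorem sum_dirD_div_sub (hp : p ∈ O) :
    ∑ j, dirD (eX j) (fun z => U j z * (∑ k, ElasticWave.grad U k k z) -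
        ∑ k, U k z * ElasticWave.grad U j k z) p =
      (∑ k, ElasticWave.grad U k k p) * (∑ k, ElasticWave.grad U k k p) -
        ∑ i, ∑ j, ElasticWave.grad U j i p * ElasticWave.grad U i j p := by
  have h1 := fun i => h.diff (h.disp_one i) hp
  have h2 := fun i j => h.diff (h.grad i j) hp
  have e1 : ∀ j, dirD (eX j) (fun z => U j z * (∑ k, ElasticWave.grad U k k z) -
        ∑ k, U k z * ElasticWave.grad U j k z) p =
      ElasticWave.grad U j j p * (∑ k, ElasticWave.grad U k k p) +
      (∑ k, U j p * dirD (eX j) (ElasticWave.grad U k k) p) -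
      ((∑ k, ElasticWave.grad U k j p * ElasticWave.grad U j k p) +
        ∑ k, U k p * dirD (eX k) (ElasticWave.grad U j j) p) := fun j => by
    rw [dirD_sub (by fun_prop) (by fun_prop), dirD_mul (h1 j) (by fun_prop),
      dirD_sum fun i _ => h2 i i, dirD_sum fun i _ => by fun_prop, ← Finset.mul_sum]
    congr 1
    rw [← Finset.sum_add_distrib]
    refine Finset.sum_congr rfl fun k _ => ?_
    rw [dirD_mul (h1 k) (h2 j k), h.dirD_grad_eX hp j k j]
    rfl
  simp only [e1, Finset.sum_add_distrib, Finset.sum_sub_distrib, ← Finset.sum_mul]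
  rw [Finset.sum_comm (f := fun j k => U j p * dirD (eX j) (ElasticWave.grad U k k) p)]
  ring

end Smooth

end SmoothData

end ElasticWave

/-! ### Boundary values, conservation of energy and integral bounds. -/

namespace ElasticWave
open Topology Filter

variable {d : ℕ} {Ω : Set (EuclideanSpace ℝ (Fin d))} {φ : EuclideanSpace ℝ (Fin d) → ℝ}

section BoundaryAlgebra

/-- For `A = c ⊗ n` and `β = c·n`, the traction is `a c + (a + b) β n`. So `a σ : A = a² |c|² + a (a
+ b) β²`, while `|σn|²` exceeds this by `a (a + b) β² + (a + b)² β²`. -/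
theorem traction_algebra {a b : ℝ} (ha : 0 ≤ a) (hab : 0 ≤ a + b) {n c : Fin d → ℝ}
    (hn : ∑ k, n k * n k = 1) {A : Fin d → Fin d → ℝ} (hA : ∀ i j, A i j = c i * n j) :
    0 ≤ a * ∑ i, ∑ j, lameTensor a b A i j * A i j ∧
    a * ∑ i, ∑ j, lameTensor a b A i j * A i j ≤
      ∑ i, (∑ j, lameTensor a b A i j * n j) * (∑ j, lameTensor a b A i j * n j) := by
  set β := ∑ k, c k * n k with hβ
  have h1 : ∀ i, ∑ j, lameTensor a b A i j * n j = a * c i + (a + b) * β * n i := fun i => by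
    simp only [lameTensor, hA, add_mul, mul_add, ite_mul, zero_mul, Finset.sum_add_distrib,
      Finset.sum_ite_eq, Finset.mem_univ, if_true, ← hβ]
    have e1 : ∑ j, a * (c i * n j) * n j = a * c i := by
      rw [← mul_one (a * c i), ← hn, Finset.mul_sum]
      exact Finset.sum_congr rfl fun j _ => by ring
    have e2 : ∑ j, a * (c j * n i) * n j = a * β * n i := by
      rw [hβ, Finset.mul_sum, Finset.sum_mul]
      exact Finset.sum_congr rfl fun j _ => by ring
    rw [e1, e2]; ring
  have h2 : ∑ i, ∑ j, lameTensor a b A i j * A i j = a * ∑ i, c i * c i + (a + b) * β * β := by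
    have e1 : ∀ i, ∑ j, lameTensor a b A i j * A i j =
        a * (c i * c i) + (a + b) * β * (c i * n i) := fun i => by
      have : ∀ j, lameTensor a b A i j * A i j = c i * (lameTensor a b A i j * n j) := fun j => by
        rw [hA i j]; ring
      simp only [this]
      rw [← Finset.mul_sum, h1]; ring
    simp only [e1, Finset.sum_add_distrib, ← Finset.mul_sum]
    rw [← hβ]
  have h3 : ∑ i, (∑ j, lameTensor a b A i j * n j) * (∑ j, lameTensor a b A i j * n j) =
      a * a * ∑ i, c i * c i + 2 * (a * (a + b)) * β * β + (a + b) * (a + b) * β * β := by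
    have e1 : ∀ i, (∑ j, lameTensor a b A i j * n j) * (∑ j, lameTensor a b A i j * n j) =
        a * a * (c i * c i) + 2 * (a * (a + b)) * β * (c i * n i) +
          (a + b) * (a + b) * β * β * (n i * n i) := fun i => by rw [h1]; ring
    simp only [e1, Finset.sum_add_distrib, ← Finset.mul_sum, hn]
    rw [← hβ]; ring
  have hc : 0 ≤ ∑ i, c i * c i := Finset.sum_nonneg fun i _ => mul_self_nonneg _
  have hβ2 : 0 ≤ β * β := mul_self_nonneg _
  rw [h2, h3]
  constructor
  · have := mul_nonneg (mul_nonneg ha ha) hc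
    have := mul_nonneg (mul_nonneg ha hab) hβ2
    nlinarith
  · have := mul_nonneg (mul_nonneg ha hab) hβ2
    have := mul_nonneg (mul_nonneg hab hab) hβ2
    nlinarith

theorem sum_outwardNormal_mul_self {x : EuclideanSpace ℝ (Fin d)} (hx : gradient φ x ≠ 0) :
    ∑ k, outwardNormal φ x k * outwardNormal φ x k = 1 := by
  have h1 : ‖outwardNormal φ x‖ = 1 := by
    rw [outwardNormal, norm_smul, norm_inv, norm_norm, inv_mul_cancel₀ (norm_ne_zero_iff.2 hx)]
  have h2 := EuclideanSpace.real_norm_sq_eq (outwardNormal φ x)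
  rw [h1] at h2
  simp only [← sq]
  linarith

/-- The gradient of a function that vanishes on the boundary is normal to it. -/
theorem exists_pderiv_eq_mul_normal (hΩ : IsC2Domain Ω φ) {f : EuclideanSpace ℝ (Fin d) → ℝ}
    {x : EuclideanSpace ℝ (Fin d)} (hx : x ∈ frontier Ω) (hf : ContDiffAt ℝ 1 f x)
    (hf0 : ∀ y ∈ frontier Ω, f y = 0) :
    ∃ c : ℝ, ∀ j, pderiv j f x = c * outwardNormal φ x j := by
  have hx0 : φ x = 0 := by rw [hΩ.frontier_eq] at hx; exact hx
  have hext : IsLocalExtrOn f {y | φ y = φ x} x := by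
    left
    refine eventually_nhdsWithin_of_forall fun y hy => ?_
    have hy' : y ∈ frontier Ω := by
      rw [hΩ.frontier_eq]; exact (show φ y = φ x from hy).trans hx0
    rw [hf0 x hx, hf0 y hy']
  -- A function constant on the level set has a constrained extremum at each of its points, so
  -- Lagrange multipliers apply. The multiplier `b` of `f` cannot vanish because `∇φ ≠ 0`.
  obtain ⟨a, b, hab, h⟩ := hext.exists_multipliers_of_hasStrictFDerivAt_1d
    (hΩ.contDiff_one.contDiffAt.hasStrictFDerivAt one_ne_zero)
    (hf.hasStrictFDerivAt one_ne_zero)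
  have hb : b ≠ 0 := by
    rintro rfl
    rw [zero_smul, add_zero] at h
    rcases smul_eq_zero.1 h with h | h
    · exact hab (by rw [h]; rfl)
    · exact hΩ.fderiv_ne hx h
  have hg : ‖gradient φ x‖ ≠ 0 := norm_ne_zero_iff.2 (hΩ.gradient_ne x hx0)
  refine ⟨-(a / b) * ‖gradient φ x‖, fun j => ?_⟩
  rw [outwardNormal, PiLp.smul_apply, gradient_apply, smul_eq_mul]
  have h1 := congrArg (fun L => L (EuclideanSpace.single j 1)) h
  simp only [_root_.add_apply, _root_.smul_apply, smul_eq_mul] at h1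
  change a * pderiv j φ x + b * pderiv j f x = 0 at h1
  field_simp
  linarith

end BoundaryAlgebra

section Extension

variable {O : Set (SpaceTime d)} {T : ℝ}

/-- The equation and the boundary condition are given for open time intervals, and the equation only
in the open domain; continuity extends them to the endpoints and the closure, where the integral
identities use them. -/
theorem eqOn_closure_of_eqOn (hT : 0 < T) {A : Set (EuclideanSpace ℝ (Fin d))}
    (hOT : Icc 0 T ×ˢ closure A ⊆ O) {f g : SpaceTime d → ℝ} (hf : ContinuousOn f O)
    (hg : ContinuousOn g O) (h : ∀ t ∈ Ioo 0 T, ∀ x ∈ A, f (t, x) = g (t, x)) :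
    ∀ t ∈ Icc 0 T, ∀ x ∈ closure A, f (t, x) = g (t, x) := by
  have h1 : EqOn f g (Ioo 0 T ×ˢ A) := fun p hp => h p.1 hp.1 p.2 hp.2
  have h2 : EqOn f g (Icc 0 T ×ˢ closure A) :=
    h1.of_subset_closure (hf.mono hOT) (hg.mono hOT)
      (prod_mono Ioo_subset_Icc_self subset_closure) (by
        rw [closure_prod_eq, closure_Ioo hT.ne])
  exact fun t ht x hx => h2 ⟨ht, hx⟩

end Extension

/-- A smooth solution of the elastic wave equation with Dirichlet boundary condition, in terms of
its components as functions on space-time. -/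
structure SolutionData (Ω : Set (EuclideanSpace ℝ (Fin d))) (O : Set (SpaceTime d)) (T : ℝ)
    (rho mu lam : SpaceTime d → ℝ) (U : Fin d → SpaceTime d → ℝ) : Prop
    extends SmoothData O rho mu lam U where
  pos_time : 0 < T
  subset : Icc 0 T ×ˢ closure Ω ⊆ O
  wave : ∀ t ∈ Ioo 0 T, ∀ x ∈ Ω, ∀ i,
    rho (t, x) * dirD eT (vel U i) (t, x) = ∑ j, dirD (eX j) (sig mu lam U i j) (t, x)
  boundary : ∀ t ∈ Ioo 0 T, ∀ x ∈ frontier Ω, ∀ i, U i (t, x) = 0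

namespace SolutionData

variable {O : Set (SpaceTime d)} {T : ℝ} {rho mu lam : SpaceTime d → ℝ}
  {U : Fin d → SpaceTime d → ℝ} {x0 : EuclideanSpace ℝ (Fin d)}

theorem mem (h : SolutionData Ω O T rho mu lam U) {t : ℝ} (ht : t ∈ Icc 0 T)
    {x : EuclideanSpace ℝ (Fin d)} (hx : x ∈ closure Ω) : (t, x) ∈ O := h.subset ⟨ht, hx⟩

theorem wave_closed (h : SolutionData Ω O T rho mu lam U) : ∀ t ∈ Icc 0 T, ∀ x ∈ closure Ω, ∀ i,
    rho (t, x) * dirD eT (vel U i) (t, x) = ∑ j, dirD (eX j) (sig mu lam U i j) (t, x) := by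
  intro t ht x hx i
  refine eqOn_closure_of_eqOn h.pos_time h.subset
    (f := fun p => rho p * dirD eT (vel U i) p)
    (g := fun p => ∑ j, dirD (eX j) (sig mu lam U i j) p) ?_ ?_
    (fun t ht x hx => h.wave t ht x hx i) t ht x hx
  · exact h.contDiffOn_rho.continuousOn.mul (continuousOn_dirD h.isOpen (h.vel i) _)
  · exact continuousOn_finsetSum _ fun j _ => continuousOn_dirD h.isOpen (h.sig i j) _

theorem boundary_closed (h : SolutionData Ω O T rho mu lam U) : ∀ t ∈ Icc 0 T,
    ∀ x ∈ frontier Ω, ∀ i, U i (t, x) = 0 := by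
  intro t ht x hx i
  have hcl : closure (frontier Ω) = frontier Ω := isClosed_frontier.closure_eq
  refine eqOn_closure_of_eqOn h.pos_time (A := frontier Ω) (O := O) (g := fun _ => 0) ?_
    (h.disp i).continuousOn continuousOn_const (fun t ht x hx => h.boundary t ht x hx i) t ht x
    (by rwa [hcl])
  rw [hcl]
  exact (prod_mono subset_rfl frontier_subset_closure).trans h.subset

theorem boundary_vel (h : SolutionData Ω O T rho mu lam U) : ∀ t ∈ Icc 0 T,
    ∀ x ∈ frontier Ω, ∀ i, vel U i (t, x) = 0 := by
  intro t ht x hx i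
  have hcl : closure (frontier Ω) = frontier Ω := isClosed_frontier.closure_eq
  refine eqOn_closure_of_eqOn h.pos_time (A := frontier Ω) (O := O) (f := vel U i)
    (g := fun _ => 0) ?_ (h.vel i).continuousOn continuousOn_const (fun t ht x hx => ?_) t ht x
    (by rwa [hcl])
  · rw [hcl]
    exact (prod_mono subset_rfl frontier_subset_closure).trans h.subset
  · have hm := h.mem (Ioo_subset_Icc_self ht) (frontier_subset_closure hx)
    have h1 := hasDerivAt_dirD_eT (h.diff (h.disp_one i) hm)
    have h2 : (fun s => U i (s, x)) =ᶠ[𝓝 t] fun _ => 0 := by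
      filter_upwards [isOpen_Ioo.mem_nhds ht] with s hs using h.boundary s hs x hx i
    exact h1.unique ((hasDerivAt_const t (0 : ℝ)).congr_of_eventuallyEq h2)

/-- The local energy flux is the stress paired with the velocity, which vanishes on the boundary. -/
theorem energy_eq (h : SolutionData Ω O T rho mu lam U) (hΩ : IsC2Domain Ω φ) {t : ℝ}
    (ht : t ∈ Icc 0 T) :
    ∫ x in Ω, (rho (t, x) * (∑ i, vel U i (t, x) * vel U i (t, x)) + strain mu lam U (t, x)) =
    ∫ x in Ω, (rho (0, x) * (∑ i, vel U i (0, x) * vel U i (0, x)) + strain mu lam U (0, x)) := by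
  have h1 := h.contDiffOn_rho
  have h2 := h.vel
  have h3 := h.strain
  have h4 := h.sig
  have hs := integral_slice_sub hΩ h.isOpen h.subset
    (f := fun p => rho p * (∑ i, vel U i p * vel U i p) + strain mu lam U p) (by fun_prop) ht
  rw [← sub_eq_zero, hs]
  have hz : ∀ s ∈ uIcc 0 t, ∫ x in Ω, dirD eT (fun p => rho p * (∑ i, vel U i p * vel U i p) +
      strain mu lam U p) (s, x) = 0 := fun s hs => by
    rw [uIcc_of_le ht.1] at hs
    have hs' : s ∈ Icc 0 T := ⟨hs.1, hs.2.trans ht.2⟩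
    rw [setIntegral_congr_fun hΩ.isOpen.measurableSet fun x hx =>
      h.dirD_energy (h.mem hs' (subset_closure hx)) (h.wave_closed s hs' x (subset_closure hx)),
      integral_const_mul,
      integral_dirD_eq_zero hΩ h.isOpen h.subset
      (F := fun j z => ∑ i, sig mu lam U i j z * vel U i z) (fun j => by fun_prop) hs', mul_zero]
    intro x hx j
    simp [h.boundary_vel s hs' x hx]
  rw [intervalIntegral.integral_congr hz]
  simp

/-- The null Lagrangian replaces `(∇·u)²` by `∇u : ∇uᵀ ≤ |∇u|²` under the integral. A pointwise
estimate of the trace would instead cost a factor `d`. -/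
theorem strain_le (h : SolutionData Ω O T rho mu lam U) (hΩ : IsC2Domain Ω φ)
    {mu1 L : ℝ} {t : ℝ} (ht : t ∈ Icc 0 T)
    (hmu : ∀ x ∈ closure Ω, 0 ≤ mu (t, x) ∧ mu (t, x) ≤ mu1)
    (hlam : ∀ x ∈ closure Ω, |lam (t, x)| ≤ L) :
    ∫ x in Ω, strain mu lam U (t, x) ≤
      (2 * mu1 + L) * ∫ x in Ω, ∑ i, ∑ j, grad U i j (t, x) * grad U i j (t, x) := by
  have h1 := h.disp_one
  have h2 := h.grad
  have h3 := h.strain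
  set F : Fin d → SpaceTime d → ℝ := fun j z => U j z * (∑ k, grad U k k z) -
        ∑ k, U k z * grad U j k z with hF
  have hFc : ∀ j, ContDiffOn ℝ 1 (F j) O := fun j => by simp only [hF]; fun_prop
  have hF0 := integral_dirD_eq_zero hΩ h.isOpen h.subset hFc ht fun x hx j => by
    simp [hF, h.boundary_closed t ht x hx]
  have hp : ∀ x ∈ Ω, strain mu lam U (t, x) ≤
      (2 * mu1 + L) * (∑ i, ∑ j, grad U i j (t, x) * grad U i j (t, x)) +
        L * ∑ j, dirD (eX j) (F j) (t, x) := fun x hx => by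
    have hm := h.mem ht (subset_closure hx)
    rw [h.sum_dirD_div_sub hm]
    have e1 : strain mu lam U (t, x) = _ := sum_lameTensor_mul (mu (t, x)) (lam (t, x))
      (fun i j => grad U i j (t, x)) (fun i j => grad U i j (t, x))
    rw [e1]
    set Q := ∑ i, ∑ j, grad U i j (t, x) * grad U i j (t, x) with hQ
    set S := ∑ i, ∑ j, grad U j i (t, x) * grad U i j (t, x) with hS
    set D := ∑ k, grad U k k (t, x) with hD
    have hQ' : ∑ i, ∑ j, grad U j i (t, x) * grad U j i (t, x) = Q := Finset.sum_comm
    have hSQ : 0 ≤ Q - S ∧ 0 ≤ Q + S := by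
      constructor
      · have : 0 ≤ ∑ i, ∑ j, (grad U i j (t, x) - grad U j i (t, x)) *
            (grad U i j (t, x) - grad U j i (t, x)) :=
          Finset.sum_nonneg fun i _ => Finset.sum_nonneg fun j _ => mul_self_nonneg _
        have e : ∑ i, ∑ j, (grad U i j (t, x) - grad U j i (t, x)) *
            (grad U i j (t, x) - grad U j i (t, x)) = 2 * (Q - S) := by
          have : ∀ i j, (grad U i j (t, x) - grad U j i (t, x)) *
            (grad U i j (t, x) - grad U j i (t, x)) = grad U i j (t, x) * grad U i j (t, x) +
              grad U j i (t, x) * grad U j i (t, x) - 2 * (grad U j i (t, x) * grad U i j (t, x)) :=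
            fun i j => by ring
          simp only [this, Finset.sum_sub_distrib, Finset.sum_add_distrib, ← Finset.mul_sum, hQ']
          rw [← hQ, ← hS]; ring
        linarith
      · have : 0 ≤ ∑ i, ∑ j, (grad U i j (t, x) + grad U j i (t, x)) *
            (grad U i j (t, x) + grad U j i (t, x)) :=
          Finset.sum_nonneg fun i _ => Finset.sum_nonneg fun j _ => mul_self_nonneg _
        have e : ∑ i, ∑ j, (grad U i j (t, x) + grad U j i (t, x)) *
            (grad U i j (t, x) + grad U j i (t, x)) = 2 * (Q + S) := by
          have : ∀ i j, (grad U i j (t, x) + grad U j i (t, x)) *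
            (grad U i j (t, x) + grad U j i (t, x)) = grad U i j (t, x) * grad U i j (t, x) +
              grad U j i (t, x) * grad U j i (t, x) + 2 * (grad U j i (t, x) * grad U i j (t, x)) :=
            fun i j => by ring
          simp only [this, Finset.sum_add_distrib, ← Finset.mul_sum, hQ']
          rw [← hQ, ← hS]; ring
        linarith
    obtain ⟨hm0, hm1⟩ := hmu x (subset_closure hx)
    have hl := hlam x (subset_closure hx)
    have hL : 0 ≤ L := (abs_nonneg _).trans hl
    have h5 : lam (t, x) * (D * D) ≤ L * (D * D) :=
      mul_le_mul_of_nonneg_right ((le_abs_self _).trans hl) (mul_self_nonneg _)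
    have h6 : mu (t, x) * (Q + S) ≤ mu1 * (Q + S) := mul_le_mul_of_nonneg_right hm1 hSQ.2
    have h7 : mu1 * (Q + S) ≤ mu1 * (2 * Q) :=
      mul_le_mul_of_nonneg_left (by linarith) (hm0.trans hm1)
    have h8 : L * S ≤ L * Q := mul_le_mul_of_nonneg_left (by linarith) hL
    nlinarith
  have hG : ContinuousOn (fun z => ∑ i, ∑ j, grad U i j z * grad U i j z) O := by
    have h2' := fun i j => (h.grad i j).continuousOn
    fun_prop
  have hDF : ContinuousOn (fun z => ∑ j, dirD (eX j) (F j) z) O :=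
    continuousOn_finsetSum _ fun j _ => continuousOn_dirD h.isOpen (hFc j) _
  have i1 := integrableOn_slice hΩ hG h.subset ht
  have i2 := integrableOn_slice hΩ hDF h.subset ht
  have := setIntegral_mono_on (integrableOn_slice hΩ h3.continuousOn h.subset ht)
    ((i1.const_mul (2 * mu1 + L)).add (i2.const_mul L)) hΩ.isOpen.measurableSet hp
  refine this.trans (le_of_eq ?_)
  simp only [Pi.add_apply]
  rw [integral_add (i1.const_mul _) (i2.const_mul _), integral_const_mul, integral_const_mul, hF0,
    mul_zero, add_zero]

/-- After integration by parts of the cross term, the total coefficient of `|u|²` is `(d - 1)² - 2d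
(d - 1) = -(d - 1)(d + 1) ≤ 0`. It can be dropped, and Cauchy–Schwarz bounds the remaining
first-order square. -/
theorem mult_sq_le (h : SolutionData Ω O T rho mu lam U) (hΩ : IsC2Domain Ω φ) (hd : 1 ≤ d)
    {M : ℝ} {t : ℝ} (ht : t ∈ Icc 0 T)
    (hM : ∀ x ∈ closure Ω, ∑ k, pos x0 k (t, x) ^ 2 ≤ M ^ 2) :
    ∫ x in Ω, ∑ i, mult x0 U i (t, x) * mult x0 U i (t, x) ≤
      4 * M ^ 2 * ∫ x in Ω, ∑ i, ∑ j, grad U i j (t, x) * grad U i j (t, x) := by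
  have h1 := h.disp_one
  have h2 := h.grad
  have h3 := fun k => (contDiff_pos x0 k).contDiffOn (s := O)
  have h4 := fun i => (h.mult (x0 := x0) i).continuousOn
  set F : Fin d → SpaceTime d → ℝ := fun j z => pos x0 j z * ∑ i, U i z * U i z with hF
  have hFc : ∀ j, ContDiffOn ℝ 1 (F j) O := fun j => by simp only [hF]; fun_prop
  have hF0 := integral_dirD_eq_zero hΩ h.isOpen h.subset hFc ht fun x hx j => by
    simp [hF, h.boundary_closed t ht x hx]
  have hp : ∀ x ∈ Ω, ∑ i, mult x0 U i (t, x) * mult x0 U i (t, x) ≤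
      4 * M ^ 2 * (∑ i, ∑ j, grad U i j (t, x) * grad U i j (t, x)) +
        2 * ((d : ℝ) - 1) * ∑ j, dirD (eX j) (F j) (t, x) := fun x hx => by
    have hm := h.mem ht (subset_closure hx)
    rw [h.sum_dirD_pos_mul_sq hm]
    have e1 : ∑ i, mult x0 U i (t, x) * mult x0 U i (t, x) =
        4 * (∑ i, (∑ k, pos x0 k (t, x) * grad U i k (t, x)) ^ 2) +
        4 * ((d : ℝ) - 1) * (∑ i, U i (t, x) * ∑ k, pos x0 k (t, x) * grad U i k (t, x)) +
        ((d : ℝ) - 1) ^ 2 * ∑ i, U i (t, x) * U i (t, x) := by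
      simp only [Finset.mul_sum (s := Finset.univ) (f := fun i => (∑ k, _) ^ 2),
        Finset.mul_sum (s := Finset.univ) (f := fun i => U i (t, x) * ∑ k, _),
        Finset.mul_sum (s := Finset.univ) (f := fun i => U i (t, x) * U i (t, x)),
        ← Finset.sum_add_distrib]
      refine Finset.sum_congr rfl fun i _ => ?_
      simp only [mult]
      ring
    have e2 : ∑ i, (∑ k, pos x0 k (t, x) * grad U i k (t, x)) ^ 2 ≤
        M ^ 2 * ∑ i, ∑ j, grad U i j (t, x) * grad U i j (t, x) := by
      rw [Finset.mul_sum]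
      refine Finset.sum_le_sum fun i _ => ?_
      refine (Finset.sum_mul_sq_le_sq_mul_sq _ _ _).trans ?_
      simp only [← sq]
      exact mul_le_mul_of_nonneg_right (hM x (subset_closure hx))
        (Finset.sum_nonneg fun j _ => sq_nonneg _)
    have hd' : (1 : ℝ) ≤ d := by exact_mod_cast hd
    have e3 : 0 ≤ ∑ i, U i (t, x) * U i (t, x) := Finset.sum_nonneg fun i _ => mul_self_nonneg _
    rw [e1]
    have e4 : 0 ≤ ((d : ℝ) - 1) * ((d : ℝ) + 1) * ∑ i, U i (t, x) * U i (t, x) :=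
      mul_nonneg (mul_nonneg (by linarith) (by linarith)) e3
    nlinarith
  have hG : ContinuousOn (fun z => ∑ i, ∑ j, grad U i j z * grad U i j z) O := by
    have h2' := fun i j => (h.grad i j).continuousOn
    fun_prop
  have hDF : ContinuousOn (fun z => ∑ j, dirD (eX j) (F j) z) O :=
    continuousOn_finsetSum _ fun j _ => continuousOn_dirD h.isOpen (hFc j) _
  have hMM : ContinuousOn (fun z => ∑ i, mult x0 U i z * mult x0 U i z) O := by fun_prop
  have i1 := integrableOn_slice hΩ hG h.subset ht
  have i2 := integrableOn_slice hΩ hDF h.subset ht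
  have := setIntegral_mono_on (integrableOn_slice hΩ hMM h.subset ht)
    ((i1.const_mul (4 * M ^ 2)).add (i2.const_mul (2 * ((d : ℝ) - 1))))
    hΩ.isOpen.measurableSet hp
  refine this.trans (le_of_eq ?_)
  simp only [Pi.add_apply]
  rw [integral_add (i1.const_mul _) (i2.const_mul _), integral_const_mul, integral_const_mul, hF0,
    mul_zero, add_zero]

/-- Young's inequality `ρ |v·m| ≤ (ρ² |v|² + |m|²) / 2` with `ρ² ≤ ρ₁ ρ`. The two coefficients
become the two entries of `C₂` once coercivity is applied to the gradient term. -/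
theorem abs_multiplier_le (h : SolutionData Ω O T rho mu lam U) (hΩ : IsC2Domain Ω φ)
    (hd : 1 ≤ d) {M rho1 : ℝ} {t : ℝ} (ht : t ∈ Icc 0 T)
    (hM : ∀ x ∈ closure Ω, ∑ k, pos x0 k (t, x) ^ 2 ≤ M ^ 2)
    (hrho : ∀ x ∈ closure Ω, 0 ≤ rho (t, x) ∧ rho (t, x) ≤ rho1) :
    |∫ x in Ω, rho (t, x) * ∑ i, vel U i (t, x) * mult x0 U i (t, x)| ≤
      rho1 / 2 * (∫ x in Ω, rho (t, x) * ∑ i, vel U i (t, x) * vel U i (t, x)) +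
      2 * M ^ 2 * ∫ x in Ω, ∑ i, ∑ j, grad U i j (t, x) * grad U i j (t, x) := by
  have h0 := h.contDiffOn_rho.continuousOn
  have h4 := fun i => (h.mult (x0 := x0) i).continuousOn
  have h5 := fun i => (h.vel i).continuousOn
  have hp : ∀ x ∈ Ω, |rho (t, x) * ∑ i, vel U i (t, x) * mult x0 U i (t, x)| ≤
      rho1 / 2 * (rho (t, x) * ∑ i, vel U i (t, x) * vel U i (t, x)) +
      1 / 2 * ∑ i, mult x0 U i (t, x) * mult x0 U i (t, x) := fun x hx => by
    obtain ⟨hr0, hr1⟩ := hrho x (subset_closure hx)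
    have e1 : rho1 / 2 * (rho (t, x) * ∑ i, vel U i (t, x) * vel U i (t, x)) +
        1 / 2 * ∑ i, mult x0 U i (t, x) * mult x0 U i (t, x) =
        ∑ i, (rho1 / 2 * (rho (t, x) * (vel U i (t, x) * vel U i (t, x))) +
          1 / 2 * (mult x0 U i (t, x) * mult x0 U i (t, x))) := by
      simp only [Finset.sum_add_distrib, Finset.mul_sum]
    rw [e1, Finset.mul_sum]
    refine (Finset.abs_sum_le_sum_abs _ _).trans (Finset.sum_le_sum fun i _ => ?_)
    have e2 : rho (t, x) * rho (t, x) * (vel U i (t, x) * vel U i (t, x)) ≤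
        rho1 * rho (t, x) * (vel U i (t, x) * vel U i (t, x)) :=
      mul_le_mul_of_nonneg_right (mul_le_mul_of_nonneg_right hr1 hr0) (mul_self_nonneg _)
    rw [abs_le]
    constructor
    · nlinarith [sq_nonneg (rho (t, x) * vel U i (t, x) + mult x0 U i (t, x))]
    · nlinarith [sq_nonneg (rho (t, x) * vel U i (t, x) - mult x0 U i (t, x))]
  have i1 := integrableOn_slice (f := fun z => rho z * ∑ i, vel U i z * vel U i z) hΩ
    (by fun_prop) h.subset ht
  have i2 := integrableOn_slice (f := fun z => ∑ i, mult x0 U i z * mult x0 U i z) hΩ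
    (by fun_prop) h.subset ht
  have i3 := integrableOn_slice (f := fun z => rho z * ∑ i, vel U i z * mult x0 U i z) hΩ
    (by fun_prop) h.subset ht
  refine (abs_integral_le_integral_abs).trans ((setIntegral_mono_on i3.abs
    ((i1.const_mul (rho1 / 2)).add (i2.const_mul (1 / 2))) hΩ.isOpen.measurableSet hp).trans ?_)
  simp only [Pi.add_apply]
  rw [integral_add (i1.const_mul _) (i2.const_mul _), integral_const_mul, integral_const_mul]
  have := h.mult_sq_le (x0 := x0) hΩ hd ht hM
  linarith

end SolutionData

end ElasticWave

/-! ### Boundary flux and the observability estimate. -/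

namespace ElasticWave
open Topology Filter

variable {d : ℕ} {Ω : Set (EuclideanSpace ℝ (Fin d))} {φ : EuclideanSpace ℝ (Fin d) → ℝ}
  {x0 : EuclideanSpace ℝ (Fin d)}

theorem gradient_weight (x : EuclideanSpace ℝ (Fin d)) : gradient (weight x0) x = x - x0 := by
  have h1 : HasFDerivAt (weight x0) (innerSL ℝ (x - x0)) x := by
    have h2 := (((hasFDerivAt_id x).sub_const x0).norm_sq).const_mul (1 / 2 : ℝ)
    refine (h2.congr_fderiv ?_).congr_of_eventuallyEq (Eventually.of_forall fun y => ?_)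
    · ext v
      simp
    · simp only [weight, id]
      ring
  rw [gradient, h1.fderiv]
  refine (LinearIsometryEquiv.symm_apply_eq _).2 ?_
  ext v
  simp

theorem inner_eq_sum (x y : EuclideanSpace ℝ (Fin d)) : inner ℝ x y = ∑ k, x k * y k := by
  rw [PiLp.inner_apply]
  exact Finset.sum_congr rfl fun k _ => by simp [mul_comm]

theorem inner_gradient_weight (t : ℝ) (x v : EuclideanSpace ℝ (Fin d)) :
    inner ℝ (gradient (weight x0) x) v = ∑ k, pos x0 k (t, x) * v k := by
  rw [gradient_weight, inner_eq_sum]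
  rfl

theorem sum_pos_sq (t : ℝ) (x : EuclideanSpace ℝ (Fin d)) :
    ∑ k, pos x0 k (t, x) ^ 2 = ‖gradient (weight x0) x‖ ^ 2 := by
  rw [gradient_weight, EuclideanSpace.real_norm_sq_eq]
  rfl

theorem norm_gradient_weight_le (hΩ : IsC2Domain Ω φ) {x : EuclideanSpace ℝ (Fin d)}
    (hx : x ∈ closure Ω) : ‖gradient (weight x0) x‖ ≤ maxGrad Ω (weight x0) := by
  refine le_csSup ?_ (mem_image_of_mem _ hx)
  have : ContinuousOn (fun x => ‖gradient (weight x0) x‖) (closure Ω) := by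
    simp only [gradient_weight]
    fun_prop
  exact (hΩ.isCompact_closure.image_of_continuousOn this).bddAbove

theorem maxGrad_nonneg (l : EuclideanSpace ℝ (Fin d) → ℝ) : 0 ≤ maxGrad Ω l := by
  refine Real.sSup_nonneg ?_
  rintro _ ⟨x, _, rfl⟩
  exact norm_nonneg _

theorem measurable_outwardNormal (hΩ : IsC2Domain Ω φ) : Measurable (outwardNormal φ) := by
  have h := (continuous_gradient hΩ.contDiff_one).measurable
  exact h.norm.inv.smul h

theorem measurableSet_obsBoundary (hΩ : IsC2Domain Ω φ) :
    MeasurableSet (obsBoundary Ω φ (weight x0)) := by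
  have h : Measurable fun x => inner ℝ (gradient (weight x0) x) (outwardNormal φ x) := by
    simp only [gradient_weight]
    exact (measurable_id.sub_const x0).inner (measurable_outwardNormal hΩ)
  exact isClosed_frontier.measurableSet.inter (measurableSet_lt measurable_const h)

theorem obsBoundary_subset {l : EuclideanSpace ℝ (Fin d) → ℝ} : obsBoundary Ω φ l ⊆ frontier Ω :=
  fun _ hx => hx.1

/-- The squared norm of the surface traction, as a function on space-time. -/
noncomputable def tracSq (φ : EuclideanSpace ℝ (Fin d) → ℝ) (mu lam : SpaceTime d → ℝ)
    (U : Fin d → SpaceTime d → ℝ) (p : SpaceTime d) : ℝ :=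
  ∑ i, (∑ j, sig mu lam U i j p * outwardNormal φ p.2 j) *
    (∑ j, sig mu lam U i j p * outwardNormal φ p.2 j)

theorem tracSq_nonneg (φ : EuclideanSpace ℝ (Fin d) → ℝ) (mu lam : SpaceTime d → ℝ)
    (U : Fin d → SpaceTime d → ℝ) (p : SpaceTime d) : 0 ≤ tracSq φ mu lam U p :=
  Finset.sum_nonneg fun _ _ => mul_self_nonneg _

namespace SolutionData

variable {O : Set (SpaceTime d)} {T : ℝ} {rho mu lam : SpaceTime d → ℝ}
  {U : Fin d → SpaceTime d → ℝ}

theorem continuousOn_tracSq (h : SolutionData Ω O T rho mu lam U) (hΩ : IsC2Domain Ω φ) :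
    ContinuousOn (tracSq φ mu lam U) (Icc 0 T ×ˢ frontier Ω) := by
  have hsub : Icc 0 T ×ˢ frontier Ω ⊆ O :=
    (prod_mono subset_rfl frontier_subset_closure).trans h.subset
  have h1 := fun i j => (h.sig i j).continuousOn.mono hsub
  have h2 : ContinuousOn (outwardNormal φ) (frontier Ω) :=
    (continuousOn_outwardNormal hΩ.contDiff_one).mono fun x hx =>
      mt fderiv_eq_zero_iff_gradient.2 (hΩ.fderiv_ne hx)
  have h3 : ∀ j, ContinuousOn (fun p : SpaceTime d => outwardNormal φ p.2 j)
      (Icc 0 T ×ˢ frontier Ω) := fun j =>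
    (EuclideanSpace.proj j : EuclideanSpace ℝ (Fin d) →L[ℝ] ℝ).continuous.comp_continuousOn
      (h2.comp continuousOn_snd fun p hp => hp.2)
  have h4 : ∀ i, ContinuousOn (fun p => ∑ j, sig mu lam U i j p * outwardNormal φ p.2 j)
      (Icc 0 T ×ˢ frontier Ω) := fun i => continuousOn_finsetSum _ fun j _ => (h1 i j).mul (h3 j)
  exact continuousOn_finsetSum _ fun i _ => (h4 i).mul (h4 i)

theorem flux_normal_le (h : SolutionData Ω O T rho mu lam U) (hΩ : IsC2Domain Ω φ) {mu0 : ℝ}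
    (hmu0 : 0 < mu0) {t : ℝ} (ht : t ∈ Icc 0 T) {x : EuclideanSpace ℝ (Fin d)}
    (hx : x ∈ frontier Ω) (hmu : mu0 ≤ mu (t, x)) (hml : 0 ≤ mu (t, x) + lam (t, x)) :
    ENNReal.ofReal (∑ j, flux rho mu lam U x0 j (t, x) * outwardNormal φ x j) ≤
      (obsBoundary Ω φ (weight x0)).indicator (fun x => ENNReal.ofReal
        (maxGrad Ω (weight x0) / mu0 * tracSq φ mu lam U (t, x))) x := by
  have hm := h.mem ht (frontier_subset_closure hx)
  have hgx : gradient φ x ≠ 0 := mt fderiv_eq_zero_iff_gradient.2 (hΩ.fderiv_ne hx)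
  have hn := sum_outwardNormal_mul_self hgx
  have hex : ∀ i, ∃ c : ℝ, ∀ j, grad U i j (t, x) = c * outwardNormal φ x j := fun i => by
    have h1 : ContDiffAt ℝ 1 (fun y => U i (t, y)) x :=
      ((h.disp_one i).contDiffAt (h.isOpen.mem_nhds hm)).comp x (by fun_prop)
    obtain ⟨c, hc⟩ := exists_pderiv_eq_mul_normal hΩ hx h1
      fun y hy => h.boundary_closed t ht y hy i
    refine ⟨c, fun j => ?_⟩
    rw [← hc j, pderiv_slice (h.diff (h.disp_one i) hm)]
    rfl
  choose c hc using hex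
  have hmu' : 0 < mu (t, x) := hmu0.trans_le hmu
  obtain ⟨ha1, ha2⟩ := traction_algebra (A := fun i j => grad U i j (t, x)) hmu'.le hml hn hc
  change 0 ≤ mu (t, x) * strain mu lam U (t, x) at ha1
  change mu (t, x) * strain mu lam U (t, x) ≤ tracSq φ mu lam U (t, x) at ha2
  have hs0 : 0 ≤ strain mu lam U (t, x) := nonneg_of_mul_nonneg_right ha1 hmu'
  set κ := inner ℝ (gradient (weight x0) x) (outwardNormal φ x) with hκ
  -- On the boundary `u` and `∂_t u` vanish and `m = 2 (∇l·ν) c`. The stress term contributes `2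
  -- (∇l·ν) σ : ∇u`, and the elastic density takes one copy back.
  have hflux : ∑ j, flux rho mu lam U x0 j (t, x) * outwardNormal φ x j =
      κ * strain mu lam U (t, x) := by
    rw [hκ, inner_gradient_weight t]
    set m := ∑ k, pos x0 k (t, x) * outwardNormal φ x k with hmdef
    have e1 : ∀ i, mult x0 U i (t, x) = 2 * (c i * m) := fun i => by
      simp only [mult, h.boundary_closed t ht x hx, mul_zero, add_zero, hc]
      rw [hmdef, Finset.mul_sum (a := c i)]
      congr 1
      exact Finset.sum_congr rfl fun k _ => by ring
    have e2 : ∀ j, flux rho mu lam U x0 j (t, x) * outwardNormal φ x j =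
        2 * m * (∑ i, sig mu lam U i j (t, x) * grad U i j (t, x)) -
          strain mu lam U (t, x) * (pos x0 j (t, x) * outwardNormal φ x j) := fun j => by
      simp only [flux, h.boundary_vel t ht x hx, mul_zero, Finset.sum_const_zero, add_zero, e1]
      rw [sub_mul, Finset.sum_mul, Finset.mul_sum]
      congr 1
      · exact Finset.sum_congr rfl fun i _ => by rw [hc]; ring
      · ring
    simp only [e2, Finset.sum_sub_distrib, ← Finset.mul_sum]
    rw [Finset.sum_comm, ← hmdef, show ∑ i, ∑ j, sig mu lam U i j (t, x) * grad U i j (t, x) =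
      strain mu lam U (t, x) from rfl]
    ring
  rw [hflux]
  by_cases hΓ : x ∈ obsBoundary Ω φ (weight x0)
  · rw [indicator_of_mem hΓ]
    refine ENNReal.ofReal_le_ofReal ?_
    have hκM : κ ≤ maxGrad Ω (weight x0) := by
      refine (real_inner_le_norm _ _).trans ?_
      rw [outwardNormal, norm_smul, norm_inv, norm_norm,
        inv_mul_cancel₀ (norm_ne_zero_iff.2 hgx), mul_one]
      exact norm_gradient_weight_le hΩ (frontier_subset_closure hx)
    have hM := maxGrad_nonneg (Ω := Ω) (weight x0)
    calc κ * strain mu lam U (t, x) ≤ maxGrad Ω (weight x0) * strain mu lam U (t, x) :=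
          mul_le_mul_of_nonneg_right hκM hs0
      _ = maxGrad Ω (weight x0) / mu0 * (mu0 * strain mu lam U (t, x)) := by field_simp
      _ ≤ _ := by
          refine mul_le_mul_of_nonneg_left ?_ (by positivity)
          exact (mul_le_mul_of_nonneg_right hmu hs0).trans ha2
  · rw [indicator_of_notMem hΓ]
    have : κ ≤ 0 := not_lt.1 fun hlt => hΓ ⟨hx, hlt⟩
    rw [ENNReal.ofReal_of_nonpos (mul_nonpos_of_nonpos_of_nonneg this hs0)]

theorem integral_flux_le (h : SolutionData Ω O T rho mu lam U) (hΩ : IsC2Domain Ω φ) {mu0 : ℝ}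
    (hmu0 : 0 < mu0) {t : ℝ} (ht : t ∈ Icc 0 T) (hmu : ∀ x ∈ closure Ω, mu0 ≤ mu (t, x))
    (hml : ∀ x ∈ closure Ω, 0 ≤ mu (t, x) + lam (t, x)) :
    ∫ x in Ω, ∑ j, dirD (eX j) (flux rho mu lam U x0 j) (t, x) ≤
      maxGrad Ω (weight x0) / mu0 * ∫ x in obsBoundary Ω φ (weight x0), tracSq φ mu lam U (t, x)
        ∂(Measure.euclideanHausdorffMeasure (d - 1)) := by
  set H : Measure (EuclideanSpace ℝ (Fin d)) := Measure.euclideanHausdorffMeasure (d - 1) with hH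
  set Γ := obsBoundary Ω φ (weight x0) with hΓ
  have hfr : MeasurableSet (frontier Ω) := isClosed_frontier.measurableSet
  have hM := maxGrad_nonneg (Ω := Ω) (weight x0)
  have hint : IntegrableOn (fun x => tracSq φ mu lam U (t, x)) Γ H := by
    have hc : ContinuousOn (fun x => tracSq φ mu lam U (t, x)) (frontier Ω) :=
      (h.continuousOn_tracSq hΩ).comp (by fun_prop) fun x hx => ⟨ht, hx⟩
    obtain ⟨C, hC⟩ := hΩ.isCompact_frontier.exists_bound_of_continuousOn hc
    have hfin : IsFiniteMeasure (H.restrict (frontier Ω)) :=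
      ⟨by rw [Measure.restrict_apply_univ]; exact hΩ.hausdorff_frontier_lt_top⟩
    refine IntegrableOn.mono_set (t := frontier Ω) ?_ obsBoundary_subset
    exact Integrable.of_bound (hc.aestronglyMeasurable hfr) C
      ((ae_restrict_mem hfr).mono fun x hx => hC x hx)
  have hle := ofReal_integral_dirD_le hΩ h.isOpen h.subset
    (F := fun j => flux rho mu lam U x0 j) (fun j => h.flux j) ht
  have hle2 : ENNReal.ofReal (∫ x in Ω, ∑ j, dirD (eX j) (flux rho mu lam U x0 j) (t, x)) ≤
      ENNReal.ofReal (maxGrad Ω (weight x0) / mu0 * ∫ x in Γ, tracSq φ mu lam U (t, x) ∂H) := by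
    refine hle.trans ((setLIntegral_mono' hfr fun x hx => h.flux_normal_le hΩ hmu0 ht hx
      (hmu x (frontier_subset_closure hx)) (hml x (frontier_subset_closure hx))).trans ?_)
    rw [setLIntegral_indicator (measurableSet_obsBoundary hΩ),
      inter_eq_self_of_subset_left obsBoundary_subset, ← integral_const_mul,
      ofReal_integral_eq_lintegral_ofReal (hint.const_mul _)]
    exact Eventually.of_forall fun x => mul_nonneg (by positivity) (tracSq_nonneg _ _ _ _ _)
  -- The truncation by `ENNReal.ofReal` is harmless because the right-hand side is nonnegative.
  refine (ENNReal.ofReal_le_ofReal_iff ?_).1 hle2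
  exact mul_nonneg (by positivity) (integral_nonneg fun x => tracSq_nonneg _ _ _ _ _)

theorem continuousOn_strainDeriv (h : SolutionData Ω O T rho mu lam U) (v : SpaceTime d) :
    ContinuousOn (strainDeriv mu lam U v) O := by
  have h1 := fun i j => (h.grad i j).continuousOn
  have h2 := continuousOn_dirD h.isOpen h.contDiffOn_mu v
  have h3 := continuousOn_dirD h.isOpen h.contDiffOn_lam v
  have h4 : ∀ i j, ContinuousOn (fun p => lameTensor (dirD v mu p) (dirD v lam p)
      (fun i j => grad U i j p) i j) O := fun i j => by
    unfold lameTensor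
    split_ifs <;> fun_prop
  unfold strainDeriv
  fun_prop

/-- The observability estimate in terms of space-time functions. -/
theorem observability (h : SolutionData Ω O T rho mu lam U) (hΩ : IsC2Domain Ω φ) (hd : 1 ≤ d)
    {rho1 rho2 mu0 mu1 L c0 c1 : ℝ} (hmu0 : 0 < mu0) (hrho2 : 0 < rho2) (hc0 : 0 < c0)
    (hc1 : 0 < c1)
    (hrho : ∀ t ∈ Icc 0 T, ∀ x ∈ closure Ω, 0 ≤ rho (t, x) ∧ rho (t, x) ≤ rho1)
    (hmu : ∀ t ∈ Icc 0 T, ∀ x ∈ closure Ω, mu0 ≤ mu (t, x) ∧ mu (t, x) ≤ mu1)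
    (hml : ∀ t ∈ Icc 0 T, ∀ x ∈ closure Ω, 0 ≤ mu (t, x) + lam (t, x))
    (hlam : ∀ t ∈ Icc 0 T, ∀ x ∈ closure Ω, |lam (t, x)| ≤ L)
    (hrw : ∀ t ∈ Icc 0 T, ∀ x ∈ closure Ω,
      rho2 * rho (t, x) ≤ rho (t, x) + ∑ k, pos x0 k (t, x) * dirD (eX k) rho (t, x))
    (hcoer : ∀ t ∈ Icc 0 T, c0 * ∫ x in Ω, ∑ i, ∑ j, grad U i j (t, x) * grad U i j (t, x) ≤
      ∫ x in Ω, strain mu lam U (t, x))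
    (hcoer' : ∀ t ∈ Icc 0 T, c1 * ∫ x in Ω, ∑ i, ∑ j, grad U i j (t, x) * grad U i j (t, x) ≤
      ∫ x in Ω, (strain mu lam U (t, x) -
        ∑ k, strainDeriv mu lam U (eX k) (t, x) * pos x0 k (t, x))) :
    (T * constC0 rho2 c1 - 2 * constC2 rho1 c0 (maxGrad Ω (weight x0)) * max 1 (2 * mu1 + L)) *
      (∫ x in Ω, (rho (0, x) * (∑ i, vel U i (0, x) * vel U i (0, x)) +
        strain mu lam U (0, x))) ≤
      max 1 (2 * mu1 + L) * (maxGrad Ω (weight x0) / mu0) *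
        ∫ t in (0 : ℝ)..T, ∫ x in obsBoundary Ω φ (weight x0), tracSq φ mu lam U (t, x)
          ∂(Measure.euclideanHausdorffMeasure (d - 1)) := by
  set M := maxGrad Ω (weight x0) with hM
  set C3 := max 1 (2 * mu1 + L) with hC3
  set C2 := constC2 rho1 c0 M with hC2
  set C0 := constC0 rho2 c1 with hC0
  set E := ∫ x in Ω, (rho (0, x) * (∑ i, vel U i (0, x) * vel U i (0, x)) +
        strain mu lam U (0, x)) with hE
  set Φ : ℝ → ℝ := fun t => ∫ x in obsBoundary Ω φ (weight x0), tracSq φ mu lam U (t, x)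
          ∂(Measure.euclideanHausdorffMeasure (d - 1)) with hΦ
  have hC3p : 0 < C3 := lt_of_lt_of_le one_pos (le_max_left _ _)
  have hC0p : 0 ≤ C0 := (lt_min hrho2 hc1).le
  have h0 := h.contDiffOn_rho
  have h1 := fun i => h.mult (x0 := x0) i
  have h2 := h.vel
  have h3 := h.strain.continuousOn
  have h4 := h.continuousOn_strainDeriv
  have h5 := fun k => (contDiff_pos x0 k).continuous.continuousOn (s := O)
  have hcK : ContinuousOn (fun z => rho z * ∑ i, vel U i z * vel U i z) O :=
    h0.continuousOn.mul (continuousOn_finsetSum _ fun i _ =>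
      (h2 i).continuousOn.mul (h2 i).continuousOn)
  have hKn : ∀ t ∈ Icc 0 T, 0 ≤ ∫ x in Ω, rho (t, x) * ∑ i, vel U i (t, x) * vel U i (t, x) :=
    fun t ht => setIntegral_nonneg hΩ.isOpen.measurableSet fun x hx =>
      mul_nonneg (hrho t ht x (subset_closure hx)).1
        (Finset.sum_nonneg fun i _ => mul_self_nonneg _)
  have hNn : ∀ t, 0 ≤ ∫ x in Ω, ∑ i, ∑ j, grad U i j (t, x) * grad U i j (t, x) := fun t =>
    integral_nonneg fun x => Finset.sum_nonneg fun i _ => Finset.sum_nonneg fun j _ =>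
      mul_self_nonneg _
  have hEt : ∀ t ∈ Icc 0 T, E = (∫ x in Ω, rho (t, x) * ∑ i, vel U i (t, x) * vel U i (t, x)) +
      ∫ x in Ω, strain mu lam U (t, x) := fun t ht => by
    rw [hE, ← h.energy_eq hΩ ht]
    exact integral_add (integrableOn_slice hΩ hcK h.subset ht)
      (integrableOn_slice hΩ h3 h.subset ht)
  set X : SpaceTime d → ℝ := fun z => rho z * ∑ i, vel U i z * mult x0 U i z with hX
  have hXc : ContDiffOn ℝ 1 X O := by simp only [hX]; fun_prop
  have hXb : ∀ t ∈ Icc 0 T, |∫ x in Ω, X (t, x)| ≤ C2 * E := fun t ht => by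
    refine (h.abs_multiplier_le hΩ hd ht (M := M) (fun x hx => ?_) (hrho t ht)).trans ?_
    · rw [sum_pos_sq]
      exact pow_le_pow_left₀ (norm_nonneg _) (norm_gradient_weight_le hΩ hx) 2
    · rw [hEt t ht, mul_add]
      have e1 := hcoer t ht
      have e2 := hKn t ht
      have e3 := hNn t
      set K := ∫ x in Ω, rho (t, x) * ∑ i, vel U i (t, x) * vel U i (t, x)
      set N := ∫ x in Ω, ∑ i, ∑ j, grad U i j (t, x) * grad U i j (t, x)
      set B := ∫ x in Ω, strain mu lam U (t, x)
      have hB : 0 ≤ B := (mul_nonneg hc0.le e3).trans e1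
      refine add_le_add (mul_le_mul_of_nonneg_right (le_max_left _ _) e2) ?_
      calc 2 * M ^ 2 * N = 2 * c0⁻¹ * M ^ 2 * (c0 * N) := by field_simp
        _ ≤ 2 * c0⁻¹ * M ^ 2 * B := mul_le_mul_of_nonneg_left e1 (by positivity)
        _ ≤ _ := mul_le_mul_of_nonneg_right (le_max_right _ _) hB
  have hXd := integral_slice_sub hΩ h.isOpen h.subset hXc ⟨h.pos_time.le, le_rfl⟩
  -- The estimate at a fixed time: boundary observation minus a fixed fraction of the conserved
  -- energy. Time integration then gives `T C₀ E / C₃` against endpoint terms of total size at most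
  -- `2 C₂ E`.
  have hY : ∀ t ∈ Icc 0 T, ∫ x in Ω, dirD eT X (t, x) ≤ M / mu0 * Φ t - C0 * E / C3 :=
    fun t ht => by
    have hcF : ContinuousOn (fun z => ∑ j, dirD (eX j) (flux rho mu lam U x0 j) z) O :=
      continuousOn_finsetSum _ fun j _ => continuousOn_dirD h.isOpen (h.flux j) _
    have hcS : ContinuousOn (fun z => strain mu lam U z -
        ∑ k, strainDeriv mu lam U (eX k) z * pos x0 k z) O := by fun_prop
    have iF := integrableOn_slice hΩ hcF h.subset ht
    have iS := integrableOn_slice hΩ hcS h.subset ht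
    have iK := integrableOn_slice hΩ hcK h.subset ht
    have hle := setIntegral_mono_on
      (integrableOn_slice hΩ (continuousOn_dirD h.isOpen hXc eT) h.subset ht)
      ((iF.sub (iK.const_mul rho2)).sub iS) hΩ.isOpen.measurableSet fun x hx => by
        have hx' := subset_closure hx
        rw [hX, h.dirD_multiplier (h.mem ht hx') (h.wave_closed t ht x hx')]
        simp only [Pi.sub_apply]
        have := mul_le_mul_of_nonneg_right (hrw t ht x hx')
          (Finset.sum_nonneg fun i _ => mul_self_nonneg (vel U i (t, x)) :
            0 ≤ ∑ i, vel U i (t, x) * vel U i (t, x))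
        linarith
    rw [integral_sub' (iF.sub (iK.const_mul rho2)) iS, integral_sub' iF (iK.const_mul rho2),
      integral_const_mul] at hle
    have e0 := h.integral_flux_le (x0 := x0) hΩ hmu0 ht (fun x hx => (hmu t ht x hx).1) (hml t ht)
    have e1 := hcoer' t ht
    have e2 := hKn t ht
    have e3 := hNn t
    have e4 := h.strain_le hΩ (mu1 := mu1) (L := L) ht (fun x hx =>
      ⟨hmu0.le.trans (hmu t ht x hx).1, (hmu t ht x hx).2⟩) (hlam t ht)
    have e5 := hEt t ht
    set K := ∫ x in Ω, rho (t, x) * ∑ i, vel U i (t, x) * vel U i (t, x)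
    set N := ∫ x in Ω, ∑ i, ∑ j, grad U i j (t, x) * grad U i j (t, x)
    set B := ∫ x in Ω, strain mu lam U (t, x)
    -- The energy is compared with `K + N`, because the second coercivity condition controls `|∇u|²`
    -- rather than the elastic density.
    have e6 : E ≤ C3 * (K + N) := by
      have f1 : 1 * K ≤ C3 * K := mul_le_mul_of_nonneg_right (le_max_left _ _) e2
      have f2 : (2 * mu1 + L) * N ≤ C3 * N := mul_le_mul_of_nonneg_right (le_max_right _ _) e3
      linarith
    have e7 : C0 * E / C3 ≤ rho2 * K + c1 * N := by
      have f1 : C0 * K ≤ rho2 * K := mul_le_mul_of_nonneg_right (min_le_left _ _) e2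
      have f2 : C0 * N ≤ c1 * N := mul_le_mul_of_nonneg_right (min_le_right _ _) e3
      have f3 : C0 * E / C3 ≤ C0 * (K + N) := by
        rw [div_le_iff₀ hC3p]
        have := mul_le_mul_of_nonneg_left e6 hC0p
        linarith
      linarith
    change _ ≤ M / mu0 * Φ t at e0
    linarith
  have hΦc : ContinuousOn Φ (Icc 0 T) :=
    continuousOn_setIntegral_slice hΩ.isCompact_frontier (measurableSet_obsBoundary hΩ)
      obsBoundary_subset
      ((measure_mono obsBoundary_subset).trans_lt hΩ.hausdorff_frontier_lt_top).ne
      (h.continuousOn_tracSq hΩ)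
  have hYc := continuousOn_integral_slice hΩ (continuousOn_dirD h.isOpen hXc eT) h.subset
  have hT := h.pos_time
  have hJi : IntervalIntegrable (fun t => M / mu0 * Φ t) volume 0 T :=
    (continuousOn_const.mul hΦc).intervalIntegrable_of_Icc hT.le
  have hmono := intervalIntegral.integral_mono_on hT.le
    (hYc.intervalIntegrable_of_Icc hT.le)
    (hJi.sub (intervalIntegrable_const (c := C0 * E / C3))) hY
  rw [← hXd, intervalIntegral.integral_sub hJi intervalIntegrable_const,
    intervalIntegral.integral_const_mul, intervalIntegral.integral_const, smul_eq_mul, sub_zero]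
    at hmono
  have hX0 := (abs_le.1 (hXb 0 ⟨le_rfl, hT.le⟩)).2
  have hXT := (abs_le.1 (hXb T ⟨hT.le, le_rfl⟩)).1
  set J := ∫ t in (0 : ℝ)..T, Φ t
  have hfin : T * (C0 * E / C3) - 2 * C2 * E ≤ M / mu0 * J := by linarith
  have hfin2 := mul_le_mul_of_nonneg_left hfin hC3p.le
  calc _ = C3 * (T * (C0 * E / C3) - 2 * C2 * E) := by field_simp
    _ ≤ _ := hfin2
    _ = _ := by ring

end SolutionData

end ElasticWave

/-! ### Translation between vector fields and space-time components. -/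

namespace ElasticWave
open Topology Filter

variable {d : ℕ} {Ω : Set (EuclideanSpace ℝ (Fin d))} {φ : EuclideanSpace ℝ (Fin d) → ℝ}

/-- The components of a time-dependent vector field, as functions on space-time. -/
def comps (u : ℝ → EuclideanSpace ℝ (Fin d) → EuclideanSpace ℝ (Fin d)) (i : Fin d)
    (p : SpaceTime d) : ℝ := u p.1 p.2 i

/-- A function of the space variable, as a function on space-time. -/
def lift (f : EuclideanSpace ℝ (Fin d) → ℝ) (p : SpaceTime d) : ℝ := f p.2

theorem dirD_lift {f : EuclideanSpace ℝ (Fin d) → ℝ} {p : SpaceTime d}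
    (hf : DifferentiableAt ℝ f p.2) (v : SpaceTime d) :
    dirD v (lift f) p = fderiv ℝ f p.2 v.2 := dirD_comp_snd hf

theorem dirD_eX_lift {f : EuclideanSpace ℝ (Fin d) → ℝ} {p : SpaceTime d}
    (hf : DifferentiableAt ℝ f p.2) (j : Fin d) :
    dirD (eX j) (lift f) p = pderiv j f p.2 := dirD_lift hf _

theorem ddot_stress_eq (a b : ℝ) (v : EuclideanSpace ℝ (Fin d) → EuclideanSpace ℝ (Fin d))
    (x : EuclideanSpace ℝ (Fin d)) :
    ddot (stress a b v x) (gradT v x) =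
      ∑ i, ∑ j, lameTensor a b (fun i j => gradT v x i j) i j * gradT v x i j := by
  refine Finset.sum_congr rfl fun i _ => Finset.sum_congr rfl fun j _ => ?_
  congr 1
  simp only [stress, lameTensor, Matrix.add_apply, Matrix.smul_apply, Matrix.transpose_apply,
    Matrix.one_apply, smul_eq_mul, mul_ite, mul_one, mul_zero]
  rfl

theorem hasDerivAt_of_components {f : ℝ → EuclideanSpace ℝ (Fin d)} {f' : Fin d → ℝ} {t : ℝ}
    (h : ∀ i, HasDerivAt (fun s => f s i) (f' i) t) : HasDerivAt f (WithLp.toLp 2 f') t := by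
  set L := (PiLp.continuousLinearEquiv 2 ℝ (fun _ : Fin d => ℝ)).symm.toContinuousLinearMap
  exact (L.hasFDerivAt (x := WithLp.ofLp (f t))).comp_hasDerivAt t (hasDerivAt_pi.2 h)

theorem fderiv_component {f : EuclideanSpace ℝ (Fin d) → EuclideanSpace ℝ (Fin d)}
    {x : EuclideanSpace ℝ (Fin d)} (hf : DifferentiableAt ℝ f x) (i : Fin d)
    (v : EuclideanSpace ℝ (Fin d)) : (fderiv ℝ f x v) i = fderiv ℝ (fun y => f y i) x v := by
  have h := hasFDerivWithinAt_euclidean.1 (hasFDerivWithinAt_univ.2 hf.hasFDerivAt) i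
  rw [(hasFDerivWithinAt_univ.1 h).fderiv]
  rfl

section Bridge

variable {O : Set (SpaceTime d)} {rho mu lam : EuclideanSpace ℝ (Fin d) → ℝ}
  {u : ℝ → EuclideanSpace ℝ (Fin d) → EuclideanSpace ℝ (Fin d)} {t : ℝ}
  {x : EuclideanSpace ℝ (Fin d)}

theorem gradT_eq (h : SmoothData O (lift rho) (lift mu) (lift lam) (comps u)) (hp : (t, x) ∈ O)
    (i j : Fin d) : gradT (u t) x i j = grad (comps u) i j (t, x) :=
  pderiv_slice (h.diff (h.disp_one i) hp) j

theorem divergence_eq (h : SmoothData O (lift rho) (lift mu) (lift lam) (comps u))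
    (hp : (t, x) ∈ O) : divergence (u t) x = ∑ k, grad (comps u) k k (t, x) :=
  Finset.sum_congr rfl fun k _ => gradT_eq h hp k k

theorem ddot_gradT_eq (h : SmoothData O (lift rho) (lift mu) (lift lam) (comps u))
    (hp : (t, x) ∈ O) : ddot (gradT (u t) x) (gradT (u t) x) =
      ∑ i, ∑ j, grad (comps u) i j (t, x) * grad (comps u) i j (t, x) := by
  simp only [ddot, gradT_eq h hp]

theorem ddot_stress_eq_strain (h : SmoothData O (lift rho) (lift mu) (lift lam) (comps u))
    (hp : (t, x) ∈ O) : ddot (stress (mu x) (lam x) (u t) x) (gradT (u t) x) =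
      strain (lift mu) (lift lam) (comps u) (t, x) := by
  rw [ddot_stress_eq]
  simp only [gradT_eq h hp]
  rfl

theorem hasDerivAt_disp (h : SmoothData O (lift rho) (lift mu) (lift lam) (comps u))
    (hp : (t, x) ∈ O) :
    HasDerivAt (fun s => u s x) (WithLp.toLp 2 fun i => vel (comps u) i (t, x)) t := by
  exact hasDerivAt_of_components fun i => hasDerivAt_dirD_eT (h.diff (h.disp_one i) hp)

theorem kinetic_eq (h : SmoothData O (lift rho) (lift mu) (lift lam) (comps u))
    (hp : (t, x) ∈ O) (hr : 0 ≤ rho x) :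
    ‖Real.sqrt (rho x) • deriv (fun s => u s x) t‖ ^ 2 =
      lift rho (t, x) * ∑ i, vel (comps u) i (t, x) * vel (comps u) i (t, x) := by
  rw [norm_smul, mul_pow, Real.norm_of_nonneg (Real.sqrt_nonneg _), Real.sq_sqrt hr,
    (hasDerivAt_disp h hp).deriv, EuclideanSpace.real_norm_sq_eq]
  simp only [← sq]
  rfl

theorem accel_eq (h : SmoothData O (lift rho) (lift mu) (lift lam) (comps u))
    (hp : (t, x) ∈ O) (i : Fin d) :
    (deriv (fun s => deriv (fun r => u r x) s) t) i = dirD eT (vel (comps u) i) (t, x) := by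
  -- The outer derivative needs the formula for the velocity at all nearby times, which openness of
  -- `O` supplies.
  have h1 : (fun s => deriv (fun r => u r x) s) =ᶠ[𝓝 t]
      fun s => WithLp.toLp 2 fun i => vel (comps u) i (s, x) := by
    have ho : {s | (s, x) ∈ O} ∈ 𝓝 t := (h.isOpen.preimage (by fun_prop)).mem_nhds hp
    filter_upwards [ho] with s hs using (hasDerivAt_disp h hs).deriv
  have h2 : HasDerivAt (fun s => (WithLp.toLp 2 fun i => vel (comps u) i (s, x) :
      EuclideanSpace ℝ (Fin d))) (WithLp.toLp 2 fun i => dirD eT (vel (comps u) i) (t, x)) t := by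
    exact hasDerivAt_of_components fun i => hasDerivAt_dirD_eT (h.diff (h.vel i) hp)
  rw [h1.deriv_eq, h2.deriv]

theorem elasticOp_eq (h : SmoothData O (lift rho) (lift mu) (lift lam) (comps u))
    (hp : (t, x) ∈ O) (i : Fin d) :
    elasticOp rho mu lam (u t) x i =
      (rho x)⁻¹ * ∑ j, dirD (eX j) (sig (lift mu) (lift lam) (comps u) i j) (t, x) := by
  have hU : ∀ᶠ y in 𝓝 x, (t, y) ∈ O :=
    (h.isOpen.preimage (by fun_prop : Continuous fun y => ((t, y) : SpaceTime d))).mem_nhds hp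
  have hg := fun i j => h.diff (h.grad i j) hp
  have hm := h.diff h.contDiffOn_mu hp
  have hl := h.diff h.contDiffOn_lam hp
  have e1 : ∀ j, pderiv j (fun y => mu y * (gradT (u t) y i j + gradT (u t) y j i)) x =
      dirD (eX j) (fun z => lift mu z * (grad (comps u) i j z + grad (comps u) j i z)) (t, x) :=
    fun j => by
    rw [← pderiv_slice (by fun_prop), pderiv, pderiv]
    congr 1
    refine Filter.EventuallyEq.fderiv_eq ?_
    filter_upwards [hU] with y hy
    rw [gradT_eq h hy, gradT_eq h hy]
    rfl
  have e2 : pderiv i (fun y => lam y * divergence (u t) y) x =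
      dirD (eX i) (fun z => lift lam z * ∑ k, grad (comps u) k k z) (t, x) := by
    rw [← pderiv_slice (by fun_prop), pderiv, pderiv]
    congr 1
    refine Filter.EventuallyEq.fderiv_eq ?_
    filter_upwards [hU] with y hy
    rw [divergence_eq h hy]
    rfl
  have e3 : ∀ j, dirD (eX j) (sig (lift mu) (lift lam) (comps u) i j) (t, x) =
      dirD (eX j) (fun z => lift mu z * (grad (comps u) i j z + grad (comps u) j i z)) (t, x) +
      if i = j then dirD (eX j) (fun z => lift lam z * ∑ k, grad (comps u) k k z) (t, x) else 0 :=
    fun j => by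
    rw [← dirD_ite, ← dirD_add (by fun_prop) (by split_ifs <;> fun_prop)]
    rfl
  simp only [elasticOp, e1, e2, e3, Finset.sum_add_distrib, Finset.sum_ite_eq, Finset.mem_univ,
    if_true]

theorem traction_sq_eq (h : SmoothData O (lift rho) (lift mu) (lift lam) (comps u))
    (hp : (t, x) ∈ O) :
    ‖traction mu lam (u t) (outwardNormal φ x) x‖ ^ 2 =
      tracSq φ (lift mu) (lift lam) (comps u) (t, x) := by
  rw [EuclideanSpace.real_norm_sq_eq]
  refine Finset.sum_congr rfl fun i _ => ?_
  rw [sq]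
  have e0 : DifferentiableAt ℝ (u t) x := differentiableAt_euclidean.2 fun i =>
    (hasFDerivAt_slice (h.diff (h.disp_one i) hp)).differentiableAt
  have e1 : (fderiv ℝ (u t) x (outwardNormal φ x)) i =
      ∑ j, grad (comps u) i j (t, x) * outwardNormal φ x j := by
    rw [fderiv_component e0]
    conv_lhs => rw [← (EuclideanSpace.basisFun (Fin d) ℝ).sum_repr (outwardNormal φ x)]
    rw [map_sum]
    refine Finset.sum_congr rfl fun j _ => ?_
    rw [map_smul, smul_eq_mul, mul_comm, ← gradT_eq h hp]
    simp [gradT, pderiv]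
  have e2 : (traction mu lam (u t) (outwardNormal φ x) x) i =
      ∑ j, sig (lift mu) (lift lam) (comps u) i j (t, x) * outwardNormal φ x j := by
    simp only [traction, PiLp.add_apply, PiLp.smul_apply, smul_eq_mul, e1, Matrix.mulVec,
      dotProduct, Matrix.transpose_apply, gradT_eq h hp, divergence_eq h hp, sig, lameTensor,
      add_mul, mul_add, ite_mul, zero_mul, Finset.sum_add_distrib, Finset.sum_ite_eq,
      Finset.mem_univ, if_true, Finset.mul_sum, mul_assoc, lift]
  rw [e2]

end Bridge

theorem exists_smoothData {T : ℝ} {rho mu lam : EuclideanSpace ℝ (Fin d) → ℝ}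
    (hrho : ContDiffNear ∞ rho (closure Ω)) (hmu : ContDiffNear 1 mu (closure Ω))
    (hlam : ContDiffNear 1 lam (closure Ω))
    {u : ℝ → EuclideanSpace ℝ (Fin d) → EuclideanSpace ℝ (Fin d)}
    (hu : ContDiffNear 2 (fun p : ℝ × EuclideanSpace ℝ (Fin d) => u p.1 p.2)
      (Icc 0 T ×ˢ closure Ω)) :
    ∃ O : Set (SpaceTime d), Icc 0 T ×ˢ closure Ω ⊆ O ∧
      SmoothData O (lift rho) (lift mu) (lift lam) (comps u) := by
  obtain ⟨A, hA, hAs, hAr⟩ := hrho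
  obtain ⟨B, hB, hBs, hBm⟩ := hmu
  obtain ⟨C, hC, hCs, hCl⟩ := hlam
  obtain ⟨D, hD, hDs, hDu⟩ := hu
  -- A single open set on which the displacement and all the coefficients are smooth.
  set O : Set (SpaceTime d) := D ∩ Prod.snd ⁻¹' (A ∩ B ∩ C) with hO
  have hlift : ∀ {f : EuclideanSpace ℝ (Fin d) → ℝ} {S : Set (EuclideanSpace ℝ (Fin d))},
      IsOpen S → ContDiffOn ℝ 1 f S → (∀ p ∈ O, p.2 ∈ S) →
      ContDiffOn ℝ 1 (lift f) O ∧ ∀ p ∈ O, dirD eT (lift f) p = 0 := by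
    intro f S hS hf hOS
    refine ⟨hf.comp contDiff_snd.contDiffOn hOS, fun p hp => ?_⟩
    rw [dirD_lift ((hf.contDiffAt (hS.mem_nhds (hOS p hp))).differentiableAt one_ne_zero)]
    simp [eT]
  obtain ⟨r1, r2⟩ := hlift hA (hAr.of_le (by simp)) fun p hp => hp.2.1.1
  obtain ⟨m1, m2⟩ := hlift hB hBm fun p hp => hp.2.1.2
  obtain ⟨l1, l2⟩ := hlift hC hCl fun p hp => hp.2.2
  refine ⟨O, fun p hp => ⟨hDs hp, ⟨hAs hp.2, hBs hp.2⟩, hCs hp.2⟩, ?_, fun i => ?_, r1, m1, l1, r2,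
    m2, l2⟩
  · exact hD.inter (((hA.inter hB).inter hC).preimage continuous_snd)
  · exact (contDiffOn_euclidean.1 hDu i).mono inter_subset_left

end ElasticWave

/-! ### The theorem in its original variables. -/

theorem mainTheorem3 (d : ℕ) (hd : 3 ≤ d)
    (Ω : Set (EuclideanSpace ℝ (Fin d))) (φ : EuclideanSpace ℝ (Fin d) → ℝ)
    (hΩ : ElasticWave.IsC2Domain Ω φ)
    (rho mu lam : EuclideanSpace ℝ (Fin d) → ℝ)
    (hrho_smooth : ElasticWave.ContDiffNear ∞ rho (closure Ω))
    (hmu_smooth : ElasticWave.ContDiffNear 1 mu (closure Ω))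
    (hlam_smooth : ElasticWave.ContDiffNear 1 lam (closure Ω))
    (rho1 mu0 mu1 lam0 lam1 : ℝ)
    (hrho : ∀ x ∈ closure Ω, 0 < rho x ∧ rho x ≤ rho1)
    (hmu0 : 0 < mu0)
    (hmu : ∀ x ∈ closure Ω, mu0 ≤ mu x ∧ mu x ≤ mu1)
    (hlam : ∀ x ∈ closure Ω, lam0 ≤ lam x ∧ lam x ≤ lam1)
    (hlame : ∀ x ∈ closure Ω, 0 < (d : ℝ) * lam x + 2 * mu x)
    (x0 : EuclideanSpace ℝ (Fin d)) (hx0 : x0 ∉ closure Ω)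
    (rho2 : ℝ) (hrho2 : 0 < rho2)
    (hrho_weight : ∀ x ∈ closure Ω,
      rho2 < 1 + inner ℝ (gradient rho x) (gradient (ElasticWave.weight x0) x) / rho x)
    (c0 c1 : ℝ) (hc0 : 0 < c0) (hc1 : 0 < c1)
    (T : ℝ)
    (hT : 2 * ElasticWave.constC2 rho1 c0 (ElasticWave.maxGrad Ω (ElasticWave.weight x0))
        * ElasticWave.constC3 mu1 lam0 lam1 / ElasticWave.constC0 rho2 c1 < T)
    (u : ℝ → EuclideanSpace ℝ (Fin d) → EuclideanSpace ℝ (Fin d))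
    (hu : ElasticWave.IsSolution Ω T rho mu lam u)
    (hadm : ∀ t ∈ Icc 0 T,
      ElasticWave.LameAdmissible Ω mu lam (ElasticWave.weight x0) c0 c1 (u t)) :
    ElasticWave.energy Ω rho mu lam u 0 ≤
      ElasticWave.constC1 mu0 (ElasticWave.maxGrad Ω (ElasticWave.weight x0))
          * ElasticWave.constC3 mu1 lam0 lam1
        / (T * ElasticWave.constC0 rho2 c1
            - 2 * ElasticWave.constC2 rho1 c0 (ElasticWave.maxGrad Ω (ElasticWave.weight x0))
              * ElasticWave.constC3 mu1 lam0 lam1)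
        * ∫ t in (0 : ℝ)..T,
            ∫ x in ElasticWave.obsBoundary Ω φ (ElasticWave.weight x0),
              ‖ElasticWave.traction mu lam (u t) (ElasticWave.outwardNormal φ x) x‖ ^ 2
                ∂(Measure.euclideanHausdorffMeasure (d - 1)) := by
  have hΩc : ∀ x ∈ Ω, x ∈ closure Ω := fun x hx => subset_closure hx
  set M := ElasticWave.maxGrad Ω (ElasticWave.weight x0) with hM
  have hM0 : 0 ≤ M := ElasticWave.maxGrad_nonneg _
  have hC3 : 0 < ElasticWave.constC3 mu1 lam0 lam1 := lt_of_lt_of_le one_pos (le_max_left _ _)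
  have hC0 : 0 < ElasticWave.constC0 rho2 c1 := lt_min hrho2 hc1
  have hC2 : 0 ≤ ElasticWave.constC2 rho1 c0 M := le_trans (by positivity) (le_max_right _ _)
  have hT0 : 0 < T := lt_of_le_of_lt (by positivity) hT
  have hden : 0 < T * ElasticWave.constC0 rho2 c1 -
      2 * ElasticWave.constC2 rho1 c0 M * ElasticWave.constC3 mu1 lam0 lam1 := by
    rw [div_lt_iff₀ hC0] at hT
    linarith
  obtain ⟨O, hOT, hO⟩ :=
    ElasticWave.exists_smoothData hrho_smooth hmu_smooth hlam_smooth hu.contDiff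
  have hmem : ∀ t ∈ Icc 0 T, ∀ x ∈ closure Ω, (t, x) ∈ O := fun t ht x hx => hOT ⟨ht, hx⟩
  have hdiff : ∀ {k : WithTop ℕ∞} {f : EuclideanSpace ℝ (Fin d) → ℝ}, k ≠ 0 →
      ElasticWave.ContDiffNear k f (closure Ω) → ∀ x ∈ closure Ω, DifferentiableAt ℝ f x := by
    rintro k f hk ⟨A, hA, hAs, hf⟩ x hx
    exact (hf.contDiffAt (hA.mem_nhds (hAs hx))).differentiableAt hk
  have hsol : ElasticWave.SolutionData Ω O T (ElasticWave.lift rho) (ElasticWave.lift mu)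
      (ElasticWave.lift lam) (ElasticWave.comps u) :=
    { hO with
      pos_time := hT0
      subset := hOT
      wave := fun t ht x hx i => by
        have hm := hmem t (Ioo_subset_Icc_self ht) x (hΩc x hx)
        rw [← ElasticWave.accel_eq hO hm, hu.wave t ht x hx, ElasticWave.elasticOp_eq hO hm]
        exact mul_inv_cancel_left₀ (hrho x (hΩc x hx)).1.ne' _
      boundary := fun t ht x hx i => by
        simp only [ElasticWave.comps]
        rw [hu.boundary t ht x hx]
        rfl }
  have hstrain : ∀ t ∈ Icc 0 T, ∀ x ∈ Ω,
      ElasticWave.ddot (ElasticWave.stress (mu x) (lam x) (u t) x) (ElasticWave.gradT (u t) x) =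
      ElasticWave.strain (ElasticWave.lift mu) (ElasticWave.lift lam) (ElasticWave.comps u) (t, x) :=
    fun t ht x hx => ElasticWave.ddot_stress_eq_strain hO (hmem t ht x (hΩc x hx))
  have hgrad : ∀ t ∈ Icc 0 T, ∀ x ∈ Ω,
      ElasticWave.ddot (ElasticWave.gradT (u t) x) (ElasticWave.gradT (u t) x) =
      ∑ i, ∑ j, ElasticWave.grad (ElasticWave.comps u) i j (t, x) *
        ElasticWave.grad (ElasticWave.comps u) i j (t, x) :=
    fun t ht x hx => ElasticWave.ddot_gradT_eq hO (hmem t ht x (hΩc x hx))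
  have hweight : ∀ (x : EuclideanSpace ℝ (Fin d)) (t : ℝ) (k : Fin d),
      ElasticWave.pderiv k (ElasticWave.weight x0) x = ElasticWave.pos x0 k (t, x) :=
    fun x t k => by
      rw [← ElasticWave.gradient_apply, ElasticWave.gradient_weight]
      rfl
  have hstrain' : ∀ t ∈ Icc 0 T, ∀ x ∈ Ω, ∀ k,
      ElasticWave.ddot (ElasticWave.stress (ElasticWave.pderiv k mu x)
        (ElasticWave.pderiv k lam x) (u t) x) (ElasticWave.gradT (u t) x) =
      ElasticWave.strainDeriv (ElasticWave.lift mu) (ElasticWave.lift lam) (ElasticWave.comps u)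
        (ElasticWave.eX k) (t, x) := fun t ht x hx k => by
    rw [ElasticWave.ddot_stress_eq, ElasticWave.strainDeriv,
      ElasticWave.dirD_eX_lift (hdiff one_ne_zero hmu_smooth x (hΩc x hx)),
      ElasticWave.dirD_eX_lift (hdiff one_ne_zero hlam_smooth x (hΩc x hx))]
    simp only [ElasticWave.gradT_eq hO (hmem t ht x (hΩc x hx))]
  -- From `d λ + 2 μ > 0` one gets `λ > -2μ / d > -μ`. This is the sign that the rank-one boundary
  -- algebra requires.
  have hml : ∀ x ∈ closure Ω, 0 ≤ mu x + lam x := fun x hx => by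
    have h1 := hlame x hx
    have h2 : 0 < mu x := hmu0.trans_le (hmu x hx).1
    have h3 : (3 : ℝ) ≤ d := by exact_mod_cast hd
    by_contra hneg
    push Not at hneg
    nlinarith
  have h0mem : (0 : ℝ) ∈ Icc 0 T := ⟨le_rfl, hT0.le⟩
  have hms := hΩ.isOpen.measurableSet
  have key := hsol.observability (x0 := x0) hΩ (by omega : 1 ≤ d) (rho1 := rho1) (rho2 := rho2)
    (mu1 := mu1) (L := max |lam0| |lam1|) hmu0 hrho2 hc0 hc1
    (fun t _ x hx => ⟨(hrho x hx).1.le, (hrho x hx).2⟩) (fun t _ x hx => hmu x hx)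
    (fun t _ x hx => hml x hx)
    (fun t _ x hx => abs_le_max_abs_abs (hlam x hx).1 (hlam x hx).2)
    (fun t _ x hx => by
      have h1 := hrho_weight x hx
      have h2 := (hrho x hx).1
      rw [real_inner_comm, ElasticWave.inner_gradient_weight t, ← sub_lt_iff_lt_add',
        lt_div_iff₀ h2] at h1
      have h3 : ∑ k, ElasticWave.pos x0 k (t, x) *
          ElasticWave.dirD (ElasticWave.eX k) (ElasticWave.lift rho) (t, x) =
          ∑ k, ElasticWave.pos x0 k (t, x) * gradient rho x k :=
        Finset.sum_congr rfl fun k _ => by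
          rw [ElasticWave.dirD_eX_lift (hdiff (by simp) hrho_smooth x hx),
            ElasticWave.gradient_apply]
      rw [h3]
      change rho2 * rho x ≤ rho x + _
      linarith)
    (fun t ht => by
      have h1 := (hadm t ht).coercive
      rwa [setIntegral_congr_fun hms (hgrad t ht), setIntegral_congr_fun hms (hstrain t ht)] at h1)
    (fun t ht => by
      have h1 := (hadm t ht).coercive_weight
      rw [setIntegral_congr_fun hms (hgrad t ht)] at h1
      refine h1.trans (le_of_eq (setIntegral_congr_fun hms fun x hx => ?_))
      simp only [hstrain t ht x hx, hstrain' t ht x hx, hweight x t])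
  have hE : ElasticWave.energy Ω rho mu lam u 0 = ∫ x in Ω, (ElasticWave.lift rho (0, x) *
      (∑ i, ElasticWave.vel (ElasticWave.comps u) i (0, x) *
        ElasticWave.vel (ElasticWave.comps u) i (0, x)) + ElasticWave.strain
        (ElasticWave.lift mu) (ElasticWave.lift lam) (ElasticWave.comps u) (0, x)) := by
    refine setIntegral_congr_fun hms fun x hx => ?_
    rw [hstrain 0 h0mem x hx, ElasticWave.kinetic_eq hO (hmem 0 h0mem x (hΩc x hx))
      (hrho x (hΩc x hx)).1.le]
  have hJ : ∫ t in (0 : ℝ)..T, ∫ x in ElasticWave.obsBoundary Ω φ (ElasticWave.weight x0),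
        ‖ElasticWave.traction mu lam (u t) (ElasticWave.outwardNormal φ x) x‖ ^ 2
          ∂(Measure.euclideanHausdorffMeasure (d - 1)) =
      ∫ t in (0 : ℝ)..T, ∫ x in ElasticWave.obsBoundary Ω φ (ElasticWave.weight x0),
        ElasticWave.tracSq φ (ElasticWave.lift mu) (ElasticWave.lift lam)
          (ElasticWave.comps u) (t, x) ∂(Measure.euclideanHausdorffMeasure (d - 1)) := by
    refine intervalIntegral.integral_congr fun t ht => ?_
    rw [uIcc_of_le hT0.le] at ht
    refine setIntegral_congr_fun (ElasticWave.measurableSet_obsBoundary hΩ) fun x hx => ?_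
    exact ElasticWave.traction_sq_eq hO (hmem t ht x (frontier_subset_closure hx.1))
  rw [hJ, hE, div_mul_eq_mul_div, le_div_iff₀ hden, mul_comm]
  refine key.trans (mul_le_mul_of_nonneg_right ?_ ?_)
  · rw [mul_comm]
    refine mul_le_mul_of_nonneg_right ?_ hC3.le
    -- The argument produces the factor `M / μ₀`, which is bounded by `C₁` through the last entry `1
    -- / μ₀` of its maximum.
    rw [ElasticWave.constC1, ← hM, div_eq_mul_one_div, mul_comm]
    exact mul_le_mul_of_nonneg_right (le_max_right _ _) hM0
  · exact intervalIntegral.integral_nonneg hT0.le fun t _ =>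
      integral_nonneg fun x => ElasticWave.tracSq_nonneg _ _ _ _ _
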